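/- **Setting.** Let $J=(J(s))_{s\ge 0}$ be a càdlàg, irreducible continuous-time Markov chain with finite state space $\mathcal E=\{1,\dots,d\}$, generator matrix $Q$ and arbitrary initial distribution, and let $\lambda,\kappa,\mu:\mathcal E\to[0,\infty)$. For $n\in\mathbb N$ consider the infinite-server queue modulated by $J$ with arrival rate $n\lambda$ (the chain $J$ is not scaled), which is empty at time $0$. Let $\bar\tau_1<\bar\tau_2<\dots$ be the jump times of a standard Poisson process and $\bar Z_1,\bar Z_2,\dots$ i.i.d. standard exponential variables, where the Poisson process, the sequence $(\bar Z_k)$ and $J$ are independent. Job $k$ arrives at time $$\tau_k=\inf\Big\{s\ge 0: \int_0^s n\lambda(J(r))\,dr\ge\bar\tau_k\Big\}\qquad(\inf\emptyset=\infty)$$ and has service requirement $Z_k=\bar Z_k/\kappa(J(\tau_k))$ (with $Z_k=\infty$ if $\kappa(J(\tau_k))=0$). It is processed at rate $\mu(J(r))$ at time $r$. For fixed $t\ge 0$ the number of jobs in the system at time $t$ is $$M_n(t)=\#\Big\{k:\ \tau_k\le t,\ Z_k>\int_{\tau_k}^t\mu(J(r))\,dr\Big\}.$$ For a càdlàg path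 $g:[0,\infty)\to\mathcal E$ put $$\phi_t(g)=\int_0^t\lambda(g(s))\,e^{-\kappa(g(s))\int_s^t\mu(g(r))\,dr}\,ds .$$ The set of attainable parameters $\mathcal R(t)$ consists of all $\gamma\ge 0$ with $\mathbb P(|\phi_t(J)-\gamma|<\epsilon)>0$ for every $\epsilon>0$. For $\gamma\ge0$ let $\ell(\gamma;\cdot)$ be the Fenchel–Legendre transform of the cumulant generating function of the Poisson distribution with parameter $\gamma$, i.e. $\ell(\gamma;a)=\infty$ for $a<0$, $\ell(\gamma;0)=\gamma$, and $\ell(\gamma;a)=\gamma-a+a\log(a/\gamma)$ for $a>0$ (read as $\infty$ if $\gamma=0$). A sequence of probability measures $(\tau_n)$ on $\mathbb R$ satisfies an LDP with rate function $\rho:\mathbb R\to[0,\infty]$ if $\rho$ is lower semicontinuous, $\limsup_n\frac1n\log\tau_n(F)\le-\inf_F\rho$ for all closed $F$ and $\liminf_n\frac1n\log\tau_n(G)\ge-\inf_G\rho$ for all open $G$. **Statement.** Let $a_-=\inf_g\phi_t(g)$ and $a_+=\sup_g\phi_t(g)$, over all càdlàg paths $g:[0,\infty)\to\mathcal E$.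 Then $0\le a_-\le a_+<\infty$ and $$\mathcal R(t)=[a_-,a_+].$$ The constant sequence of laws of $\phi_t(J)$ satisfies an LDP with some rate function $\psi$, and $\frac1nM_n(t)$ satisfies a (full) LDP with rate function $I(a)=\inf_{\gamma\in\mathcal R(t)}[\ell(\gamma;a)+\psi(\gamma)]$, which is given by $$I(a)=\begin{cases}\infty & a<0,\\ \ell(a_-;a) & 0\le a\le a_-,\\ 0 & a_-\le a\le a_+,\\ \ell(a_+;a) & a\ge a_+.\end{cases}$$ -/

import Mathlib

open Filter Topology MeasureTheory ProbabilityTheory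
open scoped NNReal ENNReal

/-! ### Large deviations principles -/

/-- `τ` satisfies a large deviations principle (at speed `n`) with rate function `ρ`, where `ρ` is
lower semicontinuous with values in `[0, ∞]`; it need not have compact level sets. Here
`ENNReal.log 0 = ⊥` and an infimum over the empty set is `⊤`. -/
structure SatisfiesLDP {X : Type*} [TopologicalSpace X] [MeasurableSpace X]
    (τ : ℕ → Measure X) (ρ : X → ℝ≥0∞) : Prop where
  lowerSemicontinuous : LowerSemicontinuous ρ
  upper_bound : ∀ F : Set X, IsClosed F →
    limsup (fun n : ℕ => ENNReal.log (τ n F) / (n : EReal)) atTop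
      ≤ -((⨅ a ∈ F, ρ a : ℝ≥0∞) : EReal)
  lower_bound : ∀ G : Set X, IsOpen G →
    -((⨅ a ∈ G, ρ a : ℝ≥0∞) : EReal)
      ≤ liminf (fun n : ℕ => ENNReal.log (τ n G) / (n : EReal)) atTop

/-- The attainable parameters of a sequence `ν` of laws of (normalized) random Poisson
parameters. -/
def attainableSet (ν : ℕ → Measure ℝ) : Set ℝ :=
  {γ | 0 ≤ γ ∧ ∀ ε : ℝ, 0 < ε → ∃ N : ℕ, ∀ n : ℕ, N ≤ n → 0 < ν n (Metric.ball γ ε)}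

/-- `ℓ(γ ; a)` for `γ ≥ 0`: the Fenchel-Legendre transform at `a` of the cumulant generating
function `θ ↦ γ (e ^ θ - 1)` of the Poisson distribution with parameter `γ`
(see `poissonRate_eq_legendre`). -/
noncomputable def poissonRate (γ a : ℝ) : ℝ≥0∞ :=
  if a < 0 then ⊤
  else if a = 0 then ENNReal.ofReal γ
  else if γ = 0 then ⊤
  else ENNReal.ofReal (γ - a + a * Real.log (a / γ))

theorem poissonRate_eq_legendre {γ : ℝ} (hγ : 0 ≤ γ) (a : ℝ) :
    (poissonRate γ a : EReal) = ⨆ θ : ℝ, ((θ * a - γ * (Real.exp θ - 1) : ℝ) : EReal) := by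
  unfold poissonRate
  split_ifs with h1 h2 h3
  · symm
    rw [EReal.coe_ennreal_top, EReal.eq_top_iff_forall_lt]
    intro b
    refine lt_of_lt_of_le ?_ (le_iSup _ ((|b| + 1) / a))
    rw [EReal.coe_lt_coe_iff, div_mul_cancel₀ _ h1.ne]
    have hθ : (|b| + 1) / a ≤ 0 := div_nonpos_of_nonneg_of_nonpos (by positivity) h1.le
    have he := Real.exp_le_one_iff.2 hθ
    nlinarith [le_abs_self b]
  · subst h2
    rw [EReal.coe_ennreal_ofReal, max_eq_left hγ]
    apply le_antisymm
    · have ht : Tendsto (fun θ : ℝ => ((θ * 0 - γ * (Real.exp θ - 1) : ℝ) : EReal)) atBot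
          (𝓝 (γ : EReal)) := by
        refine (continuous_coe_real_ereal.tendsto γ).comp ?_
        have := (Real.tendsto_exp_atBot.sub_const 1).const_mul (-γ)
        simpa using this
      exact le_of_tendsto' ht fun θ =>
        le_iSup (fun θ : ℝ => ((θ * 0 - γ * (Real.exp θ - 1) : ℝ) : EReal)) θ
    · refine iSup_le fun θ => ?_
      rw [EReal.coe_le_coe_iff]
      nlinarith [Real.exp_pos θ]
  · symm
    have ha : 0 < a := lt_of_le_of_ne (not_lt.1 h1) (Ne.symm h2)
    rw [EReal.coe_ennreal_top, EReal.eq_top_iff_forall_lt]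
    intro b
    refine lt_of_lt_of_le ?_ (le_iSup _ ((|b| + 1) / a))
    rw [EReal.coe_lt_coe_iff, div_mul_cancel₀ _ ha.ne', h3]
    linarith [le_abs_self b]
  · have ha : 0 < a := lt_of_le_of_ne (not_lt.1 h1) (Ne.symm h2)
    have hg : 0 < γ := lt_of_le_of_ne hγ (Ne.symm h3)
    have key : ∀ θ : ℝ, θ * a - γ * (Real.exp θ - 1) ≤ γ - a + a * Real.log (a / γ) := by
      intro θ
      have h := Real.add_one_le_exp (θ - Real.log (a / γ))
      rw [Real.exp_sub, Real.exp_log (by positivity)] at h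
      have h' := mul_le_mul_of_nonneg_left h ha.le
      have e : a * (Real.exp θ / (a / γ)) = γ * Real.exp θ := by field_simp
      rw [e] at h'
      linarith
    have h0 : 0 ≤ γ - a + a * Real.log (a / γ) := by simpa using key 0
    rw [EReal.coe_ennreal_ofReal, max_eq_left h0]
    apply le_antisymm
    · refine le_trans ?_ (le_iSup _ (Real.log (a / γ)))
      rw [EReal.coe_le_coe_iff, Real.exp_log (by positivity)]
      have e : γ * (a / γ - 1) = a - γ := by field_simp
      rw [e]
      linarith
    · exact iSup_le fun θ => EReal.coe_le_coe_iff.2 (key θ)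

/-- The rate function `I(a) = inf_{γ ∈ R} [ℓ(γ ; a) + ψ(γ)]`. -/
noncomputable def mixedPoissonRate (R : Set ℝ) (ψ : ℝ → ℝ≥0∞) (a : ℝ) : ℝ≥0∞ :=
  ⨅ γ ∈ R, (poissonRate γ a + ψ γ)

/-! ### Paths and the random Poisson parameter -/

/-- Right-continuous paths `[0, ∞) → E` with left limits. -/
def IsCadlagPath {E : Type*} [TopologicalSpace E] (f : ℝ≥0 → E) : Prop :=
  (∀ s : ℝ≥0, ContinuousWithinAt f (Set.Ici s) s) ∧
    ∀ s : ℝ≥0, 0 < s → ∃ l : E, Tendsto f (𝓝[<] s) (𝓝 l)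

/-- `∫_u^v g(f(r)) dr` for `0 ≤ u ≤ v`, along a path `f` indexed by `[0, ∞)`. -/
noncomputable def pathIntegral {E : Type*} (g : E → ℝ≥0) (f : ℝ≥0 → E) (u v : ℝ≥0) : ℝ :=
  ∫ r in (u : ℝ)..(v : ℝ), (g (f r.toNNReal) : ℝ)

/-- `φ_t(f) = ∫_0^t λ(f(s)) exp(-κ(f(s)) ∫_s^t μ(f(r)) dr) ds`. -/
noncomputable def phi {E : Type*} (lam kap mu : E → ℝ≥0) (t : ℝ≥0) (f : ℝ≥0 → E) : ℝ :=
  ∫ s in (0 : ℝ)..(t : ℝ), (lam (f s.toNNReal) : ℝ) *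
    Real.exp (-(kap (f s.toNNReal) : ℝ) * pathIntegral mu f s.toNNReal t)

/-! ### The modulated infinite-server queue

Jobs are numbered `0, 1, 2, …`. The standard Poisson process driving the arrivals is given by its
interarrival times `σ 0, σ 1, …` and the job `k` carries a mark `z k`, its service requirement
before modulation. The following are defined for one realization of `σ`, `z` and the background
path `f`. -/

/-- The `k`-th jump time of the driving standard Poisson process. -/
def baseArrival (σ : ℕ → ℝ) (k : ℕ) : ℝ := ∑ i ∈ Finset.range (k + 1), σ i

/-- Arrival time of job `k`, i.e. the `k`-th jump time of the driving process run with the clock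
`Λ(s) = ∫_0^s λ(f(r)) dr`: the first `s` with `Λ(s) ≥ baseArrival σ k`, and `∞` if there is
none. -/
noncomputable def arrivalTime {E : Type*} (lam : E → ℝ≥0) (f : ℝ≥0 → E) (σ : ℕ → ℝ) (k : ℕ) :
    ℝ≥0∞ :=
  ⨅ (s : ℝ≥0) (_ : baseArrival σ k ≤ pathIntegral lam f 0 s), (s : ℝ≥0∞)

/-- Service requirement of a job with mark `z` arriving while the background is in state `x`:
`z / κ(x)`, or `∞` if `κ(x) = 0`. -/
noncomputable def serviceRequirement {E : Type*} (kap : E → ℝ≥0) (x : E) (z : ℝ) : ℝ≥0∞ :=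
  if 0 < kap x then ENNReal.ofReal (z / kap x) else ⊤

/-- The jobs present at time `t`: those which have arrived by time `t` and whose service requirement
exceeds the work `∫_{[τ_k, t)} μ(f(r)) dr` done on them up to time `t`. -/
def jobsPresent {E : Type*} (lam kap mu : E → ℝ≥0) (f : ℝ≥0 → E) (σ z : ℕ → ℝ) (t : ℝ≥0) :
    Set ℕ :=
  {k | arrivalTime lam f σ k ≤ t ∧
    ¬ serviceRequirement kap (f (arrivalTime lam f σ k).toNNReal) (z k)
      ≤ ENNReal.ofReal (pathIntegral mu f (arrivalTime lam f σ k).toNNReal t)}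

/-- `M(t)`, the number of jobs present at time `t` (almost surely finite; the value on the
exceptional null set is immaterial). -/
noncomputable def numJobs {E : Type*} (lam kap mu : E → ℝ≥0) (f : ℝ≥0 → E) (σ z : ℕ → ℝ)
    (t : ℝ≥0) : ℕ :=
  (jobsPresent lam kap mu f σ z t).ncard

/-- The driving randomness of the queue: the interarrival times `σ` of a standard Poisson process
and the marks `z` are independent standard exponential variables, and together they are
independent of the background process `J`. -/
structure IsQueueDriver {Ω E : Type*} [MeasurableSpace Ω] [MeasurableSpace E]
    (P : Measure Ω) (J : ℝ≥0 → Ω → E) (σ z : ℕ → Ω → ℝ) : Prop where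
  law_interarrival : ∀ k, HasLaw (σ k) (expMeasure 1) P
  law_mark : ∀ k, HasLaw (z k) (expMeasure 1) P
  indep_driver : iIndepFun (Sum.elim σ z) P
  indep_background : IndepFun (fun ω s => J s ω) (fun ω => (fun k => σ k ω, fun k => z k ω)) P

/-! ### Irreducible continuous-time Markov chains on a finite set -/

/-- `Q` is a generator (transition rate) matrix. -/
structure IsGeneratorMatrix {E : Type*} [Fintype E] (Q : Matrix E E ℝ) : Prop where
  offDiag_nonneg : ∀ i j, i ≠ j → 0 ≤ Q i j
  row_sum : ∀ i, ∑ j, Q i j = 0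

/-- Any state can be reached from any other one by finitely many transitions of positive rate. -/
def IsIrreducibleGenerator {E : Type*} (Q : Matrix E E ℝ) : Prop :=
  ∀ i j, Relation.ReflTransGen (fun x y => x ≠ y ∧ 0 < Q x y) i j

/-- `J` is a càdlàg continuous-time Markov chain with generator `Q` (and arbitrary initial
distribution): for `s ≤ u`, conditionally on the history up to time `s`, the state at time `u` has
law `exp((u - s) Q) (J s, ·)`. -/
structure IsMarkovChain {Ω E : Type*} [MeasurableSpace Ω] [Fintype E] [DecidableEq E]
    [TopologicalSpace E] [MeasurableSpace E]
    (P : Measure Ω) (Q : Matrix E E ℝ) (J : ℝ≥0 → Ω → E) : Prop where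
  measurable : ∀ s, Measurable (J s)
  cadlag : ∀ ω, IsCadlagPath (fun s => J s ω)
  markov : ∀ s u : ℝ≥0, s ≤ u → ∀ A : Set Ω,
    MeasurableSet[⨆ (r : ℝ≥0) (_ : r ≤ s), MeasurableSpace.comap (J r) inferInstance] A →
    ∀ i j : E, P (A ∩ J s ⁻¹' {i} ∩ J u ⁻¹' {j})
      = P (A ∩ J s ⁻¹' {i}) * ENNReal.ofReal (NormedSpace.exp (((u : ℝ) - (s : ℝ)) • Q) i j)

/-! ### Exponential bounds and large deviations principles -/

/-! Conditionally on the background path, the jobs still present at time `t` form an independent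
thinning of a time-changed Poisson process. Hence their number is Poisson with mean `n φ_t(J)`: the
count is a mixed Poisson variable whose normalized random parameter has a law not depending on `n`.

Because this law is fixed, every event of positive probability for `J` costs nothing on the
exponential scale. The parameter can therefore be chosen freely in the support `K` of `φ_t(J)`: the
constant sequence of laws has rate `0` on `K` and `∞` off `K`, and the counts have rate `inf_{γ ∈ K}
ℓ(γ; a)`. As `ℓ(·; a)` increases away from `a`, on an interval `K = [p, q]` the infimum is reached
at the point of `K` closest to `a`, which gives the explicit formula.

That `K` is the whole interval between the extreme values of `φ_t` over càdlàg paths has two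
reasons. An irreducible chain follows any prescribed càdlàg path, except on a set of times of small
measure, with positive probability (`IsMarkovChain.followsUntil`), and `φ_t` is Lipschitz in that
measure (`exists_abs_phi_sub_le`). Moreover, splicing two paths at a moving time changes `φ_t`
continuously, so its values form an interval (`ordConnected_phi_image`).

The conditional Poisson law (`IsExpFamily.map_numJobs`) comes from a renewal argument. The
generating function of the retained arrivals among the first `m` is an iterate of a contracting
renewal operator, whose fixed point is the Poisson generating function (`thinGenLimit_renewal`);
`map_hitTime` converts clock time to real time and identifies the mean with `φ_t`.

The large deviation bounds are explicit. The upper bound is Chernoff's inequality, uniform over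
parameters in `[np, nq]`. The lower bound restricts to the event that `φ_t(J)` is near the best `γ`
and uses a single Poisson weight, estimated by a crude Stirling bound. -/

theorem log_ofReal_mul_exp_div {C : ℝ} (hC : 0 < C) (c : ℝ) (n : ℕ) :
    ENNReal.log (ENNReal.ofReal (C * Real.exp (-(n * c)))) / (n : EReal)
      = (((Real.log C - n * c) / n : ℝ) : EReal) := by
  rw [ENNReal.log_ofReal_of_pos (by positivity), Real.log_mul hC.ne' (Real.exp_pos _).ne',
    Real.log_exp, EReal.coe_div, EReal.coe_natCast, sub_eq_add_neg]

theorem tendsto_log_sub_mul_div (C c : ℝ) :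
    Tendsto (fun n : ℕ => (((Real.log C - n * c) / n : ℝ) : EReal)) atTop (𝓝 ((-c : ℝ) : EReal)) := by
  refine (continuous_coe_real_ereal.tendsto _).comp ?_
  have h : Tendsto (fun n : ℕ => Real.log C / n - c) atTop (𝓝 (0 - c)) :=
    (tendsto_const_div_atTop_nhds_zero_nat _).sub_const c
  rw [zero_sub] at h
  refine h.congr' ?_
  filter_upwards [eventually_gt_atTop 0] with n hn
  have : (n : ℝ) ≠ 0 := by positivity
  field_simp

theorem limsup_log_div_le {u : ℕ → ℝ≥0∞} {C c : ℝ} (hC : 0 < C)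
    (h : ∀ᶠ n : ℕ in atTop, u n ≤ ENNReal.ofReal (C * Real.exp (-(n * c)))) :
    limsup (fun n : ℕ => ENNReal.log (u n) / (n : EReal)) atTop ≤ ((-c : ℝ) : EReal) := by
  rw [← (tendsto_log_sub_mul_div C c).limsup_eq]
  refine limsup_le_limsup ?_
  filter_upwards [h] with n hn
  rw [← log_ofReal_mul_exp_div hC]
  exact EReal.div_le_div_right_of_nonneg (by positivity) (ENNReal.log_monotone hn)

theorem le_liminf_log_div {u : ℕ → ℝ≥0∞} {C c : ℝ} (hC : 0 < C)
    (h : ∀ᶠ n : ℕ in atTop, ENNReal.ofReal (C * Real.exp (-(n * c))) ≤ u n) :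
    ((-c : ℝ) : EReal) ≤ liminf (fun n : ℕ => ENNReal.log (u n) / (n : EReal)) atTop := by
  rw [← (tendsto_log_sub_mul_div C c).liminf_eq]
  refine liminf_le_liminf ?_
  filter_upwards [h] with n hn
  rw [← log_ofReal_mul_exp_div hC]
  exact EReal.div_le_div_right_of_nonneg (by positivity) (ENNReal.log_monotone hn)

/-- A large deviations principle follows from nonasymptotic exponential bounds. -/
theorem SatisfiesLDP.of_exp_bounds {X : Type*} [TopologicalSpace X] [MeasurableSpace X]
    {τ : ℕ → Measure X} {ρ : X → ℝ≥0∞} (hτ : ∀ n s, τ n s ≤ 1) (hρ : LowerSemicontinuous ρ)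
    (upper : ∀ F : Set X, IsClosed F → ∀ c : ℝ≥0, (∀ a ∈ F, (c : ℝ≥0∞) < ρ a) →
      ∃ C : ℝ, 0 < C ∧ ∀ᶠ n : ℕ in atTop, τ n F ≤ ENNReal.ofReal (C * Real.exp (-(n * c))))
    (lower : ∀ G : Set X, IsOpen G → ∀ a ∈ G, ρ a ≠ ⊤ → ∀ ε : ℝ, 0 < ε →
      ∃ C : ℝ, 0 < C ∧ ∀ᶠ n : ℕ in atTop,
        ENNReal.ofReal (C * Real.exp (-(n * ((ρ a).toReal + ε)))) ≤ τ n G) :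
    SatisfiesLDP τ ρ where
  lowerSemicontinuous := hρ
  upper_bound F hF := by
    rw [EReal.le_neg]
    -- Total mass at most one makes the limsup nonpositive, so its negative can be treated as an
    -- element of `[0, ∞]` and compared with the infimum there.
    have h0 : limsup (fun n : ℕ => ENNReal.log (τ n F) / (n : EReal)) atTop ≤ ((-0 : ℝ) : EReal) :=
      limsup_log_div_le one_pos (Eventually.of_forall fun n => by simpa using hτ n F)
    have key : ∀ c : ℝ≥0, (c : ℝ≥0∞) < ⨅ a ∈ F, ρ a →
        ((c : ℝ≥0∞) : EReal)
          ≤ -limsup (fun n : ℕ => ENNReal.log (τ n F) / (n : EReal)) atTop := by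
      intro c hc
      obtain ⟨C, hC, h⟩ := upper F hF c fun a ha => hc.trans_le (iInf₂_le a ha)
      rw [EReal.le_neg]
      refine (limsup_log_div_le hC h).trans (le_of_eq ?_)
      rw [EReal.coe_neg]
      rfl
    rw [neg_zero, EReal.coe_zero] at h0
    set L := limsup (fun n : ℕ => ENNReal.log (τ n F) / (n : EReal)) atTop with hL
    have hnn : 0 ≤ -L := by rwa [EReal.le_neg, neg_zero]
    lift -L to ℝ≥0∞ using hnn with M hM
    refine EReal.coe_ennreal_le_coe_ennreal_iff.2 ?_
    refine ENNReal.le_of_forall_nnreal_lt fun c hc => ?_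
    exact EReal.coe_ennreal_le_coe_ennreal_iff.1 (key c hc)
  lower_bound G hG := by
    rw [EReal.neg_le]
    set L := liminf (fun n : ℕ => ENNReal.log (τ n G) / (n : EReal)) atTop with hL
    have key : ∀ a ∈ G, -L ≤ ((ρ a : ℝ≥0∞) : EReal) := by
      intro a ha
      by_cases hfin : ρ a = ⊤
      · simp [hfin]
      rw [EReal.neg_le]
      refine le_of_forall_lt fun x hx => ?_
      obtain ⟨y, hxy, hy⟩ := EReal.lt_iff_exists_real_btwn.1 hx
      rw [← EReal.coe_toReal (x := ((ρ a : ℝ≥0∞) : EReal)) (by simpa using hfin) (by simp),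
        ← EReal.coe_neg, EReal.coe_lt_coe_iff, EReal.toReal_coe_ennreal] at hy
      obtain ⟨C, hC, h⟩ := lower G hG a ha hfin (-(ρ a).toReal - y) (by linarith)
      refine hxy.trans_le (le_trans (le_of_eq ?_) (le_liminf_log_div hC h))
      congr 1
      ring
    by_cases hL0 : 0 ≤ -L
    · lift -L to ℝ≥0∞ using hL0 with M hM
      refine EReal.coe_ennreal_le_coe_ennreal_iff.2 (le_iInf₂ fun a ha => ?_)
      exact EReal.coe_ennreal_le_coe_ennreal_iff.1 (key a ha)
    · exact (not_le.1 hL0).le.trans (EReal.coe_ennreal_nonneg _)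

/-! ### The Poisson rate function -/

theorem poissonRate_of_neg {γ a : ℝ} (ha : a < 0) : poissonRate γ a = ⊤ := if_pos ha

theorem poissonRate_of_nonneg {γ a : ℝ} (ha : 0 ≤ a) (hγ : 0 < γ) :
    poissonRate γ a = ENNReal.ofReal (γ - a + a * Real.log (a / γ)) := by
  unfold poissonRate
  rw [if_neg ha.not_gt]
  split_ifs with h h'
  · simp [h]
  · exact absurd h' hγ.ne'
  · rfl

theorem poissonRate_self {a : ℝ} (ha : 0 ≤ a) : poissonRate a a = 0 := by
  rcases ha.eq_or_lt with rfl | h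
  · simp [poissonRate]
  · rw [poissonRate_of_nonneg ha h, div_self h.ne']
    simp

/-- The Legendre form exhibits the rate as a supremum of affine functions of `a`. -/
theorem lowerSemicontinuous_poissonRate {γ : ℝ} (hγ : 0 ≤ γ) :
    LowerSemicontinuous (poissonRate γ) := by
  have h : LowerSemicontinuous fun a => (poissonRate γ a : EReal) := by
    simp_rw [poissonRate_eq_legendre hγ]
    refine lowerSemicontinuous_iSup fun θ => Continuous.lowerSemicontinuous ?_
    exact continuous_coe_real_ereal.comp (by fun_prop)
  intro a b hb
  have := h a b (EReal.coe_ennreal_lt_coe_ennreal_iff.2 hb)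
  filter_upwards [this] with x hx using EReal.coe_ennreal_lt_coe_ennreal_iff.1 hx

/-- `ℓ(· ; a)` increases away from `a`: if `γ` lies between `a` and `γ'`, its rate is smaller. -/
theorem poissonRate_mono {γ γ' a : ℝ} (ha : 0 ≤ a) (h₁ : a ≤ γ) (h₂ : γ ≤ γ') :
    poissonRate γ a ≤ poissonRate γ' a := by
  rw [← EReal.coe_ennreal_le_coe_ennreal_iff, poissonRate_eq_legendre (ha.trans h₁),
    poissonRate_eq_legendre (ha.trans (h₁.trans h₂))]
  refine iSup_le fun θ => ?_
  rcases le_total θ 0 with hθ | hθ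
  · refine le_trans ?_ (le_iSup _ θ)
    rw [EReal.coe_le_coe_iff]
    nlinarith [Real.exp_le_one_iff.2 hθ]
  -- A tilt towards the wrong side of the mean gives a nonpositive value, no better than the tilt
  -- `0`.
  · refine le_trans ?_ (le_iSup _ 0)
    rw [EReal.coe_le_coe_iff]
    have h := Real.add_one_le_exp θ
    have h3 : θ * a ≤ γ * θ := by nlinarith
    have h4 : γ * θ ≤ γ * (Real.exp θ - 1) :=
      mul_le_mul_of_nonneg_left (by linarith) (ha.trans h₁)
    simp only [zero_mul, Real.exp_zero, sub_self, mul_zero]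
    linarith

theorem poissonRate_anti {γ γ' a : ℝ} (hγ' : 0 ≤ γ') (h₁ : γ ≤ a) (h₂ : γ' ≤ γ) :
    poissonRate γ a ≤ poissonRate γ' a := by
  rw [← EReal.coe_ennreal_le_coe_ennreal_iff, poissonRate_eq_legendre (hγ'.trans h₂),
    poissonRate_eq_legendre hγ']
  refine iSup_le fun θ => ?_
  rcases le_total 0 θ with hθ | hθ
  · refine le_trans ?_ (le_iSup _ θ)
    rw [EReal.coe_le_coe_iff]
    nlinarith [Real.one_le_exp hθ]
  · refine le_trans ?_ (le_iSup _ 0)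
    rw [EReal.coe_le_coe_iff]
    have h := Real.add_one_le_exp θ
    have h3 : θ * a ≤ γ * θ := by nlinarith
    have h4 : γ * θ ≤ γ * (Real.exp θ - 1) :=
      mul_le_mul_of_nonneg_left (by linarith) (hγ'.trans h₂)
    simp only [zero_mul, Real.exp_zero, sub_self, mul_zero]
    linarith

/-- The tilting parameter of a Chernoff bound below the mean can be taken nonpositive. -/
theorem exists_nonpos_tilt {γ b : ℝ} {c : ℝ≥0} (hγ : 0 ≤ γ) (hb : b ≤ γ)
    (h : (c : ℝ≥0∞) < poissonRate γ b) :
    ∃ θ ≤ 0, (c : ℝ) < θ * b - γ * (Real.exp θ - 1) := by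
  rw [← EReal.coe_ennreal_lt_coe_ennreal_iff, poissonRate_eq_legendre hγ, lt_iSup_iff] at h
  obtain ⟨θ, hθ⟩ := h
  have hθ : (c : ℝ) < θ * b - γ * (Real.exp θ - 1) := EReal.coe_lt_coe_iff.1 hθ
  refine ⟨θ, ?_, hθ⟩
  -- For `θ > 0` the objective is at most `θ (b - γ) ≤ 0`, since `e ^ θ - 1 ≥ θ`, so it cannot
  -- exceed `c ≥ 0`.
  by_contra! hpos
  have := Real.add_one_le_exp θ
  nlinarith [c.coe_nonneg]

theorem exists_nonneg_tilt {γ b : ℝ} {c : ℝ≥0} (hγ : 0 ≤ γ) (hb : γ ≤ b)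
    (h : (c : ℝ≥0∞) < poissonRate γ b) :
    ∃ θ ≥ 0, (c : ℝ) < θ * b - γ * (Real.exp θ - 1) := by
  rw [← EReal.coe_ennreal_lt_coe_ennreal_iff, poissonRate_eq_legendre hγ, lt_iSup_iff] at h
  obtain ⟨θ, hθ⟩ := h
  have hθ : (c : ℝ) < θ * b - γ * (Real.exp θ - 1) := EReal.coe_lt_coe_iff.1 hθ
  refine ⟨θ, ?_, hθ⟩
  by_contra! hneg
  have := Real.add_one_le_exp θ
  nlinarith [c.coe_nonneg]

/-! ### The rate function of a mixture over an interval -/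

/-- The rate function of a constant sequence of measures with support `K`. -/
noncomputable def supportRate (K : Set ℝ) (a : ℝ) : ℝ≥0∞ :=
  open Classical in if a ∈ K then 0 else ⊤

theorem lowerSemicontinuous_supportRate {K : Set ℝ} (hK : IsClosed K) :
    LowerSemicontinuous (supportRate K) := by
  intro a b hb
  by_cases ha : a ∈ K
  · simp [supportRate, ha] at hb
  · filter_upwards [hK.isOpen_compl.mem_nhds ha] with x hx
    have hx' : x ∉ K := hx
    simp only [supportRate, ha, hx', if_false] at hb ⊢
    exact hb

/-- If `K` is the support of `ν`, the constant sequence `ν` satisfies an LDP. -/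
theorem satisfiesLDP_const {ν : Measure ℝ} [IsProbabilityMeasure ν] {K : Set ℝ} (hK : IsClosed K)
    (hKν : ν Kᶜ = 0) (hpos : ∀ a ∈ K, ∀ ε : ℝ, 0 < ε → 0 < ν (Metric.ball a ε)) :
    SatisfiesLDP (fun _ => ν) (supportRate K) := by
  refine SatisfiesLDP.of_exp_bounds (fun _ s => prob_le_one) (lowerSemicontinuous_supportRate hK)
    (fun F _ c h => ⟨1, one_pos, Eventually.of_forall fun n => ?_⟩) (fun G hG a ha hfin ε hε => ?_)
  · have : F ⊆ Kᶜ := fun a ha haK => by simpa [supportRate, haK] using h a ha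
    rw [measure_mono_null this hKν]
    exact zero_le
  · have haK : a ∈ K := by
      by_contra hne
      simp [supportRate, hne] at hfin
    obtain ⟨δ, hδ, hball⟩ := Metric.isOpen_iff.1 hG a ha
    have hG : 0 < ν G := (hpos a haK δ hδ).trans_le (measure_mono hball)
    refine ⟨(ν G).toReal, ENNReal.toReal_pos hG.ne' (measure_ne_top _ _),
      Eventually.of_forall fun n => ?_⟩
    rw [← ENNReal.ofReal_toReal (measure_ne_top ν G)]
    refine ENNReal.ofReal_le_ofReal ?_
    rw [ENNReal.ofReal_toReal (measure_ne_top ν G)]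
    refine mul_le_of_le_one_right ENNReal.toReal_nonneg (Real.exp_le_one_iff.2 ?_)
    have : 0 ≤ (supportRate K a).toReal := ENNReal.toReal_nonneg
    have : 0 ≤ (n : ℝ) * ((supportRate K a).toReal + ε) := by positivity
    linarith

section Mixture

variable {p q : ℝ}

theorem mixedPoissonRate_supportRate (K : Set ℝ) (a : ℝ) :
    mixedPoissonRate K (supportRate K) a = ⨅ γ ∈ K, poissonRate γ a := by
  unfold mixedPoissonRate
  refine iInf_congr fun γ => iInf_congr fun hγ => ?_
  simp [supportRate, hγ]

theorem mixedPoissonRate_Icc_of_neg {a : ℝ} (ha : a < 0) :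
    mixedPoissonRate (Set.Icc p q) (supportRate (Set.Icc p q)) a = ⊤ := by
  rw [mixedPoissonRate_supportRate]
  simp [poissonRate_of_neg ha]

theorem mixedPoissonRate_Icc_of_le (hpq : p ≤ q) {a : ℝ} (ha : a ∈ Set.Icc 0 p) :
    mixedPoissonRate (Set.Icc p q) (supportRate (Set.Icc p q)) a = poissonRate p a := by
  rw [mixedPoissonRate_supportRate]
  exact le_antisymm (iInf₂_le p ⟨le_rfl, hpq⟩)
    (le_iInf₂ fun γ hγ => poissonRate_mono ha.1 ha.2 hγ.1)

theorem mixedPoissonRate_Icc_of_mem (hp : 0 ≤ p) {a : ℝ} (ha : a ∈ Set.Icc p q) :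
    mixedPoissonRate (Set.Icc p q) (supportRate (Set.Icc p q)) a = 0 := by
  rw [mixedPoissonRate_supportRate]
  exact le_antisymm ((iInf₂_le a ha).trans (poissonRate_self (hp.trans ha.1)).le) zero_le

theorem mixedPoissonRate_Icc_of_ge (hp : 0 ≤ p) (hpq : p ≤ q) {a : ℝ} (ha : q ≤ a) :
    mixedPoissonRate (Set.Icc p q) (supportRate (Set.Icc p q)) a = poissonRate q a := by
  rw [mixedPoissonRate_supportRate]
  exact le_antisymm (iInf₂_le q ⟨hpq, le_rfl⟩)
    (le_iInf₂ fun γ hγ => poissonRate_anti (hp.trans hγ.1) ha hγ.2)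

/-- An infimum of lower semicontinuous functions need not be lower semicontinuous, so this is
checked locally: outside `[p, q]` the rate coincides near the point with a single Poisson rate, and
on `[p, q]` it takes its minimal value `0`. -/
theorem lowerSemicontinuous_mixedPoissonRate_Icc (hp : 0 ≤ p) (hpq : p ≤ q) :
    LowerSemicontinuous (mixedPoissonRate (Set.Icc p q) (supportRate (Set.Icc p q))) := by
  have below : ∀ a < p, mixedPoissonRate (Set.Icc p q) (supportRate (Set.Icc p q)) a
      = poissonRate p a := by
    intro a ha
    rcases lt_or_ge a 0 with h | h
    · rw [mixedPoissonRate_Icc_of_neg h, poissonRate_of_neg h]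
    · exact mixedPoissonRate_Icc_of_le hpq ⟨h, ha.le⟩
  intro a b hb
  rcases lt_or_ge a p with h | h
  · rw [below a h] at hb
    filter_upwards [lowerSemicontinuous_poissonRate hp a b hb, Iio_mem_nhds h] with x hx hxp
    rwa [below x hxp]
  rcases lt_or_ge q a with h' | h'
  · rw [mixedPoissonRate_Icc_of_ge hp hpq h'.le] at hb
    filter_upwards [lowerSemicontinuous_poissonRate (hp.trans hpq) a b hb, Ioi_mem_nhds h']
      with x hx hxq
    rwa [mixedPoissonRate_Icc_of_ge hp hpq (le_of_lt hxq)]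
  · rw [mixedPoissonRate_Icc_of_mem hp ⟨h, h'⟩] at hb
    simp at hb

end Mixture

/-! ### Positivity of transition probabilities -/

section MatrixExp

variable {E : Type*} [Fintype E] [DecidableEq E]

theorem Matrix.hasSum_exp (A : Matrix E E ℝ) :
    HasSum (fun k : ℕ => ((k.factorial : ℝ)⁻¹) • A ^ k) (NormedSpace.exp A) := by
  -- Matrices carry no canonical norm; any choice inducing the product topology makes the
  -- exponential series available.
  let : NormedRing (Matrix E E ℝ) := Matrix.linftyOpNormedRing
  let : NormedAlgebra ℝ (Matrix E E ℝ) := Matrix.linftyOpNormedAlgebra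
  exact NormedSpace.exp_series_hasSum_exp' (𝕂 := ℝ) A

theorem Matrix.hasSum_exp_apply (A : Matrix E E ℝ) (i j : E) :
    HasSum (fun k : ℕ => ((k.factorial : ℝ)⁻¹) * (A ^ k) i j) (NormedSpace.exp A i j) := by
  simpa using Pi.hasSum.1 (Pi.hasSum.1 A.hasSum_exp i) j

theorem Matrix.le_exp_apply {A : Matrix E E ℝ} (hA : ∀ i j, 0 ≤ A i j) (k : ℕ) (i j : E) :
    ((k.factorial : ℝ)⁻¹) * (A ^ k) i j ≤ NormedSpace.exp A i j := by
  refine le_hasSum (A.hasSum_exp_apply i j) k fun l _ => ?_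
  exact mul_nonneg (by positivity) (Matrix.pow_apply_nonneg hA l i j)

theorem Matrix.exists_pow_apply_pos {A : Matrix E E ℝ} (hA : ∀ i j, 0 ≤ A i j) {i j : E}
    (h : Relation.ReflTransGen (fun x y => 0 < A x y) i j) : ∃ k, 0 < (A ^ k) i j := by
  induction h with
  | refl => exact ⟨0, by simp⟩
  | @tail b c _ hbc ih =>
    obtain ⟨k, hk⟩ := ih
    refine ⟨k + 1, ?_⟩
    rw [pow_succ, Matrix.mul_apply]
    exact Finset.sum_pos' (fun l _ => mul_nonneg (Matrix.pow_apply_nonneg hA k i l) (hA l c))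
      ⟨b, Finset.mem_univ _, mul_pos hk hbc⟩

theorem Matrix.exp_smul_one (c : ℝ) :
    NormedSpace.exp (c • (1 : Matrix E E ℝ)) = Real.exp c • (1 : Matrix E E ℝ) := by
  rw [Matrix.smul_one_eq_diagonal, Matrix.exp_diagonal, Matrix.smul_one_eq_diagonal]
  congr 1
  ext i
  rw [Pi.coe_exp, ← Real.exp_eq_exp_ℝ]

/-- `e ^ (h Q) = e ^ (-c h) e ^ (h (Q + c))`. -/
theorem exp_smul_eq_shift (Q : Matrix E E ℝ) (c h : ℝ) :
    NormedSpace.exp (h • Q)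
      = Real.exp (-(c * h)) • NormedSpace.exp (h • (Q + c • (1 : Matrix E E ℝ))) := by
  have e : h • Q = (-(c * h)) • (1 : Matrix E E ℝ) + h • (Q + c • (1 : Matrix E E ℝ)) := by
    rw [smul_add, smul_smul, mul_comm h c, neg_smul]
    abel
  rw [e, Matrix.exp_add_of_commute _ _ ((Commute.one_left _).smul_left _), Matrix.exp_smul_one,
    smul_mul_assoc, one_mul]

/-- A bound for the total rate of leaving a state. -/
noncomputable def exitBound (Q : Matrix E E ℝ) : ℝ := ∑ i, |Q i i|

theorem shift_nonneg {Q : Matrix E E ℝ} (hQ : IsGeneratorMatrix Q) (i j : E) :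
    0 ≤ (Q + exitBound Q • (1 : Matrix E E ℝ)) i j := by
  rw [Matrix.add_apply, Matrix.smul_apply, Matrix.one_apply]
  split_ifs with h
  · subst h
    have : |Q i i| ≤ exitBound Q :=
      Finset.single_le_sum (f := fun i => |Q i i|) (fun _ _ => abs_nonneg _) (Finset.mem_univ i)
    simp only [smul_eq_mul, mul_one]
    linarith [neg_abs_le (Q i i)]
  · simpa using hQ.offDiag_nonneg i j h

/-- After the shift by `exitBound Q` all entries are nonnegative, so the exponential dominates the
zeroth term of its series, the identity. The bound is exponential in `h`, hence multiplicative over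
consecutive steps. -/
theorem exp_neg_le_exp_smul_apply {Q : Matrix E E ℝ} (hQ : IsGeneratorMatrix Q) {h : ℝ}
    (hh : 0 ≤ h) (i : E) :
    Real.exp (-(exitBound Q * h)) ≤ NormedSpace.exp (h • Q) i i := by
  rw [exp_smul_eq_shift Q (exitBound Q) h, Matrix.smul_apply, smul_eq_mul]
  refine le_mul_of_one_le_right (Real.exp_pos _).le ?_
  have := Matrix.le_exp_apply (A := h • (Q + exitBound Q • (1 : Matrix E E ℝ)))
    (fun i j => mul_nonneg hh (shift_nonneg hQ i j)) 0 i i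
  simpa using this

/-- A chain of `k` positive-rate transitions from `i` to `j` makes the `(i, j)` entry of the `k`-th
power of the shifted, nonnegative matrix positive, and this term of the series cannot be cancelled.
-/
theorem exp_smul_apply_pos {Q : Matrix E E ℝ} (hQ : IsGeneratorMatrix Q)
    (hirr : IsIrreducibleGenerator Q) {h : ℝ} (hh : 0 < h) (i j : E) :
    0 < NormedSpace.exp (h • Q) i j := by
  rw [exp_smul_eq_shift Q (exitBound Q) h, Matrix.smul_apply, smul_eq_mul]
  refine mul_pos (Real.exp_pos _) ?_
  have hA : ∀ i j, 0 ≤ (h • (Q + exitBound Q • (1 : Matrix E E ℝ))) i j :=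
    fun i j => mul_nonneg hh.le (shift_nonneg hQ i j)
  have hle : ∀ x y, x ≠ y ∧ 0 < Q x y →
      0 < (h • (Q + exitBound Q • (1 : Matrix E E ℝ))) x y := fun x y hxy => by
    rw [Matrix.smul_apply, Matrix.add_apply, Matrix.smul_apply, Matrix.one_apply_ne hxy.1]
    simpa using mul_pos hh hxy.2
  obtain ⟨k, hk⟩ :=
    Matrix.exists_pow_apply_pos hA (Relation.ReflTransGen.mono hle _ _ (hirr i j))
  exact (mul_pos (by positivity) hk).trans_le (Matrix.le_exp_apply hA k i j)

end MatrixExp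

/-! ### The support of the law of a finite Markov chain -/

theorem IsCadlagPath.exists_forall_Ico_eq {E : Type*} [TopologicalSpace E] [DiscreteTopology E]
    {f : ℝ≥0 → E} (hf : IsCadlagPath f) (s : ℝ≥0) : ∃ v > s, ∀ r ∈ Set.Ico s v, f r = f s := by
  have h : {r | f r = f s} ∈ 𝓝[≥] s := by
    exact (hf.1 s) ((isOpen_discrete {f s}).mem_nhds rfl)
  obtain ⟨v, hv, hsub⟩ := mem_nhdsGE_iff_exists_Ico_subset.1 h
  exact ⟨v, hv, fun r hr => hsub hr⟩

/-- The history of a process up to time `s`. -/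
abbrev processHistory {Ω E : Type*} [MeasurableSpace E] (J : ℝ≥0 → Ω → E) (s : ℝ≥0) :
    MeasurableSpace Ω :=
  ⨆ (r : ℝ≥0) (_ : r ≤ s), MeasurableSpace.comap (J r) inferInstance

theorem processHistory_mono {Ω E : Type*} [MeasurableSpace E] (J : ℝ≥0 → Ω → E) {s u : ℝ≥0}
    (h : s ≤ u) : processHistory J s ≤ processHistory J u :=
  iSup₂_le fun r hr =>
    le_iSup₂ (f := fun r (_ : r ≤ u) => MeasurableSpace.comap (J r) inferInstance) r (hr.trans h)

theorem measurableSet_processHistory {Ω E : Type*} [MeasurableSpace E]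
    [MeasurableSingletonClass E] (J : ℝ≥0 → Ω → E) {r s : ℝ≥0} (h : r ≤ s) (i : E) :
    MeasurableSet[processHistory J s] (J r ⁻¹' {i}) :=
  le_iSup₂ (f := fun r (_ : r ≤ s) => MeasurableSpace.comap (J r) inferInstance) r h _
    ⟨{i}, measurableSet_singleton i, rfl⟩

section Markov

set_option linter.unusedSectionVars false

variable {Ω E : Type*} [MeasurableSpace Ω] [Fintype E] [DecidableEq E] [TopologicalSpace E]
  [MeasurableSpace E] [MeasurableSingletonClass E] {P : Measure Ω} {Q : Matrix E E ℝ}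
  {J : ℝ≥0 → Ω → E}

theorem IsMarkovChain.processHistory_le (hJ : IsMarkovChain P Q J) (s : ℝ≥0) :
    processHistory J s ≤ (inferInstance : MeasurableSpace Ω) :=
  iSup₂_le fun r _ => (hJ.measurable r).comap_le

/-- The point of the bound is that it depends on `m` and `δ` only through the elapsed time `m * δ`,
so it survives refinement of the grid. The Markov property is applied once per grid step, which is
why measurability of the event is carried through the same induction. -/
theorem IsMarkovChain.le_measure_grid (hJ : IsMarkovChain P Q J) (hQ : IsGeneratorMatrix Q)
    {u δ : ℝ≥0} {A : Set Ω} (hA : MeasurableSet[processHistory J u] A) {x : E}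
    (hAx : ∀ ω ∈ A, J u ω = x) (m : ℕ) :
    MeasurableSet[processHistory J (u + m * δ)] {ω ∈ A | ∀ k ≤ m, J (u + k * δ) ω = x} ∧
    P A * ENNReal.ofReal (Real.exp (-(exitBound Q * (m * δ))))
      ≤ P {ω ∈ A | ∀ k ≤ m, J (u + k * δ) ω = x} := by
  induction m with
  | zero =>
    have : {ω ∈ A | ∀ k ≤ 0, J (u + (k : ℕ) * δ) ω = x} = A := by
      ext ω
      simpa using hAx ω
    rw [this]
    refine ⟨processHistory_mono J le_self_add _ hA, ?_⟩
    simp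
  | succ m ih =>
    have hle : u + m * δ ≤ u + (m + 1 : ℕ) * δ := by gcongr; simp
    have e : {ω ∈ A | ∀ k ≤ m + 1, J (u + (k : ℕ) * δ) ω = x}
        = {ω ∈ A | ∀ k ≤ m, J (u + (k : ℕ) * δ) ω = x} ∩ J (u + m * δ) ⁻¹' {x}
          ∩ J (u + (m + 1 : ℕ) * δ) ⁻¹' {x} := by
      ext ω
      simp only [Set.mem_ofPred_eq, Set.mem_inter_iff, Set.mem_preimage, Set.mem_singleton_iff]
      constructor
      · rintro ⟨h1, h2⟩
        exact ⟨⟨⟨h1, fun k hk => h2 k (by omega)⟩, h2 m (by omega)⟩, h2 (m + 1) le_rfl⟩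
      · rintro ⟨⟨⟨h1, h2⟩, -⟩, h3⟩
        refine ⟨h1, fun k hk => ?_⟩
        rcases Nat.le_succ_iff.1 hk with h | h
        · exact h2 k h
        · rw [h]; exact h3
    have e' : {ω ∈ A | ∀ k ≤ m, J (u + (k : ℕ) * δ) ω = x} ∩ J (u + m * δ) ⁻¹' {x}
        = {ω ∈ A | ∀ k ≤ m, J (u + (k : ℕ) * δ) ω = x} :=
      Set.inter_eq_left.2 fun ω hω => hω.2 m le_rfl
    constructor
    · rw [e]
      refine MeasurableSet.inter (processHistory_mono J hle _ (ih.1.inter ?_)) ?_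
      · exact measurableSet_processHistory J le_rfl x
      · exact measurableSet_processHistory J le_rfl x
    · rw [e, hJ.markov _ _ hle _ ih.1, e']
      have hexp : Real.exp (-(exitBound Q * ((m + 1 : ℕ) * δ)))
          = Real.exp (-(exitBound Q * (m * δ))) * Real.exp (-(exitBound Q * δ)) := by
        rw [← Real.exp_add]
        congr 1
        push_cast
        ring
      rw [hexp, ENNReal.ofReal_mul (Real.exp_pos _).le, ← mul_assoc]
      refine mul_le_mul' ih.2 (ENNReal.ofReal_le_ofReal ?_)
      have : (((u + (m + 1 : ℕ) * δ : ℝ≥0) : ℝ) - ((u + m * δ : ℝ≥0) : ℝ)) = δ := by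
        push_cast
        ring
      rw [this]
      exact exp_neg_le_exp_smul_apply hQ δ.coe_nonneg x

/-- Right-continuous paths in a discrete space are constant on some `[r, v)`; finding a grid point
there transfers information on dyadic times to every time `r`. -/
theorem exists_dyadic_between {u h r v : ℝ≥0} (hr : r ∈ Set.Ico u (u + h)) (hv : r < v) :
    ∃ n k : ℕ, k ≤ 2 ^ n ∧ u + k * (h / 2 ^ n) ∈ Set.Ico r v := by
  obtain ⟨hur, hrh⟩ := hr
  have hh : 0 < h := by
    by_contra! h0
    simp only [nonpos_iff_eq_zero] at h0
    rw [h0, add_zero] at hrh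
    exact absurd hrh hur.not_gt
  have hur' : (u : ℝ) ≤ r := by exact_mod_cast hur
  have hrh' : (r : ℝ) < u + h := by exact_mod_cast hrh
  have hv' : (r : ℝ) < v := by exact_mod_cast hv
  have hh' : (0 : ℝ) < h := by exact_mod_cast hh
  have hpos : 0 < min ((v : ℝ) - r) (u + h - r) := lt_min (by linarith) (by linarith)
  obtain ⟨n, hn⟩ := exists_pow_lt_of_lt_one (div_pos hpos hh') (by norm_num : (1 / 2 : ℝ) < 1)
  have hstep : (h : ℝ) / 2 ^ n < min ((v : ℝ) - r) (u + h - r) := by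
    rw [lt_div_iff₀ hh'] at hn
    calc (h : ℝ) / 2 ^ n = (1 / 2) ^ n * h := by rw [one_div, inv_pow]; field_simp
      _ < _ := hn
  have hstep0 : 0 < (h : ℝ) / 2 ^ n := by positivity
  set k := ⌈((r : ℝ) - u) / (h / 2 ^ n)⌉₊ with hk
  have hk1 : (r : ℝ) - u ≤ k * (h / 2 ^ n) := by
    rw [← div_le_iff₀ hstep0]
    exact Nat.le_ceil _
  have hk2 : (k : ℝ) * (h / 2 ^ n) < (r - u) + h / 2 ^ n := by
    have := Nat.ceil_lt_add_one (div_nonneg (sub_nonneg.2 hur') hstep0.le)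
    rw [← hk] at this
    calc (k : ℝ) * (h / 2 ^ n) < (((r : ℝ) - u) / (h / 2 ^ n) + 1) * (h / 2 ^ n) :=
          mul_lt_mul_of_pos_right this hstep0
      _ = _ := by field_simp
  refine ⟨n, k, ?_, ?_, ?_⟩
  · have : (k : ℝ) * (h / 2 ^ n) < h := by linarith [min_le_right ((v : ℝ) - r) (u + h - r)]
    have h2 : (k : ℝ) < 2 ^ n := by
      rw [← mul_div_assoc, div_lt_iff₀ (by positivity)] at this
      nlinarith
    exact_mod_cast h2.le
  · rw [← NNReal.coe_le_coe]
    push_cast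
    linarith
  · rw [← NNReal.coe_lt_coe]
    push_cast
    linarith [min_le_left ((v : ℝ) - r) (u + h - r)]

/-- On an event of positive probability, the chain stays where it is for a given time. -/
theorem IsMarkovChain.exists_holding (hJ : IsMarkovChain P Q J) [IsProbabilityMeasure P]
    [DiscreteTopology E] (hQ : IsGeneratorMatrix Q) {u : ℝ≥0} (h : ℝ≥0) {A : Set Ω}
    (hA : MeasurableSet[processHistory J u] A) (hPA : 0 < P A) {x : E}
    (hAx : ∀ ω ∈ A, J u ω = x) :
    ∃ B ⊆ A, MeasurableSet[processHistory J (u + h)] B ∧ 0 < P B ∧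
      ∀ ω ∈ B, ∀ r ∈ Set.Ico u (u + h), J r ω = x := by
  let C : ℕ → Set Ω := fun n => {ω ∈ A | ∀ k ≤ 2 ^ n, J (u + (k : ℕ) * (h / 2 ^ n)) ω = x}
  have hgrid : ∀ n : ℕ, ((2 ^ n : ℕ) : ℝ≥0) * (h / 2 ^ n) = h := fun n => by
    push_cast
    field_simp
  have hC : ∀ n, MeasurableSet[processHistory J (u + h)] (C n) ∧
      P A * ENNReal.ofReal (Real.exp (-(exitBound Q * h))) ≤ P (C n) := by
    intro n
    have := hJ.le_measure_grid hQ (δ := h / 2 ^ n) hA hAx (2 ^ n)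
    rw [hgrid] at this
    have hg : ((2 ^ n : ℕ) : ℝ) * ((h / 2 ^ n : ℝ≥0) : ℝ) = h := by exact_mod_cast hgrid n
    rwa [hg] at this
  -- The dyadic grids are nested: point `k` of level `n` is point `2 * k` of level `n + 1`.
  -- Continuity from above then preserves the lower bound in the limit.
  have hanti : Antitone C := by
    refine antitone_nat_of_succ_le fun n ω hω => ⟨hω.1, fun k hk => ?_⟩
    have := hω.2 (2 * k) (by rw [pow_succ]; omega)
    have e : ((2 * k : ℕ) : ℝ≥0) * (h / 2 ^ (n + 1)) = k * (h / 2 ^ n) := by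
      rw [pow_succ]
      push_cast
      field_simp
    rwa [e] at this
  refine ⟨⋂ n, C n, fun ω hω => (Set.mem_iInter.1 hω 0).1,
    MeasurableSet.iInter fun n => (hC n).1, ?_, fun ω hω r hr => ?_⟩
  · have ht := tendsto_measure_iInter_atTop (μ := P) (s := C)
      (fun n => (hJ.processHistory_le _ _ (hC n).1).nullMeasurableSet) hanti
      ⟨0, measure_ne_top _ _⟩
    have hpos : 0 < P A * ENNReal.ofReal (Real.exp (-(exitBound Q * h))) :=
      ENNReal.mul_pos hPA.ne' (by simp [Real.exp_pos])
    exact hpos.trans_le (ge_of_tendsto' ht fun n => (hC n).2)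
  · obtain ⟨v, hv, hconst⟩ := (hJ.cadlag ω).exists_forall_Ico_eq r
    obtain ⟨n, k, hk, hmem⟩ := exists_dyadic_between hr hv
    have h1 := (Set.mem_iInter.1 hω n).2 k hk
    exact (hconst _ hmem).symm.trans h1

/-- The set of times before `s` at which two paths differ. -/
def diffSet {E : Type*} (f g : ℝ≥0 → E) (s : ℝ≥0) : Set ℝ :=
  {r | 0 ≤ r ∧ r < s ∧ f r.toNNReal ≠ g r.toNNReal}

theorem diffSet_subset {E : Type*} (f g : ℝ≥0 → E) {s u : ℝ≥0} :
    diffSet f g u ⊆ diffSet f g s ∪ Set.Ico (s : ℝ) u := by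
  rintro r ⟨h0, h1, h2⟩
  rcases lt_or_ge r s with h | h
  · exact Or.inl ⟨h0, h, h2⟩
  · exact Or.inr ⟨h, h1⟩

/-- The chain follows a given path up to a small set of times with positive probability,
on an event observable at time `s`. -/
def FollowsUntil (P : Measure Ω) (J : ℝ≥0 → Ω → E) (g : ℝ≥0 → E) (s : ℝ≥0) : Prop :=
  ∀ δ : ℝ, 0 < δ → ∃ A, MeasurableSet[processHistory J s] A ∧ 0 < P A ∧
    ∀ ω ∈ A, volume (diffSet (fun r => J r ω) g s) ≤ ENNReal.ofReal δ

/-- A last stretch shorter than `δ / 2` may be ignored, because only the measure of the disagreement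
counts. This gives closedness under increasing limits of times. -/
theorem FollowsUntil.of_lt {g : ℝ≥0 → E} {s : ℝ≥0}
    (h : ∀ ε : ℝ≥0, 0 < ε → ∃ u ≤ s, s < u + ε ∧ FollowsUntil P J g u) : FollowsUntil P J g s := by
  intro δ hδ
  obtain ⟨u, hus, hsu, hu⟩ := h (δ / 2).toNNReal (by simpa using hδ)
  obtain ⟨A, hA, hPA, hvol⟩ := hu (δ / 2) (by positivity)
  refine ⟨A, processHistory_mono J hus _ hA, hPA, fun ω hω => ?_⟩
  have hsu' : (s : ℝ) < u + δ / 2 := by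
    have : (s : ℝ) < ((u + (δ / 2).toNNReal : ℝ≥0) : ℝ) := by exact_mod_cast hsu
    rwa [NNReal.coe_add, Real.coe_toNNReal _ (by positivity)] at this
  calc volume (diffSet (fun r => J r ω) g s)
      ≤ volume (diffSet (fun r => J r ω) g u ∪ Set.Ico (u : ℝ) s) :=
        measure_mono (diffSet_subset _ _)
    _ ≤ ENNReal.ofReal (δ / 2) + ENNReal.ofReal (δ / 2) := by
        refine (measure_union_le _ _).trans (add_le_add (hvol ω hω) ?_)
        rw [Real.volume_Ico]
        exact ENNReal.ofReal_le_ofReal (by linarith)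
    _ = ENNReal.ofReal δ := by rw [← ENNReal.ofReal_add (by positivity) (by positivity), add_halves]

/-- From whatever state `i` it occupies at time `s`, the chain can reach `g s` within a time `η < δ
/ 2` by irreducibility, and can then hold there until `u`. Only `[s, s + η)` adds to the
disagreement. Observability of the event at time `s` is what permits restarting the chain. -/
theorem FollowsUntil.extend (hJ : IsMarkovChain P Q J) [IsProbabilityMeasure P]
    [DiscreteTopology E] (hQ : IsGeneratorMatrix Q) (hirr : IsIrreducibleGenerator Q)
    {g : ℝ≥0 → E} {s u : ℝ≥0} (hsu : s < u) (hg : ∀ r ∈ Set.Ico s u, g r = g s)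
    (h : FollowsUntil P J g s) : FollowsUntil P J g u := by
  intro δ hδ
  obtain ⟨A, hA, hPA, hvol⟩ := h (δ / 2) (by positivity)
  obtain ⟨i, hi⟩ : ∃ i, 0 < P (A ∩ J s ⁻¹' {i}) := by
    by_contra! hcon
    refine hPA.ne' (measure_mono_null (t := ⋃ i, A ∩ J s ⁻¹' {i}) (fun ω hω => ?_) ?_)
    · exact Set.mem_iUnion.2 ⟨J s ω, hω, rfl⟩
    · exact measure_iUnion_null fun i => nonpos_iff_eq_zero.1 (hcon i)
  obtain ⟨η, hη0, hη⟩ : ∃ η : ℝ≥0, 0 < η ∧ η < min (δ / 2).toNNReal (u - s) :=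
    exists_between (lt_min (by simpa using hδ) (tsub_pos_of_lt hsu))
  have hsη : s + η ≤ u := by
    have := hη.le.trans (min_le_right _ _)
    rwa [le_tsub_iff_left hsu.le] at this
  let A₁ := A ∩ J s ⁻¹' {i} ∩ J (s + η) ⁻¹' {g s}
  have hA₁ : MeasurableSet[processHistory J (s + η)] A₁ := by
    refine MeasurableSet.inter (processHistory_mono J le_self_add _ (hA.inter ?_)) ?_
    · exact measurableSet_processHistory J le_rfl i
    · exact measurableSet_processHistory J le_rfl _
  have hPA₁ : 0 < P A₁ := by
    rw [show P A₁ = _ from hJ.markov s (s + η) le_self_add A hA i (g s)]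
    refine ENNReal.mul_pos hi.ne' ?_
    rw [NNReal.coe_add, add_sub_cancel_left, Ne, ENNReal.ofReal_eq_zero, not_le]
    exact exp_smul_apply_pos hQ hirr hη0 _ _
  obtain ⟨B, hBA, hB, hPB, hBJ⟩ := hJ.exists_holding hQ (u - (s + η)) hA₁ hPA₁ (fun ω hω => hω.2)
  rw [add_tsub_cancel_of_le hsη] at hB hBJ
  refine ⟨B, hB, hPB, fun ω hω => ?_⟩
  have hsub : diffSet (fun r => J r ω) g u
      ⊆ diffSet (fun r => J r ω) g s ∪ Set.Ico (s : ℝ) (s + η) := by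
    rintro r ⟨h0, h1, h2⟩
    rcases lt_or_ge r s with h | h
    · exact Or.inl ⟨h0, h, h2⟩
    refine Or.inr ⟨h, ?_⟩
    by_contra! h3
    have hr1 : r.toNNReal ∈ Set.Ico (s + η) u :=
      ⟨by rwa [Real.le_toNNReal_iff_coe_le h0], by rwa [Real.toNNReal_lt_iff_lt_coe h0]⟩
    refine h2 ((hBJ ω hω _ hr1).trans (hg _ ⟨le_self_add.trans hr1.1, hr1.2⟩).symm)
  have hη' : (η : ℝ) ≤ δ / 2 := by
    have := hη.le.trans (min_le_left _ _)
    rw [Real.le_toNNReal_iff_coe_le (by positivity)] at this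
    exact this
  calc volume (diffSet (fun r => J r ω) g u)
      ≤ volume (diffSet (fun r => J r ω) g s ∪ Set.Ico (s : ℝ) (s + η)) := measure_mono hsub
    _ ≤ ENNReal.ofReal (δ / 2) + ENNReal.ofReal (δ / 2) := by
        refine (measure_union_le _ _).trans (add_le_add (hvol ω (hBA hω).1.1) ?_)
        rw [Real.volume_Ico]
        exact ENNReal.ofReal_le_ofReal (by linarith)
    _ = ENNReal.ofReal δ := by rw [← ENNReal.ofReal_add (by positivity) (by positivity), add_halves]

/-- Continuous induction along `[0, t]`: the good times form a closed set containing `0`, and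
right-continuity of `g` provides a constant piece on which to continue past any good time. No
decomposition of `g` into finitely many pieces is needed. -/
theorem IsMarkovChain.followsUntil (hJ : IsMarkovChain P Q J) [IsProbabilityMeasure P]
    [DiscreteTopology E] (hQ : IsGeneratorMatrix Q) (hirr : IsIrreducibleGenerator Q)
    {g : ℝ≥0 → E} (hg : IsCadlagPath g) (t : ℝ≥0) : FollowsUntil P J g t := by
  let S : Set ℝ≥0 := {s | ∀ u ≤ s, FollowsUntil P J g u}
  have hzero : (0 : ℝ≥0) ∈ S := by
    intro u hu δ hδ
    refine ⟨Set.univ, MeasurableSet.univ, by simp, fun ω _ => ?_⟩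
    have : diffSet (fun r => J r ω) g u = ∅ := by
      ext r
      simp only [diffSet, Set.mem_ofPred_eq, Set.mem_empty_iff_false, iff_false, not_and]
      intro h0 h1
      rw [nonpos_iff_eq_zero.1 hu] at h1
      exact absurd h1 (not_lt.2 h0)
    simp [this]
  have hclosed : IsClosed S := by
    refine isClosed_of_closure_subset fun s hs u hu => ?_
    have hlt : ∀ w < s, FollowsUntil P J g w := fun w hw => by
      obtain ⟨s', hs', hsS⟩ := mem_closure_iff.1 hs (Set.Ioi w) isOpen_Ioi hw
      exact hsS w (le_of_lt hs')
    rcases hu.lt_or_eq with h | rfl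
    · exact hlt u h
    rcases eq_zero_or_pos u with rfl | hpos
    · exact hzero 0 le_rfl
    refine FollowsUntil.of_lt fun ε hε => ?_
    have : max 0 (u - ε) < u := max_lt hpos (tsub_lt_self hpos hε)
    obtain ⟨w, hw1, hw2⟩ := exists_between this
    exact ⟨w, hw2.le, lt_add_of_tsub_lt_right ((le_max_right _ _).trans_lt hw1), hlt w hw2⟩
  refine (IsClosed.Icc_subset_of_forall_exists_gt (a := 0) (b := t)
    (hclosed.inter isClosed_Icc) hzero fun s hs y hy => ?_) ⟨zero_le, le_rfl⟩ t le_rfl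
  obtain ⟨v, hv, hconst⟩ := hg.exists_forall_Ico_eq s
  refine ⟨min v y, fun u hu => ?_, lt_min hv hy, min_le_right _ _⟩
  rcases le_or_gt u s with h | h
  · exact hs.1 u h
  · exact (hs.1 s le_rfl).extend hJ hQ hirr h fun r hr =>
      hconst r ⟨hr.1, hr.2.trans_le (hu.trans (min_le_left _ _))⟩

end Markov

/-! ### Measurability of paths -/

section Measurability

variable {S E : Type*} [MeasurableSpace S] [TopologicalSpace E] [DiscreteTopology E]
  [MeasurableSpace E] [DiscreteMeasurableSpace E]

/-- Discretizing time by rounding up keeps the approximations to the right of `s`, where the path is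
continuous. -/
theorem tendsto_floor_add_one_div (s : ℝ≥0) :
    Tendsto (fun n : ℕ => ((⌊s * (n + 1)⌋₊ : ℝ≥0) + 1) / (n + 1)) atTop (𝓝[≥] s) := by
  have lower : ∀ n : ℕ, s ≤ ((⌊s * (n + 1)⌋₊ : ℝ≥0) + 1) / (n + 1) := fun n => by
    rw [le_div_iff₀ (by positivity)]
    exact (Nat.lt_floor_add_one _).le
  refine tendsto_nhdsWithin_iff.2 ⟨?_, Eventually.of_forall fun n => ?_⟩
  · have hub : Tendsto (fun n : ℕ => s + 1 / ((n : ℝ≥0) + 1)) atTop (𝓝 (s + 0)) :=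
      tendsto_const_nhds.add tendsto_one_div_add_atTop_nhds_zero_nat
    rw [add_zero] at hub
    exact tendsto_of_tendsto_of_tendsto_of_le_of_le tendsto_const_nhds hub lower fun n => by
      rw [add_div]
      gcongr
      exact div_le_of_le_mul₀ zero_le zero_le (Nat.floor_le zero_le)
  · exact lower n

/-- A right-continuous process with values in a countable discrete space is jointly measurable. -/
theorem measurable_uncurry_of_cadlag {J : ℝ≥0 → S → E} (hm : ∀ s, Measurable (J s))
    (hc : ∀ ω, IsCadlagPath fun s => J s ω) : Measurable fun p : S × ℝ≥0 => J p.2 p.1 := by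
  refine measurable_of_tendsto_metrizable
    (f := fun (n : ℕ) (p : S × ℝ≥0) => J (((⌊p.2 * (n + 1)⌋₊ : ℝ≥0) + 1) / (n + 1)) p.1)
    (fun n => ?_) ?_
  · have h1 : ∀ a : ℕ → ℝ≥0, Measurable fun q : S × ℕ => J (a q.2) q.1 := fun a =>
      measurable_from_prod_countable_left fun k => hm (a k)
    have h2 : ∀ (a : ℕ → ℝ≥0) (c : ℝ≥0), Measurable fun p : S × ℝ≥0 => J (a ⌊p.2 * c⌋₊) p.1 :=
      fun a c => (h1 a).comp
        (measurable_fst.prodMk (Nat.measurable_floor.comp (measurable_snd.mul_const c)))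
    exact h2 (fun k => ((k : ℝ≥0) + 1) / (n + 1)) (n + 1)
  · rw [tendsto_pi_nhds]
    intro p
    exact ((hc p.1).1 p.2).tendsto.comp (tendsto_floor_add_one_div p.2)

theorem IsCadlagPath.measurable {f : ℝ≥0 → E} (hf : IsCadlagPath f) : Measurable f :=
  (measurable_uncurry_of_cadlag (S := Unit) (J := fun s _ => f s) (fun _ => measurable_const)
    fun _ => hf).comp (measurable_const.prodMk measurable_id : Measurable fun s : ℝ≥0 => ((), s))

end Measurability

/-! ### The random Poisson parameter as a functional of the path -/

section Phi

set_option linter.unusedSectionVars false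

variable {E : Type*} [Finite E] [MeasurableSpace E] [DiscreteMeasurableSpace E]

theorem exists_forall_le_of_finite (g : E → ℝ≥0) : ∃ C : ℝ, 0 ≤ C ∧ ∀ x, (g x : ℝ) ≤ C := by
  obtain ⟨C, hC⟩ := (Set.finite_range g).bddAbove
  exact ⟨C, C.coe_nonneg, fun x => by exact_mod_cast hC ⟨x, rfl⟩⟩

theorem measurable_path_comp (g : E → ℝ≥0) {f : ℝ≥0 → E} (hf : Measurable f) :
    Measurable fun r : ℝ => (g (f r.toNNReal) : ℝ) :=
  measurable_coe_nnreal_real.comp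
    (Measurable.of_discrete.comp (hf.comp measurable_real_toNNReal))

theorem intervalIntegrable_of_bounded {F : ℝ → ℝ} (hF : Measurable F) {C : ℝ} (hC : ∀ r, |F r| ≤ C)
    (a b : ℝ) : IntervalIntegrable F volume a b := by
  rw [intervalIntegrable_iff]
  exact Measure.integrableOn_of_bounded measure_Ioc_lt_top.ne hF.aestronglyMeasurable
    (Eventually.of_forall hC)

theorem intervalIntegrable_path (g : E → ℝ≥0) {f : ℝ≥0 → E} (hf : Measurable f) (a b : ℝ) :
    IntervalIntegrable (fun r : ℝ => (g (f r.toNNReal) : ℝ)) volume a b := by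
  obtain ⟨C, -, hC⟩ := exists_forall_le_of_finite g
  exact intervalIntegrable_of_bounded (measurable_path_comp g hf)
    (fun r => by rw [abs_of_nonneg (NNReal.coe_nonneg _)]; exact hC _) a b

theorem pathIntegral_nonneg (g : E → ℝ≥0) (f : ℝ≥0 → E) {u v : ℝ≥0} (h : u ≤ v) :
    0 ≤ pathIntegral g f u v :=
  intervalIntegral.integral_nonneg (by exact_mod_cast h) fun _ _ => NNReal.coe_nonneg _

theorem pathIntegral_eq_sub (g : E → ℝ≥0) {f : ℝ≥0 → E} (hf : Measurable f) (u v : ℝ≥0) :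
    pathIntegral g f u v = pathIntegral g f 0 v - pathIntegral g f 0 u := by
  unfold pathIntegral
  rw [intervalIntegral.integral_interval_sub_left (intervalIntegrable_path g hf _ _)
    (intervalIntegrable_path g hf _ _)]

theorem continuous_pathIntegral (g : E → ℝ≥0) {f : ℝ≥0 → E} (hf : Measurable f) :
    Continuous fun u : ℝ≥0 => pathIntegral g f 0 u := by
  unfold pathIntegral
  exact (intervalIntegral.continuous_primitive (fun a b => intervalIntegrable_path g hf a b) _).comp
    NNReal.continuous_coe

theorem monotone_pathIntegral (g : E → ℝ≥0) {f : ℝ≥0 → E} (hf : Measurable f) :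
    Monotone fun u : ℝ≥0 => pathIntegral g f 0 u := fun u v h => by
  have := pathIntegral_eq_sub g hf u v
  have h' := pathIntegral_nonneg g f h
  simp only
  linarith

/-- The integrand of `phi`. -/
noncomputable def phiIntegrand (lam kap mu : E → ℝ≥0) (t : ℝ≥0) (f : ℝ≥0 → E) (s : ℝ) : ℝ :=
  (lam (f s.toNNReal) : ℝ) * Real.exp (-(kap (f s.toNNReal) : ℝ) * pathIntegral mu f s.toNNReal t)

theorem measurable_phiIntegrand (lam kap mu : E → ℝ≥0) (t : ℝ≥0) {f : ℝ≥0 → E}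
    (hf : Measurable f) : Measurable (phiIntegrand lam kap mu t f) := by
  have h : Measurable fun s : ℝ => pathIntegral mu f s.toNNReal t := by
    rw [funext fun s : ℝ => pathIntegral_eq_sub mu hf s.toNNReal t]
    exact measurable_const.sub
      ((continuous_pathIntegral mu hf).measurable.comp measurable_real_toNNReal)
  exact (measurable_path_comp lam hf).mul
    (Real.measurable_exp.comp ((measurable_path_comp kap hf).neg.mul h))

theorem phiIntegrand_nonneg (lam kap mu : E → ℝ≥0) (t : ℝ≥0) (f : ℝ≥0 → E) (s : ℝ) :
    0 ≤ phiIntegrand lam kap mu t f s :=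
  mul_nonneg (NNReal.coe_nonneg _) (Real.exp_pos _).le

theorem phiIntegrand_le (lam kap mu : E → ℝ≥0) {t : ℝ≥0} (f : ℝ≥0 → E) {s : ℝ} (hs : s ≤ t) :
    phiIntegrand lam kap mu t f s ≤ lam (f s.toNNReal) := by
  refine mul_le_of_le_one_right (NNReal.coe_nonneg _) (Real.exp_le_one_iff.2 ?_)
  have := pathIntegral_nonneg mu f (u := s.toNNReal) (v := t)
    (Real.toNNReal_le_iff_le_coe.2 hs)
  rw [neg_mul, neg_nonpos]
  positivity

theorem phi_nonneg (lam kap mu : E → ℝ≥0) (t : ℝ≥0) (f : ℝ≥0 → E) : 0 ≤ phi lam kap mu t f :=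
  intervalIntegral.integral_nonneg t.coe_nonneg fun s _ => phiIntegrand_nonneg lam kap mu t f s

theorem exists_phi_le (lam kap mu : E → ℝ≥0) (t : ℝ≥0) : ∃ C, ∀ f, phi lam kap mu t f ≤ C := by
  obtain ⟨C, hC0, hC⟩ := exists_forall_le_of_finite lam
  refine ⟨C * |(t : ℝ) - 0|, fun f => ?_⟩
  refine (Real.le_norm_self _).trans (intervalIntegral.norm_integral_le_of_norm_le_const ?_)
  intro s hs
  rw [Set.uIoc_of_le t.coe_nonneg] at hs
  exact (abs_of_nonneg (phiIntegrand_nonneg lam kap mu t f s)).le.trans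
    ((phiIntegrand_le lam kap mu f hs.2).trans (hC _))

theorem measurableSet_diffSet [Countable E] {f g : ℝ≥0 → E} (hf : Measurable f) (hg : Measurable g)
    (s : ℝ≥0) : MeasurableSet (diffSet f g s) := by
  have h : MeasurableSet {r : ℝ | f r.toNNReal = g r.toNNReal} :=
    measurableSet_eq_fun (hf.comp measurable_real_toNNReal) (hg.comp measurable_real_toNNReal)
  exact (measurableSet_le measurable_const measurable_id).inter
    ((measurableSet_lt measurable_id measurable_const).inter h.compl)

theorem volume_diffSet_ne_top {E : Type*} (f g : ℝ≥0 → E) (s : ℝ≥0) :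
    volume (diffSet f g s) ≠ ⊤ :=
  ne_top_of_le_ne_top (measure_Icc_lt_top (a := (0 : ℝ)) (b := s)).ne
    (measure_mono fun _ hr => ⟨hr.1, hr.2.1.le⟩)

/-- Integrals of functions that nearly agree off `diffSet f g t`. -/
theorem abs_integral_sub_le {f g : ℝ≥0 → E} (hf : Measurable f) (hg : Measurable g) {t : ℝ≥0}
    {F G : ℝ → ℝ} {a : ℝ} (ha : 0 ≤ a) (hat : a ≤ t)
    (hF : IntervalIntegrable F volume a t) (hG : IntervalIntegrable G volume a t)
    {C₁ C₂ : ℝ} (hC₁ : 0 ≤ C₁) (hC₂ : 0 ≤ C₂) (hdiff : ∀ s, a ≤ s → s ≤ t → |F s - G s| ≤ C₁)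
    (heq : ∀ s, a ≤ s → s ≤ t → f s.toNNReal = g s.toNNReal → |F s - G s| ≤ C₂) :
    |(∫ s in a..t, F s) - ∫ s in a..t, G s|
      ≤ C₁ * (volume (diffSet f g t)).toReal + C₂ * t := by
  have hD := measurableSet_diffSet hf hg t
  have hi1 : Integrable ((diffSet f g t).indicator fun _ => C₁) :=
    (integrable_indicator_iff hD).2 (integrableOn_const (volume_diffSet_ne_top f g t))
  rw [← intervalIntegral.integral_sub hF hG]
  have hbound : ∀ᵐ s : ℝ, s ∈ Set.Ioc a (t : ℝ) →
      ‖F s - G s‖ ≤ (diffSet f g t).indicator (fun _ => C₁) s + C₂ := by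
    have hne : ∀ᵐ s : ℝ, s ≠ t := by simp [ae_iff]
    filter_upwards [hne] with s hs hmem
    by_cases h : f s.toNNReal = g s.toNNReal
    · have h0 : 0 ≤ (diffSet f g t).indicator (fun _ => C₁) s :=
        Set.indicator_nonneg (fun _ _ => hC₁) s
      have := heq s hmem.1.le hmem.2 h
      rw [Real.norm_eq_abs]
      linarith
    · have : s ∈ diffSet f g t := ⟨ha.trans hmem.1.le, lt_of_le_of_ne hmem.2 hs, h⟩
      rw [Set.indicator_of_mem this, Real.norm_eq_abs]
      linarith [hdiff s hmem.1.le hmem.2]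
  refine (intervalIntegral.norm_integral_le_of_norm_le hat hbound
    (hi1.intervalIntegrable.add intervalIntegrable_const)).trans ?_
  rw [intervalIntegral.integral_add hi1.intervalIntegrable intervalIntegrable_const,
    intervalIntegral.integral_const, smul_eq_mul, mul_comm _ C₂]
  refine add_le_add ?_ (mul_le_mul_of_nonneg_left (by linarith) hC₂)
  rw [intervalIntegral.integral_of_le hat]
  refine (setIntegral_le_integral hi1 (Eventually.of_forall fun s =>
    Set.indicator_nonneg (fun _ _ => hC₁) s)).trans (le_of_eq ?_)
  rw [integral_indicator_const _ hD, smul_eq_mul, mul_comm, measureReal_def]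

/-- `phi` is Lipschitz in the amount of time during which two paths differ. -/
theorem exists_abs_phi_sub_le (lam kap mu : E → ℝ≥0) (t : ℝ≥0) :
    ∃ C : ℝ, 0 ≤ C ∧ ∀ f g : ℝ≥0 → E, Measurable f → Measurable g →
      |phi lam kap mu t f - phi lam kap mu t g| ≤ C * (volume (diffSet f g t)).toReal := by
  obtain ⟨L, hL0, hL⟩ := exists_forall_le_of_finite lam
  obtain ⟨K, hK0, hK⟩ := exists_forall_le_of_finite kap
  obtain ⟨M, hM0, hM⟩ := exists_forall_le_of_finite mu
  -- The term `L` accounts for times at which the paths differ; at the other times the integrands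
  -- differ only through the work integrals in the exponent, by at most `L * K * M` times the
  -- disagreement, over a period of length `t`.
  refine ⟨L + L * K * M * t, by positivity, fun f g hf hg => ?_⟩
  set D := (volume (diffSet f g t)).toReal with hD
  have hD0 : 0 ≤ D := ENNReal.toReal_nonneg
  have hint : ∀ h : ℝ≥0 → E, Measurable h →
      IntervalIntegrable (phiIntegrand lam kap mu t h) volume 0 t := fun h hh => by
    refine (intervalIntegrable_path lam hh 0 t).mono_fun
      (measurable_phiIntegrand lam kap mu t hh).aestronglyMeasurable ?_
    rw [Set.uIoc_of_le t.coe_nonneg]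
    filter_upwards [ae_restrict_mem measurableSet_Ioc] with s hs
    rw [Real.norm_of_nonneg (phiIntegrand_nonneg _ _ _ _ _ _),
      Real.norm_of_nonneg (NNReal.coe_nonneg _)]
    exact phiIntegrand_le lam kap mu h hs.2
  have hmu : ∀ s : ℝ, 0 ≤ s → s ≤ t →
      |pathIntegral mu f s.toNNReal t - pathIntegral mu g s.toNNReal t| ≤ M * D := by
    intro s h0 hst
    have := abs_integral_sub_le hf hg h0 hst (intervalIntegrable_path mu hf _ _)
      (intervalIntegrable_path mu hg _ _) hM0 le_rfl
      (fun r _ _ => abs_sub_le_of_nonneg_of_le (NNReal.coe_nonneg _) (hM _)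
        (NNReal.coe_nonneg _) (hM _)) (fun r _ _ h => by rw [h]; simp)
    unfold pathIntegral
    rw [Real.coe_toNNReal _ h0]
    linarith
  have := abs_integral_sub_le hf hg le_rfl t.coe_nonneg (hint f hf) (hint g hg) hL0
    (C₂ := L * (K * (M * D))) (by positivity)
    (fun s _ hs => abs_sub_le_of_nonneg_of_le (phiIntegrand_nonneg _ _ _ _ _ _)
      ((phiIntegrand_le lam kap mu f hs).trans (hL _)) (phiIntegrand_nonneg _ _ _ _ _ _)
      ((phiIntegrand_le lam kap mu g hs).trans (hL _))) ?_
  · refine this.trans (le_of_eq ?_)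
    ring
  · intro s h0 hst hfg
    unfold phiIntegrand
    rw [hfg, ← mul_sub, abs_mul, abs_of_nonneg (NNReal.coe_nonneg _)]
    refine mul_le_mul (hL _) ?_ (abs_nonneg _) hL0
    have hle : ∀ h : ℝ≥0 → E, 0 ≤ pathIntegral mu h s.toNNReal t := fun h =>
      pathIntegral_nonneg mu h (Real.toNNReal_le_iff_le_coe.2 hst)
    -- The exponential is 1-Lipschitz on the nonpositive half-line.
    have hexp : ∀ x y : ℝ, x ≤ 0 → y ≤ 0 → |Real.exp x - Real.exp y| ≤ |x - y| := by
      have key : ∀ x y : ℝ, x ≤ 0 → y ≤ x → Real.exp x - Real.exp y ≤ x - y := fun x y hx hyx => by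
        have h1 := Real.add_one_le_exp (y - x)
        have h2 : Real.exp y = Real.exp x * Real.exp (y - x) := by rw [← Real.exp_add]; ring_nf
        have h3 := Real.exp_le_one_iff.2 hx
        nlinarith [Real.exp_pos x]
      intro x y hx hy
      rcases le_total y x with h | h
      · rw [abs_of_nonneg (sub_nonneg.2 (Real.exp_le_exp.2 h)), abs_of_nonneg (sub_nonneg.2 h)]
        exact key x y hx h
      · rw [abs_sub_comm, abs_sub_comm x,
          abs_of_nonneg (sub_nonneg.2 (Real.exp_le_exp.2 h)), abs_of_nonneg (sub_nonneg.2 h)]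
        exact key y x hy h
    refine (hexp _ _ ?_ ?_).trans ?_
    · nlinarith [hle f, (kap (g s.toNNReal)).coe_nonneg]
    · nlinarith [hle g, (kap (g s.toNNReal)).coe_nonneg]
    · rw [← mul_sub, abs_mul, abs_neg, abs_of_nonneg (NNReal.coe_nonneg _)]
      exact mul_le_mul (hK _) (hmu s h0 hst) (abs_nonneg _) hK0

end Phi

/-! ### Splicing paths and the intermediate value property -/

section Splice

variable {E : Type*}

/-- The path that follows `g` before time `θ` and `h` from then on. -/
noncomputable def splice (g h : ℝ≥0 → E) (θ s : ℝ≥0) : E := if s < θ then g s else h s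

theorem IsCadlagPath.spliced [TopologicalSpace E] {g h : ℝ≥0 → E} (hg : IsCadlagPath g)
    (hh : IsCadlagPath h) (θ : ℝ≥0) : IsCadlagPath (splice g h θ) := by
  have hlt : ∀ s < θ, splice g h θ =ᶠ[𝓝 s] g := fun s hs => by
    filter_upwards [Iio_mem_nhds hs] with r hr using if_pos hr
  constructor
  · intro s
    rcases lt_or_ge s θ with hs | hs
    · exact (hg.1 s).congr_of_eventuallyEq ((hlt s hs).filter_mono inf_le_left) (if_pos hs)
    · refine (hh.1 s).congr (fun r hr => ?_) ?_
      · exact if_neg (hs.trans hr).not_gt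
      · exact if_neg hs.not_gt
  · intro s hs0
    rcases le_or_gt s θ with hs | hs
    · obtain ⟨l, hl⟩ := hg.2 s hs0
      refine ⟨l, hl.congr' ?_⟩
      filter_upwards [self_mem_nhdsWithin] with r hr
      exact (if_pos (lt_of_lt_of_le hr hs)).symm
    · obtain ⟨l, hl⟩ := hh.2 s hs0
      refine ⟨l, hl.congr' ?_⟩
      filter_upwards [mem_nhdsWithin_of_mem_nhds (Ioi_mem_nhds hs)] with r hr
      exact (if_neg (le_of_lt hr).not_gt).symm

theorem diffSet_splice_subset (g h : ℝ≥0 → E) (θ θ' t : ℝ≥0) :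
    diffSet (splice g h θ) (splice g h θ') t ⊆ Set.uIcc (θ : ℝ) θ' := by
  rintro r ⟨h0, -, hne⟩
  by_contra hr
  apply hne
  unfold splice
  rw [Set.mem_uIcc, not_or, not_and, not_and, not_le, not_le] at hr
  have key : r.toNNReal < θ ↔ r.toNNReal < θ' := by
    rw [Real.toNNReal_lt_iff_lt_coe h0, Real.toNNReal_lt_iff_lt_coe h0]
    constructor
    · intro h1
      by_contra! h2
      exact absurd (hr.2 h2) (not_lt.2 h1.le)
    · intro h1
      by_contra! h2
      exact absurd (hr.1 h2) (not_lt.2 h1.le)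
  simp only [key]

/-- The values of `phi` along càdlàg paths form an interval. -/
theorem ordConnected_phi_image [Finite E] [MeasurableSpace E] [DiscreteMeasurableSpace E]
    [TopologicalSpace E] [DiscreteTopology E] (lam kap mu : E → ℝ≥0) (t : ℝ≥0) :
    (phi lam kap mu t '' {g | IsCadlagPath g}).OrdConnected := by
  obtain ⟨C, hC0, hC⟩ := exists_abs_phi_sub_le lam kap mu t
  refine ⟨?_⟩
  rintro _ ⟨h, hh, rfl⟩ _ ⟨g, hg, rfl⟩ y hy
  -- Moving the splicing time from `θ` to `θ'` alters the path only between these times, so the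
  -- value moves by at most `C |θ - θ'|`. The intermediate value theorem then runs from `h` at `θ =
  -- 0` to `g` at `θ = t`.
  have hcont : Continuous fun θ : ℝ≥0 => phi lam kap mu t (splice g h θ) := by
    refine LipschitzWith.continuous (K := C.toNNReal) (LipschitzWith.of_dist_le_mul fun θ θ' => ?_)
    rw [Real.dist_eq, NNReal.dist_eq, Real.coe_toNNReal _ hC0]
    refine (hC _ _ (hg.spliced hh θ).measurable (hg.spliced hh θ').measurable).trans
      (mul_le_mul_of_nonneg_left ?_ hC0)
    refine ENNReal.toReal_le_of_le_ofReal (abs_nonneg _)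
      ((measure_mono (diffSet_splice_subset g h θ θ' t)).trans (le_of_eq ?_))
    rw [Real.volume_interval, abs_sub_comm]
  have h0 : phi lam kap mu t (splice g h 0) = phi lam kap mu t h := by
    congr 1
    ext s
    exact if_neg not_lt_zero
  have ht : phi lam kap mu t (splice g h t) = phi lam kap mu t g := by
    have := hC _ _ (hg.spliced hh t).measurable hg.measurable
    have e : diffSet (splice g h t) g t = ∅ := by
      ext r
      simp only [diffSet, Set.mem_ofPred_eq, Set.mem_empty_iff_false, iff_false, not_and, not_not]
      intro h1 h2
      exact if_pos ((Real.toNNReal_lt_iff_lt_coe h1).2 h2)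
    rw [e, measure_empty, ENNReal.toReal_zero, mul_zero] at this
    exact sub_eq_zero.1 (abs_nonpos_iff.1 this)
  have hivt := intermediate_value_Icc (zero_le : (0 : ℝ≥0) ≤ t) hcont.continuousOn
  simp only [h0, ht] at hivt
  obtain ⟨θ, -, hθ⟩ := hivt hy
  exact ⟨_, hg.spliced hh θ, hθ⟩

end Splice

/-! ### Measurability along random paths -/

section RandomPath

set_option linter.unusedSectionVars false

variable {S E : Type*} [MeasurableSpace S] [Finite E] [MeasurableSpace E]
  [DiscreteMeasurableSpace E] {J : ℝ≥0 → S → E}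

theorem measurable_path_of_uncurry (hJ : Measurable fun p : S × ℝ≥0 => J p.2 p.1) (ω : S) :
    Measurable fun s => J s ω :=
  hJ.comp (measurable_const.prodMk measurable_id)

theorem measurable_intervalIntegral_param {F : S → ℝ → ℝ} (hF : Measurable (Function.uncurry F)) :
    Measurable fun p : S × ℝ≥0 => ∫ r in (0 : ℝ)..p.2, F p.1 r := by
  have e : (fun p : S × ℝ≥0 => ∫ r in (0 : ℝ)..p.2, F p.1 r)
      = fun p : S × ℝ≥0 => ∫ r : ℝ, if 0 < r ∧ r ≤ (p.2 : ℝ) then F p.1 r else 0 := by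
    funext p
    rw [intervalIntegral.integral_of_le p.2.coe_nonneg, ← integral_indicator measurableSet_Ioc]
    simp only [Set.indicator, Set.mem_Ioc]
  rw [e]
  refine (StronglyMeasurable.integral_prod_right (ν := (volume : Measure ℝ))
    (f := fun (p : S × ℝ≥0) (r : ℝ) => if 0 < r ∧ r ≤ (p.2 : ℝ) then F p.1 r else 0) ?_).measurable
  refine Measurable.stronglyMeasurable (Measurable.ite ?_ ?_ measurable_const)
  · exact (measurableSet_lt measurable_const measurable_snd).inter (measurableSet_le measurable_snd
      (measurable_coe_nnreal_real.comp (measurable_snd.comp measurable_fst)))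
  · exact hF.comp ((measurable_fst.comp measurable_fst).prodMk measurable_snd)

theorem measurable_pathIntegral_uncurry (hJ : Measurable fun p : S × ℝ≥0 => J p.2 p.1)
    (g : E → ℝ≥0) :
    Measurable fun p : S × ℝ≥0 => pathIntegral g (fun s => J s p.1) 0 p.2 := by
  refine measurable_intervalIntegral_param (F := fun ω r => (g (J r.toNNReal ω) : ℝ)) ?_
  exact measurable_coe_nnreal_real.comp (Measurable.of_discrete.comp
    (hJ.comp (measurable_fst.prodMk (measurable_real_toNNReal.comp measurable_snd))))

theorem measurable_pathIntegral_uncurry_left (hJ : Measurable fun p : S × ℝ≥0 => J p.2 p.1)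
    (g : E → ℝ≥0) (t : ℝ≥0) :
    Measurable fun p : S × ℝ≥0 => pathIntegral g (fun s => J s p.1) p.2 t := by
  have h := measurable_pathIntegral_uncurry hJ g
  rw [funext fun p : S × ℝ≥0 =>
    pathIntegral_eq_sub g (measurable_path_of_uncurry hJ p.1) p.2 t]
  exact (h.comp (measurable_fst.prodMk measurable_const)).sub h

theorem measurable_phi (hJ : Measurable fun p : S × ℝ≥0 => J p.2 p.1) (lam kap mu : E → ℝ≥0)
    (t : ℝ≥0) : Measurable fun ω => phi lam kap mu t fun s => J s ω := by
  have hpath : Measurable fun p : S × ℝ => J p.2.toNNReal p.1 :=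
    hJ.comp (measurable_fst.prodMk (measurable_real_toNNReal.comp measurable_snd))
  have hcoe : ∀ g : E → ℝ≥0, Measurable fun p : S × ℝ => (g (J p.2.toNNReal p.1) : ℝ) := fun g =>
    measurable_coe_nnreal_real.comp (Measurable.of_discrete.comp hpath)
  have hmu : Measurable fun p : S × ℝ => pathIntegral mu (fun s => J s p.1) p.2.toNNReal t :=
    (measurable_pathIntegral_uncurry_left hJ mu t).comp
      (measurable_fst.prodMk (measurable_real_toNNReal.comp measurable_snd))
  have hF : Measurable (Function.uncurry fun (ω : S) => phiIntegrand lam kap mu t fun s => J s ω) :=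
    (hcoe lam).mul (Real.measurable_exp.comp ((hcoe kap).neg.mul hmu))
  exact (measurable_intervalIntegral_param hF).comp (measurable_id.prodMk measurable_const)

end RandomPath

/-! ### The support of the random parameter -/

section Support

set_option linter.unusedSectionVars false

variable {Ω E : Type*} [MeasurableSpace Ω] [Fintype E] [DecidableEq E] [TopologicalSpace E]
  [DiscreteTopology E] [MeasurableSpace E] [DiscreteMeasurableSpace E] {P : Measure Ω}
  [IsProbabilityMeasure P] {Q : Matrix E E ℝ} {J : ℝ≥0 → Ω → E}

theorem IsMarkovChain.measurable_uncurry (hJ : IsMarkovChain P Q J) :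
    Measurable fun p : Ω × ℝ≥0 => J p.2 p.1 :=
  measurable_uncurry_of_cadlag hJ.measurable hJ.cadlag

/-- Every value of `phi` along a càdlàg path is in the support of its law. -/
theorem IsMarkovChain.map_phi_ball_pos (hJ : IsMarkovChain P Q J) (hQ : IsGeneratorMatrix Q)
    (hirr : IsIrreducibleGenerator Q) (lam kap mu : E → ℝ≥0) (t : ℝ≥0) {g : ℝ≥0 → E}
    (hg : IsCadlagPath g) {ε : ℝ} (hε : 0 < ε) :
    0 < P.map (fun ω => phi lam kap mu t fun s => J s ω)
      (Metric.ball (phi lam kap mu t g) ε) := by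
  obtain ⟨C, hC0, hC⟩ := exists_abs_phi_sub_le lam kap mu t
  obtain ⟨A, -, hPA, hA⟩ := hJ.followsUntil hQ hirr hg t (ε / (C + 1)) (by positivity)
  rw [Measure.map_apply (measurable_phi hJ.measurable_uncurry lam kap mu t)
    Metric.isOpen_ball.measurableSet]
  refine hPA.trans_le (measure_mono fun ω hω => ?_)
  rw [Set.mem_preimage, Metric.mem_ball, Real.dist_eq]
  refine (hC _ _ (hJ.cadlag ω).measurable hg.measurable).trans_lt ?_
  calc C * (volume (diffSet (fun s => J s ω) g t)).toReal
      ≤ C * (ε / (C + 1)) :=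
        mul_le_mul_of_nonneg_left (ENNReal.toReal_le_of_le_ofReal (by positivity) (hA ω hω)) hC0
    _ < ε := by
        rw [← mul_div_assoc, div_lt_iff₀ (by positivity)]
        nlinarith

/-- The extreme values need not be attained, so `a` itself may not be a value. Some value always
lies within `ε / 2` of it: one approximating an endpoint, or `a` itself if values exist on both
sides. -/
theorem IsMarkovChain.map_phi_ball_pos_of_mem_Icc (hJ : IsMarkovChain P Q J)
    (hQ : IsGeneratorMatrix Q) (hirr : IsIrreducibleGenerator Q) (lam kap mu : E → ℝ≥0) (t : ℝ≥0)
    {p q : ℝ} (hp : IsGLB (phi lam kap mu t '' {g | IsCadlagPath g}) p)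
    (hq : IsLUB (phi lam kap mu t '' {g | IsCadlagPath g}) q) {a : ℝ} (ha : a ∈ Set.Icc p q)
    {ε : ℝ} (hε : 0 < ε) :
    0 < P.map (fun ω => phi lam kap mu t fun s => J s ω) (Metric.ball a ε) := by
  obtain ⟨α, hα, -, hαp⟩ := hp.exists_between (show p < a + ε / 2 by linarith [ha.1])
  obtain ⟨β, hβ, hβq, -⟩ := hq.exists_between (show a - ε / 2 < q by linarith [ha.2])
  obtain ⟨y, ⟨g, hg, rfl⟩, hy⟩ : ∃ y ∈ phi lam kap mu t '' {g | IsCadlagPath g},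
      |y - a| < ε / 2 := by
    by_cases h1 : a - ε / 2 < α
    · exact ⟨α, hα, abs_sub_lt_iff.2 ⟨by linarith, by linarith⟩⟩
    by_cases h2 : β < a + ε / 2
    · exact ⟨β, hβ, abs_sub_lt_iff.2 ⟨by linarith, by linarith⟩⟩
    refine ⟨a, (ordConnected_phi_image lam kap mu t).out hα hβ ⟨?_, ?_⟩, by simpa using hε⟩
    · linarith
    · linarith
  refine (hJ.map_phi_ball_pos hQ hirr lam kap mu t hg (half_pos hε)).trans_le
    (measure_mono (Metric.ball_subset_ball' ?_))
  rw [Real.dist_eq]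
  linarith

theorem IsMarkovChain.map_phi_compl_Icc (hJ : IsMarkovChain P Q J) (lam kap mu : E → ℝ≥0)
    (t : ℝ≥0) {p q : ℝ} (hp : IsGLB (phi lam kap mu t '' {g | IsCadlagPath g}) p)
    (hq : IsLUB (phi lam kap mu t '' {g | IsCadlagPath g}) q) :
    P.map (fun ω => phi lam kap mu t fun s => J s ω) (Set.Icc p q)ᶜ = 0 := by
  rw [Measure.map_apply (measurable_phi hJ.measurable_uncurry lam kap mu t)
    measurableSet_Icc.compl]
  convert measure_empty (μ := P)
  ext ω
  have : phi lam kap mu t (fun s => J s ω) ∈ phi lam kap mu t '' {g | IsCadlagPath g} :=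
    ⟨_, hJ.cadlag ω, rfl⟩
  simpa using ⟨hp.1 this, hq.1 this⟩

theorem IsMarkovChain.attainableSet_eq (hJ : IsMarkovChain P Q J)
    (hQ : IsGeneratorMatrix Q) (hirr : IsIrreducibleGenerator Q) (lam kap mu : E → ℝ≥0) (t : ℝ≥0)
    {p q : ℝ} (hp : IsGLB (phi lam kap mu t '' {g | IsCadlagPath g}) p)
    (hq : IsLUB (phi lam kap mu t '' {g | IsCadlagPath g}) q) (hp0 : 0 ≤ p) :
    attainableSet (fun _ => P.map fun ω => phi lam kap mu t fun s => J s ω) = Set.Icc p q := by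
  ext a
  constructor
  · rintro ⟨-, h⟩
    by_contra ha
    obtain ⟨ε, hε, hball⟩ := Metric.isOpen_iff.1 (isClosed_Icc (a := p) (b := q)).isOpen_compl a ha
    obtain ⟨N, hN⟩ := h ε hε
    exact (hN N le_rfl).ne' (measure_mono_null hball (hJ.map_phi_compl_Icc lam kap mu t hp hq))
  · exact fun ha => ⟨hp0.trans ha.1, fun ε hε =>
      ⟨0, fun _ _ => hJ.map_phi_ball_pos_of_mem_Icc hQ hirr lam kap mu t hp hq ha hε⟩⟩

end Support

/-! ### Arrival times and the number of jobs -/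

section Jobs

set_option linter.unusedSectionVars false

variable {E : Type*} [Finite E] [MeasurableSpace E] [DiscreteMeasurableSpace E]

/-- The first time at which the clock `∫ lam` reaches `u`. -/
noncomputable def hitTime (lam : E → ℝ≥0) (f : ℝ≥0 → E) (u : ℝ) : ℝ≥0∞ :=
  ⨅ (s : ℝ≥0) (_ : u ≤ pathIntegral lam f 0 s), (s : ℝ≥0∞)

/-- The infimum is attained because the clock is continuous: if it is still below `u` at time `a`,
it remains so until some later `b`. -/
theorem hitTime_le_iff (lam : E → ℝ≥0) {f : ℝ≥0 → E} (hf : Measurable f) {u : ℝ} {a : ℝ≥0} :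
    hitTime lam f u ≤ a ↔ u ≤ pathIntegral lam f 0 a := by
  refine ⟨fun h => ?_, fun h => iInf₂_le a h⟩
  by_contra! hlt
  have hev := (continuous_pathIntegral lam hf).continuousAt.eventually_lt_const hlt
  obtain ⟨b, hb, hsub⟩ := mem_nhdsGE_iff_exists_Icc_subset.1 (mem_nhdsWithin_of_mem_nhds hev)
  have : (b : ℝ≥0∞) ≤ hitTime lam f u := by
    refine le_iInf₂ fun s hs => ?_
    rw [ENNReal.coe_le_coe]
    by_contra! hsb
    have h1 : pathIntegral lam f 0 b < u := hsub ⟨le_of_lt hb, le_rfl⟩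
    exact absurd (hs.trans (monotone_pathIntegral lam hf hsb.le)) (not_le.2 h1)
  exact absurd (this.trans h) (not_le.2 (by exact_mod_cast hb))

variable {S : Type*} [MeasurableSpace S] {J : ℝ≥0 → S → E}

theorem measurable_hitTime (hJ : Measurable fun p : S × ℝ≥0 => J p.2 p.1) (lam : E → ℝ≥0)
    {T : S → ℝ} (hT : Measurable T) :
    Measurable fun ω => hitTime lam (fun s => J s ω) (T ω) := by
  refine measurable_of_Iic fun a => ?_
  induction a with
  | top => simp
  | coe a =>
    have : (fun ω => hitTime lam (fun s => J s ω) (T ω)) ⁻¹' Set.Iic (a : ℝ≥0∞)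
        = {ω | T ω ≤ pathIntegral lam (fun s => J s ω) 0 a} := by
      ext ω
      exact hitTime_le_iff lam (measurable_path_of_uncurry hJ ω)
    rw [this]
    exact measurableSet_le hT ((measurable_pathIntegral_uncurry hJ lam).comp
      (measurable_id.prodMk measurable_const))

/-- Valid for infinite sets too, where both sides take the default value `0`. It reduces
measurability of a random cardinality to that of its membership events. -/
theorem Set.ncard_eq_toReal_tsum (A : Set ℕ) :
    (A.ncard : ℝ) = (∑' k, A.indicator (1 : ℕ → ℝ≥0∞) k).toReal := by
  rw [← tsum_subtype A (1 : ℕ → ℝ≥0∞)]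
  simp only [Pi.one_apply]
  rw [ENNReal.tsum_set_one, Set.ncard_def]
  cases h : A.encard <;> simp

/-- The number of jobs present is a measurable function of the randomness. -/
theorem measurable_numJobs (hJ : Measurable fun p : S × ℝ≥0 => J p.2 p.1)
    (lam kap mu : E → ℝ≥0) (t : ℝ≥0) :
    Measurable fun p : S × ((ℕ → ℝ) × (ℕ → ℝ)) =>
      (numJobs lam kap mu (fun s => J s p.1) p.2.1 p.2.2 t : ℝ) := by
  have hJ' : Measurable fun q : (S × ((ℕ → ℝ) × (ℕ → ℝ))) × ℝ≥0 => J q.2 q.1.1 :=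
    hJ.comp ((measurable_fst.comp measurable_fst).prodMk measurable_snd)
  have hT : ∀ k, Measurable fun p : S × ((ℕ → ℝ) × (ℕ → ℝ)) => baseArrival p.2.1 k := fun k => by
    unfold baseArrival
    fun_prop
  have harr : ∀ k, Measurable fun p : S × ((ℕ → ℝ) × (ℕ → ℝ)) =>
      arrivalTime lam (fun s => J s p.1) p.2.1 k := fun k => measurable_hitTime
        (J := fun s (p : S × ((ℕ → ℝ) × (ℕ → ℝ))) => J s p.1) hJ' lam (hT k)
  have hx : ∀ k, Measurable fun p : S × ((ℕ → ℝ) × (ℕ → ℝ)) =>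
      J (arrivalTime lam (fun s => J s p.1) p.2.1 k).toNNReal p.1 := fun k =>
    hJ'.comp (measurable_id.prodMk (harr k).ennreal_toNNReal)
  have hset : ∀ k, MeasurableSet {p : S × ((ℕ → ℝ) × (ℕ → ℝ)) |
      k ∈ jobsPresent lam kap mu (fun s => J s p.1) p.2.1 p.2.2 t} := by
    intro k
    suffices hserv : MeasurableSet {p : S × ((ℕ → ℝ) × (ℕ → ℝ)) |
        serviceRequirement kap (J (arrivalTime lam (fun s => J s p.1) p.2.1 k).toNNReal p.1)
          (p.2.2 k) ≤ ENNReal.ofReal (pathIntegral mu (fun s => J s p.1)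
            (arrivalTime lam (fun s => J s p.1) p.2.1 k).toNNReal t)} from
      (measurableSet_le (harr k) measurable_const).inter hserv.compl
    refine measurableSet_le ?_ ?_
    · have hk : Measurable fun p : S × ((ℕ → ℝ) × (ℕ → ℝ)) =>
          kap (J (arrivalTime lam (fun s => J s p.1) p.2.1 k).toNNReal p.1) :=
        Measurable.of_discrete.comp (hx k)
      unfold serviceRequirement
      refine Measurable.ite (measurableSet_lt measurable_const hk) ?_ measurable_const
      refine ENNReal.measurable_ofReal.comp (Measurable.div ?_ hk.coe_nnreal_real)
      fun_prop
    · exact ENNReal.measurable_ofReal.comp ((measurable_pathIntegral_uncurry_left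
        (J := fun s (p : S × ((ℕ → ℝ) × (ℕ → ℝ))) => J s p.1) hJ' mu t).comp
        (measurable_id.prodMk (harr k).ennreal_toNNReal))
  unfold numJobs
  simp_rw [Set.ncard_eq_toReal_tsum]
  refine ENNReal.measurable_toReal.comp (Measurable.tsum fun k => ?_)
  have e : (fun p : S × ((ℕ → ℝ) × (ℕ → ℝ)) =>
      (jobsPresent lam kap mu (fun s => J s p.1) p.2.1 p.2.2 t).indicator (1 : ℕ → ℝ≥0∞) k)
      = {p : S × ((ℕ → ℝ) × (ℕ → ℝ)) |
        k ∈ jobsPresent lam kap mu (fun s => J s p.1) p.2.1 p.2.2 t}.indicator 1 := by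
    ext p
    simp [Set.indicator]
  rw [e]
  exact measurable_one.indicator (hset k)

end Jobs

/-! ### Exponentials of primitives -/

/-- The fundamental theorem of calculus for the exponential of the primitive of a bounded function,
`∫_u^L c(v) exp(∫_v^L c) dv = exp(∫_u^L c) - 1`. -/
theorem integral_mul_exp_primitive {c : ℝ → ℂ} (hc : Measurable c) {C : ℝ} (hC : ∀ v, ‖c v‖ ≤ C)
    (u L : ℝ) :
    ∫ v in u..L, c v * Complex.exp (∫ w in v..L, c w) = Complex.exp (∫ w in u..L, c w) - 1 := by
  have hint : ∀ a b, IntervalIntegrable c volume a b := fun a b => by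
    rw [intervalIntegrable_iff]
    exact Measure.integrableOn_of_bounded measure_Ioc_lt_top.ne hc.aestronglyMeasurable
      (Eventually.of_forall hC)
  have hC0 : 0 ≤ C := (norm_nonneg _).trans (hC 0)
  let a : ℝ → ℂ := fun v => ∫ w in v..L, c w
  have ha : a = fun v => -∫ w in L..v, c w := by
    funext v
    exact intervalIntegral.integral_symm _ _
  have halip : LipschitzWith C.toNNReal a := by
    refine LipschitzWith.of_dist_le_mul fun x y => ?_
    have : a x - a y = ∫ w in x..y, c w := by
      rw [sub_eq_iff_eq_add]
      exact (intervalIntegral.integral_add_adjacent_intervals (hint x y) (hint y L)).symm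
    rw [dist_eq_norm, this, Real.coe_toNNReal _ hC0, dist_comm, Real.dist_eq]
    exact intervalIntegral.norm_integral_le_of_norm_le_const fun v _ => hC v
  have hacont : Continuous a := halip.continuous
  obtain ⟨R, hR⟩ := isCompact_uIcc.exists_bound_of_continuousOn (s := Set.uIcc u L)
    hacont.continuousOn
  have hexpac : AbsolutelyContinuousOnInterval (fun v => Complex.exp (a v)) u L := by
    obtain ⟨K, hK⟩ := (Complex.contDiff_exp (n := 1) (𝕜 := ℝ)).contDiffOn.exists_lipschitzOnWith
      (by decide) (convex_closedBall (0 : ℂ) R) (isCompact_closedBall _ _)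
    refine (hK.comp (halip.lipschitzOnWith (s := Set.uIcc u L)) fun x hx => ?_)
      |>.absolutelyContinuousOnInterval
    simpa using hR x hx
  have hb : IntervalIntegrable (fun v => c v * Complex.exp (a v)) volume u L :=
    (hint u L).mul_continuousOn (Complex.continuous_exp.comp hacont).continuousOn
  have hbac : AbsolutelyContinuousOnInterval
      (fun x => ∫ v in u..x, c v * Complex.exp (a v)) u L := by
    refine LipschitzOnWith.absolutelyContinuousOnInterval (K := (C * Real.exp R).toNNReal)
      (LipschitzOnWith.of_dist_le_mul fun x hx y hy => ?_)
    have hsub : ∀ x ∈ Set.uIcc u L, ∀ y ∈ Set.uIcc u L,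
        IntervalIntegrable (fun v => c v * Complex.exp (a v)) volume x y := fun x hx y hy =>
      hb.mono_set (Set.uIcc_subset_uIcc hx hy)
    rw [dist_eq_norm, intervalIntegral.integral_interval_sub_left
      (hsub u (by simp) x hx) (hsub u (by simp) y hy), Real.coe_toNNReal _ (by positivity),
      Real.dist_eq]
    refine intervalIntegral.norm_integral_le_of_norm_le_const fun v hv => ?_
    rw [norm_mul]
    refine mul_le_mul (hC v) ((Complex.norm_exp_le_exp_norm _).trans (Real.exp_le_exp.2 ?_))
      (norm_nonneg _) hC0
    exact hR v (Set.uIcc_subset_uIcc hy hx (Set.uIoc_subset_uIcc hv))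
  have hsum := hexpac.add hbac
  -- Since `c` is only measurable, the primitive is differentiable merely almost everywhere.
  -- Absolute continuity compensates: `exp (a v)` plus the integral from `u` to `v` has derivative
  -- zero almost everywhere, hence is constant, and the endpoints give the identity.
  obtain ⟨K, hK⟩ := hsum.const_of_ae_hasDerivAt_zero (by
    filter_upwards [(hint u L).ae_hasDerivAt_integral, hb.ae_hasDerivAt_integral] with x h1 h2 hx
    have d1 : HasDerivAt a (-(c x)) x := by
      rw [ha]
      exact (h1 hx L (by simp)).neg
    have d2 := (d1.cexp).add (h2 hx u (by simp))
    convert! d2 using 1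
    ring)
  have e1 := hK u (by simp)
  have e2 := hK L (by simp)
  simp only [Pi.add_apply, intervalIntegral.integral_same, add_zero, a, Complex.exp_zero] at e1 e2
  rw [e1, ← e2]
  ring

/-! ### The time change -/

section TimeChange

set_option linter.unusedSectionVars false

variable {E : Type*} [Finite E] [MeasurableSpace E] [DiscreteMeasurableSpace E]

theorem measurable_hitTime_right (lam : E → ℝ≥0) {f : ℝ≥0 → E} (hf : Measurable f) :
    Measurable (hitTime lam f) :=
  measurable_hitTime (J := fun s (_ : ℝ) => f s) (hf.comp measurable_snd) lam measurable_id

theorem pathIntegral_min (lam : E → ℝ≥0) {f : ℝ≥0 → E} (hf : Measurable f) (s t : ℝ≥0) :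
    pathIntegral lam f 0 (min s t) = min (pathIntegral lam f 0 s) (pathIntegral lam f 0 t) :=
  (monotone_pathIntegral lam hf).map_min

theorem toNNReal_hitTime_le_iff (lam : E → ℝ≥0) {f : ℝ≥0 → E} (hf : Measurable f) {t : ℝ≥0} {u : ℝ}
    (hu : u ≤ pathIntegral lam f 0 t) (a : ℝ≥0) :
    (hitTime lam f u).toNNReal ≤ a ↔ u ≤ pathIntegral lam f 0 a := by
  have hfin : hitTime lam f u ≠ ⊤ :=
    ne_top_of_le_ne_top ENNReal.coe_ne_top ((hitTime_le_iff lam hf).2 hu)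
  rw [← hitTime_le_iff lam hf, ← ENNReal.coe_le_coe, ENNReal.coe_toNNReal hfin]

/-- The hitting times of the clock `∫ lam` push Lebesgue measure forward to `lam(f(s)) ds`. -/
theorem map_hitTime (lam : E → ℝ≥0) {f : ℝ≥0 → E} (hf : Measurable f) (t : ℝ≥0) :
    (volume.restrict (Set.Ioc 0 (pathIntegral lam f 0 t))).map
        (fun u => ((hitTime lam f u).toNNReal : ℝ))
      = (volume.restrict (Set.Ioc (0 : ℝ) t)).withDensity
          (fun s => (lam (f s.toNNReal) : ℝ≥0∞)) := by
  have hτ : Measurable fun u : ℝ => ((hitTime lam f u).toNNReal : ℝ) :=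
    (measurable_hitTime_right lam hf).ennreal_toNNReal.coe_nnreal_real
  have hfin : IsFiniteMeasure ((volume.restrict (Set.Ioc 0 (pathIntegral lam f 0 t))).map
      (fun u => ((hitTime lam f u).toNNReal : ℝ))) := inferInstance
  -- Finite measures on the line are determined by half-lines, and for `a ≥ 0` both give `Iic a` the
  -- clock value at `min a t`.
  refine Measure.ext_of_Iic _ _ fun a => ?_
  rw [Measure.map_apply hτ measurableSet_Iic, Measure.restrict_apply (hτ measurableSet_Iic),
    withDensity_apply _ measurableSet_Iic, Measure.restrict_restrict measurableSet_Iic]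
  rcases lt_or_ge a 0 with ha | ha
  · have e1 : (fun u => ((hitTime lam f u).toNNReal : ℝ)) ⁻¹' Set.Iic a
        ∩ Set.Ioc 0 (pathIntegral lam f 0 t) = ∅ := by
      ext u
      simp only [Set.mem_inter_iff, Set.mem_preimage, Set.mem_Iic, Set.mem_empty_iff_false,
        iff_false, not_and]
      intro h
      exact absurd (ha.trans_le (NNReal.coe_nonneg _)) (not_lt.2 h)
    have e2 : Set.Iic a ∩ Set.Ioc (0 : ℝ) t = ∅ := by
      ext u
      simp only [Set.mem_inter_iff, Set.mem_Iic, Set.mem_Ioc, Set.mem_empty_iff_false]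
      constructor
      · rintro ⟨h1, h2, -⟩
        linarith
      · exact False.elim
    rw [e1, e2]
    simp
  · lift a to ℝ≥0 using ha
    have e1 : (fun u => ((hitTime lam f u).toNNReal : ℝ)) ⁻¹' Set.Iic (a : ℝ)
        ∩ Set.Ioc 0 (pathIntegral lam f 0 t) = Set.Ioc 0 (pathIntegral lam f 0 (min a t)) := by
      ext u
      rw [pathIntegral_min lam hf]
      simp only [Set.mem_inter_iff, Set.mem_preimage, Set.mem_Iic, Set.mem_Ioc, le_min_iff,
        NNReal.coe_le_coe]
      constructor
      · rintro ⟨h1, h2, h3⟩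
        exact ⟨h2, (toNNReal_hitTime_le_iff lam hf h3 a).1 h1, h3⟩
      · rintro ⟨h2, h1, h3⟩
        exact ⟨(toNNReal_hitTime_le_iff lam hf h3 a).2 h1, h2, h3⟩
    have e2 : Set.Iic (a : ℝ) ∩ Set.Ioc (0 : ℝ) t = Set.Ioc (0 : ℝ) (min a t : ℝ≥0) := by
      ext s
      simp only [Set.mem_inter_iff, Set.mem_Iic, Set.mem_Ioc, NNReal.coe_min, le_min_iff]
      tauto
    rw [e1, e2, Real.volume_Ioc, sub_zero]
    have hi := (intervalIntegrable_iff_integrableOn_Ioc_of_le (NNReal.coe_nonneg _)).1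
      (intervalIntegrable_path lam hf 0 (min a t : ℝ≥0))
    rw [pathIntegral, NNReal.coe_zero, intervalIntegral.integral_of_le (NNReal.coe_nonneg _),
      ofReal_integral_eq_lintegral_ofReal hi (Eventually.of_forall fun _ => NNReal.coe_nonneg _)]
    simp

/-- The substitution `u = ∫_0^s lam`, through the pushforward of measures because the clock may have
flat pieces and no inverse. -/
theorem integral_comp_hitTime (lam : E → ℝ≥0) {f : ℝ≥0 → E} (hf : Measurable f) (t : ℝ≥0)
    {ψ : ℝ → ℝ} (hψ : Measurable ψ) :
    ∫ u in (0 : ℝ)..pathIntegral lam f 0 t, ψ ((hitTime lam f u).toNNReal : ℝ)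
      = ∫ s in (0 : ℝ)..t, (lam (f s.toNNReal) : ℝ) * ψ s := by
  have hτ : Measurable fun u : ℝ => ((hitTime lam f u).toNNReal : ℝ) :=
    (measurable_hitTime_right lam hf).ennreal_toNNReal.coe_nnreal_real
  rw [intervalIntegral.integral_of_le (pathIntegral_nonneg lam f zero_le),
    intervalIntegral.integral_of_le t.coe_nonneg,
    ← integral_map hτ.aemeasurable hψ.aestronglyMeasurable, map_hitTime lam hf t,
    integral_withDensity_eq_integral_smul
      (f := fun s : ℝ => lam (f s.toNNReal))
      (Measurable.of_discrete.comp (hf.comp measurable_real_toNNReal))]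
  rfl

/-- The base mark below which a job arriving at clock time `u` has left by time `t`. -/
noncomputable def markThreshold (lam kap mu : E → ℝ≥0) (f : ℝ≥0 → E) (t : ℝ≥0) (u : ℝ) : ℝ :=
  (kap (f (hitTime lam f u).toNNReal) : ℝ) *
    max (pathIntegral mu f (hitTime lam f u).toNNReal t) 0

/-- The truncation at `0` in the threshold is inactive for arrivals up to time `t`; it makes
nonnegativity hold at every clock time, as the thinning estimates require. -/
theorem markThreshold_nonneg (lam kap mu : E → ℝ≥0) (f : ℝ≥0 → E) (t : ℝ≥0) (u : ℝ) :
    0 ≤ markThreshold lam kap mu f t u :=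
  mul_nonneg (NNReal.coe_nonneg _) (le_max_right _ _)

theorem measurable_markThreshold (lam kap mu : E → ℝ≥0) {f : ℝ≥0 → E} (hf : Measurable f)
    (t : ℝ≥0) : Measurable (markThreshold lam kap mu f t) := by
  have hτ := (measurable_hitTime_right lam hf).ennreal_toNNReal
  have h : Measurable fun s : ℝ≥0 => pathIntegral mu f s t := by
    rw [funext fun s : ℝ≥0 => pathIntegral_eq_sub mu hf s t]
    exact measurable_const.sub (continuous_pathIntegral mu hf).measurable
  exact (measurable_coe_nnreal_real.comp (Measurable.of_discrete.comp (hf.comp hτ))).mul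
    ((h.comp hτ).max measurable_const)

/-- The mean number of surviving jobs is `phi`. -/
theorem integral_exp_neg_markThreshold (lam kap mu : E → ℝ≥0) {f : ℝ≥0 → E} (hf : Measurable f)
    (t : ℝ≥0) :
    ∫ u in (0 : ℝ)..pathIntegral lam f 0 t, Real.exp (-markThreshold lam kap mu f t u)
      = phi lam kap mu t f := by
  let ψ : ℝ → ℝ := fun s =>
    Real.exp (-((kap (f s.toNNReal) : ℝ) * max (pathIntegral mu f s.toNNReal t) 0))
  have h : Measurable fun s : ℝ => pathIntegral mu f s.toNNReal t := by
    rw [funext fun s : ℝ => pathIntegral_eq_sub mu hf s.toNNReal t]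
    exact measurable_const.sub
      ((continuous_pathIntegral mu hf).measurable.comp measurable_real_toNNReal)
  have hψ : Measurable ψ :=
    Real.measurable_exp.comp (((measurable_path_comp kap hf).mul (h.max measurable_const)).neg)
  have := integral_comp_hitTime lam hf t hψ
  simp only [ψ, Real.toNNReal_coe] at this
  refine this.trans (intervalIntegral.integral_congr fun s hs => ?_)
  rw [Set.uIcc_of_le t.coe_nonneg] at hs
  have hnn : 0 ≤ pathIntegral mu f s.toNNReal t :=
    pathIntegral_nonneg mu f (Real.toNNReal_le_iff_le_coe.2 hs.2)
  simp only [max_eq_left hnn, neg_mul]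

/-- In clock time, presence becomes a condition on the base arrival and the mark alone. Positivity
of the mark settles `kap = 0`: the job never leaves, and correspondingly its threshold `0` is below
the mark. -/
theorem mem_jobsPresent_iff (lam kap mu : E → ℝ≥0) {f : ℝ≥0 → E} (hf : Measurable f)
    (t : ℝ≥0) {σ z : ℕ → ℝ} {k : ℕ} (hz : 0 < z k) :
    k ∈ jobsPresent lam kap mu f σ z t ↔ baseArrival σ k ≤ pathIntegral lam f 0 t ∧
      markThreshold lam kap mu f t (baseArrival σ k) < z k := by
  have harr : arrivalTime lam f σ k = hitTime lam f (baseArrival σ k) := rfl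
  simp only [jobsPresent, Set.mem_ofPred_eq, harr, hitTime_le_iff lam hf]
  refine and_congr_right fun hle => ?_
  have hτt : (hitTime lam f (baseArrival σ k)).toNNReal ≤ t :=
    (toNNReal_hitTime_le_iff lam hf hle t).2 hle
  have hnn := pathIntegral_nonneg mu f hτt
  unfold serviceRequirement markThreshold
  rw [max_eq_left hnn]
  split_ifs with hk
  · rw [ENNReal.ofReal_le_ofReal_iff hnn, not_le, lt_div_iff₀ (by exact_mod_cast hk), mul_comm]
  · have : kap (f (hitTime lam f (baseArrival σ k)).toNNReal) = 0 := by simpa using hk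
    rw [this]
    simpa using hz

end TimeChange

/-! ### Exponential waiting times and marks -/

theorem integral_expMeasure {F : Type*} [NormedAddCommGroup F] [NormedSpace ℝ F] (f : ℝ → F) :
    ∫ x, f x ∂expMeasure 1 = ∫ x in Set.Ioi (0 : ℝ), Real.exp (-x) • f x := by
  have h : expMeasure 1 = volume.withDensity (exponentialPDF 1) := rfl
  have hm : Measurable (exponentialPDF 1) :=
    (measurable_exponentialPDFReal 1).ennreal_ofReal
  rw [h, integral_withDensity_eq_integral_toReal_smul hm
    (Eventually.of_forall fun _ => ENNReal.ofReal_lt_top), ← integral_indicator measurableSet_Ioi]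
  refine integral_congr_ae ?_
  have hne : ∀ᵐ x : ℝ, x ≠ 0 := by simp [ae_iff]
  filter_upwards [hne] with x hx
  rw [exponentialPDF_eq]
  rcases lt_or_gt_of_ne hx with h | h
  · rw [if_neg h.not_ge, Set.indicator_of_notMem (by simpa using h.le)]
    simp
  · rw [if_pos h.le, Set.indicator_of_mem (by simpa using h),
      ENNReal.toReal_ofReal (by positivity), one_mul, one_mul]

instance : IsProbabilityMeasure (expMeasure 1) := isProbabilityMeasure_expMeasure one_pos

theorem ae_pos_expMeasure : ∀ᵐ x ∂expMeasure 1, 0 < x := by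
  have h : expMeasure 1 = volume.withDensity (exponentialPDF 1) := rfl
  have hm : Measurable (exponentialPDF 1) :=
    (measurable_exponentialPDFReal 1).ennreal_ofReal
  rw [h, ae_withDensity_iff hm]
  have hne : ∀ᵐ x : ℝ, x ≠ 0 := by simp [ae_iff]
  filter_upwards [hne] with x hx hpdf
  by_contra! hle
  exact hpdf (exponentialPDF_of_neg (lt_of_le_of_ne hle hx))

theorem integral_ite_lt_expMeasure {a : ℝ} (ha : 0 ≤ a) (x y : ℂ) :
    ∫ w, (if a < w then x else y) ∂expMeasure 1
      = y + (x - y) * (Real.exp (-a) : ℝ) := by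
  have hr : (expMeasure 1).real (Set.Ioi a) = Real.exp (-a) := by
    rw [← integral_indicator_one measurableSet_Ioi, integral_expMeasure, ← integral_exp_neg_Ioi a,
      ← integral_indicator measurableSet_Ioi, ← integral_indicator measurableSet_Ioi]
    congr 1
    ext w
    by_cases hw : a < w
    · simp [Set.indicator, hw, ha.trans_lt hw]
    · simp [Set.indicator, hw]
  have e : (fun w : ℝ => if a < w then x else y)
      = fun w => y + (Set.Ioi a).indicator (fun _ => x - y) w := by
    ext w
    by_cases hw : a < w
    · simp [hw]
    · simp [hw]
  rw [e, integral_add (integrable_const _) ((integrable_const _).indicator measurableSet_Ioi),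
    integral_indicator_const _ measurableSet_Ioi, hr]
  simp [mul_comm]

/-- Splitting an exponential expectation at time `b`. -/
theorem integral_ite_le_expMeasure {b : ℝ} (hb : 0 ≤ b) {A : ℝ → ℂ} (hA : Measurable A) {C : ℝ}
    (hC : ∀ v, ‖A v‖ ≤ C) :
    ∫ v, (if v ≤ b then A v else 1) ∂expMeasure 1
      = (∫ v in (0 : ℝ)..b, (Real.exp (-v) : ℝ) * A v) + (Real.exp (-b) : ℝ) := by
  have hexp : IntegrableOn (fun v : ℝ => Real.exp (-v)) (Set.Ioi 0) := integrableOn_exp_neg_Ioi 0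
  have hint1 : IntegrableOn (fun v : ℝ => Real.exp (-v) • (if v ≤ b then A v else 1))
      (Set.Ioi 0) := by
    refine Integrable.mono' (hexp.mul_const (max C 1)) ?_ (Eventually.of_forall fun v => ?_)
    · exact ((Real.measurable_exp.comp measurable_neg).smul
        (Measurable.ite measurableSet_Iic hA measurable_const)).aestronglyMeasurable
    · rw [norm_smul, Real.norm_of_nonneg (Real.exp_pos _).le]
      refine mul_le_mul_of_nonneg_left ?_ (Real.exp_pos _).le
      split_ifs
      · exact (hC v).trans (le_max_left _ _)
      · simp
  rw [integral_expMeasure, ← Set.Ioc_union_Ioi_eq_Ioi hb,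
    setIntegral_union (Set.Ioc_disjoint_Ioi le_rfl) measurableSet_Ioi
      (hint1.mono_set Set.Ioc_subset_Ioi_self) (hint1.mono_set (Set.Ioi_subset_Ioi hb)),
    intervalIntegral.integral_of_le hb]
  congr 1
  · refine setIntegral_congr_fun measurableSet_Ioc fun v hv => ?_
    simp only [if_pos hv.2, Complex.real_smul]
  · rw [← integral_exp_neg_Ioi b, ← integral_complex_ofReal]
    refine setIntegral_congr_fun measurableSet_Ioi fun v hv => ?_
    have hv' : ¬ v ≤ b := not_le.2 hv
    simp [hv']

/-! ### Thinned renewal counting with exponential waiting times -/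

section Thinning

/-- `s` to the number of arrivals among the first `m`, started at clock time `u`, that happen before
`L` and have a mark above the threshold `h`. -/
noncomputable def thinGen (s : ℂ) (L : ℝ) (h : ℝ → ℝ) : ℕ → ℝ → (ℕ → ℝ) → (ℕ → ℝ) → ℂ
  | 0, _, _, _ => 1
  | m + 1, u, σ, z =>
    if u + σ 0 ≤ L then
      (if h (u + σ 0) < z 0 then s else 1) *
        thinGen s L h m (u + σ 0) (fun k => σ (k + 1)) (fun k => z (k + 1))
    else 1

variable {s : ℂ} {L : ℝ} {h : ℝ → ℝ}

theorem measurable_thinGen (hh : Measurable h) (m : ℕ) :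
    Measurable fun p : ℝ × ((ℕ → ℝ) × (ℕ → ℝ)) => thinGen s L h m p.1 p.2.1 p.2.2 := by
  induction m with
  | zero => exact measurable_const
  | succ m ih =>
    have h0 : Measurable fun p : ℝ × ((ℕ → ℝ) × (ℕ → ℝ)) => p.1 + p.2.1 0 := by fun_prop
    have hz : Measurable fun p : ℝ × ((ℕ → ℝ) × (ℕ → ℝ)) => p.2.2 0 := by fun_prop
    have hshift : Measurable fun p : ℝ × ((ℕ → ℝ) × (ℕ → ℝ)) =>
        (p.1 + p.2.1 0, ((fun k => p.2.1 (k + 1)), fun k => p.2.2 (k + 1))) := by fun_prop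
    exact Measurable.ite (measurableSet_le h0 measurable_const)
      ((Measurable.ite (measurableSet_lt (hh.comp h0) hz) measurable_const measurable_const).mul
        (ih.comp hshift)) measurable_const

theorem norm_thinGen_le (hs : ‖s‖ ≤ 1) (m : ℕ) (u : ℝ) (σ z : ℕ → ℝ) :
    ‖thinGen s L h m u σ z‖ ≤ 1 := by
  induction m generalizing u σ z with
  | zero => simp [thinGen]
  | succ m ih =>
    unfold thinGen
    split_ifs
    · rw [norm_mul]
      exact mul_le_one₀ hs (norm_nonneg _) (ih _ _ _)
    · rw [norm_mul, norm_one, one_mul]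
      exact ih _ _ _
    · simp

/-- With nonnegative waiting times, once an arrival overshoots `L` so do all later ones; stopping
the recursion there agrees with continuing with factors `1`. -/
theorem thinGen_eq_prod {σ : ℕ → ℝ} (hσ : ∀ k, 0 ≤ σ k) (z : ℕ → ℝ) (m : ℕ) (u : ℝ) :
    thinGen s L h m u σ z = ∏ k ∈ Finset.range m,
      if u + baseArrival σ k ≤ L ∧ h (u + baseArrival σ k) < z k then s else 1 := by
  induction m generalizing u σ z with
  | zero => simp [thinGen]
  | succ m ih =>
    have h0 : baseArrival σ 0 = σ 0 := by simp [baseArrival]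
    have hsucc : ∀ k, u + baseArrival σ (k + 1)
        = u + σ 0 + baseArrival (fun k => σ (k + 1)) k := fun k => by
      unfold baseArrival
      rw [Finset.sum_range_succ' _ (k + 1)]
      ring
    unfold thinGen
    rw [Finset.prod_range_succ', h0]
    simp only [hsucc]
    by_cases hL : u + σ 0 ≤ L
    · rw [if_pos hL, ih (fun k => hσ (k + 1)), mul_comm]
      simp [hL]
    · rw [if_neg hL, Finset.prod_eq_one, if_neg (fun hc => hL hc.1), one_mul]
      intro k _
      refine if_neg fun hc => hL (le_trans ?_ hc.1)
      exact le_add_of_nonneg_right (Finset.sum_nonneg fun i _ => hσ (i + 1))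

/-- The limit of `thinGen`: the probability generating function of the number of retained arrivals
in `[u, L]`. -/
noncomputable def thinGenLimit (s : ℂ) (L : ℝ) (h : ℝ → ℝ) (u : ℝ) : ℂ :=
  Complex.exp ((s - 1) * ((∫ v in u..L, Real.exp (-h v) : ℝ) : ℂ))

/-- The quantity is a convex combination of `1` and `s`, namely the generating function of one
retained-or-discarded arrival. -/
theorem norm_one_add_mul_le (hs : ‖s‖ ≤ 1) {a : ℝ} (ha : 0 ≤ a) :
    ‖1 + (s - 1) * (Real.exp (-a) : ℝ)‖ ≤ 1 := by
  have h1 : Real.exp (-a) ≤ 1 := Real.exp_le_one_iff.2 (by linarith)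
  have e : 1 + (s - 1) * ((Real.exp (-a) : ℝ) : ℂ)
      = ((1 - Real.exp (-a) : ℝ) : ℂ) + s * (Real.exp (-a) : ℝ) := by
    push_cast
    ring
  rw [e]
  refine (norm_add_le _ _).trans ?_
  rw [norm_mul, Complex.norm_real, Complex.norm_real, Real.norm_of_nonneg (by linarith),
    Real.norm_of_nonneg (Real.exp_pos _).le]
  nlinarith [Real.exp_pos (-a)]

theorem norm_thinGenLimit_le (hs : ‖s‖ ≤ 1) {u : ℝ} (hu : u ≤ L) : ‖thinGenLimit s L h u‖ ≤ 1 := by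
  unfold thinGenLimit
  rw [Complex.norm_exp, Real.exp_le_one_iff, Complex.re_mul_ofReal]
  have h1 : (s - 1).re ≤ 0 := by
    have := (Complex.re_le_norm s).trans hs
    simpa using this
  exact mul_nonpos_of_nonpos_of_nonneg h1
    (intervalIntegral.integral_nonneg hu fun _ _ => (Real.exp_pos _).le)

theorem intervalIntegrable_exp_neg (hh : Measurable h) (hnn : ∀ v, 0 ≤ h v) (a b : ℝ) :
    IntervalIntegrable (fun v => Real.exp (-h v)) volume a b :=
  intervalIntegrable_of_bounded (Real.measurable_exp.comp hh.neg) (C := 1)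
    (fun r => (abs_of_pos (Real.exp_pos _)).le.trans
      (Real.exp_le_one_iff.2 (neg_nonpos.2 (hnn r)))) a b

theorem continuous_thinGenLimit (hh : Measurable h) (hnn : ∀ v, 0 ≤ h v) :
    Continuous (thinGenLimit s L h) := by
  have h1 : Continuous fun u => ∫ v in u..L, Real.exp (-h v) := by
    simp_rw [fun u => intervalIntegral.integral_symm (f := fun v => Real.exp (-h v)) (μ := volume)
      L u]
    exact (intervalIntegral.continuous_primitive (intervalIntegrable_exp_neg hh hnn) L).neg
  exact Complex.continuous_exp.comp (continuous_const.mul (Complex.continuous_ofReal.comp h1))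

/-- The renewal equation. -/
theorem thinGenLimit_renewal (hs : ‖s‖ ≤ 1) (hh : Measurable h) (hnn : ∀ v, 0 ≤ h v) {u : ℝ}
    (hu : u ≤ L) :
    ∫ v, (if u + v ≤ L then
        (1 + (s - 1) * (Real.exp (-h (u + v)) : ℝ)) * thinGenLimit s L h (u + v) else 1)
        ∂expMeasure 1 = thinGenLimit s L h u := by
  let c : ℝ → ℂ := fun v => 1 + (s - 1) * (Real.exp (-h v) : ℝ)
  have hcm : Measurable c := by
    have := Complex.measurable_ofReal.comp (Real.measurable_exp.comp hh.neg)
    exact (this.const_mul _).const_add _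
  have hc1 : ∀ v, ‖c v‖ ≤ 1 := fun v => norm_one_add_mul_le hs (hnn v)
  have hcint : ∀ v, ∫ w in v..L, c w
      = ((L - v : ℝ) : ℂ) + (s - 1) * ((∫ w in v..L, Real.exp (-h w) : ℝ) : ℂ) := fun v => by
    have hi : IntervalIntegrable (fun w => ((Real.exp (-h w) : ℝ) : ℂ)) volume v L :=
      ⟨(intervalIntegrable_exp_neg hh hnn v L).1.ofReal,
        (intervalIntegrable_exp_neg hh hnn v L).2.ofReal⟩
    simp only [c]
    rw [intervalIntegral.integral_add intervalIntegrable_const (hi.const_mul _),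
      intervalIntegral.integral_const_mul, intervalIntegral.integral_ofReal]
    simp
  -- Adding `1` to the thinned intensity in `c` produces the factor `e ^ (L - v)`, which matches the
  -- exponential density of the waiting time up to the constant `e ^ (u - L)`. The renewal equation
  -- thus becomes the identity for exponentials of primitives.
  have hG : ∀ v, Complex.exp (∫ w in v..L, c w)
      = (Real.exp (L - v) : ℝ) * thinGenLimit s L h v := fun v => by
    rw [hcint, Complex.exp_add, thinGenLimit, Complex.ofReal_exp]
  have key := integral_mul_exp_primitive hcm hc1 u L
  simp only [hG] at key
  -- The redundant inner condition makes the integrand bounded by `1` on the whole line;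
  -- `thinGenLimit` need not be bounded beyond `L`.
  have e : (fun v => if u + v ≤ L then
        (1 + (s - 1) * (Real.exp (-h (u + v)) : ℝ)) * thinGenLimit s L h (u + v) else 1)
      = fun v => if v ≤ L - u then (if u + v ≤ L then c (u + v) * thinGenLimit s L h (u + v) else 0)
        else 1 := by
    ext v
    have : u + v ≤ L ↔ v ≤ L - u := by constructor <;> intro _ <;> linarith
    by_cases hv : v ≤ L - u
    · simp [this, hv, c]
    · simp [this, hv]
  have hA : Measurable fun v =>
      if u + v ≤ L then c (u + v) * thinGenLimit s L h (u + v) else 0 := by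
    have hadd : Measurable fun v : ℝ => u + v := measurable_const_add u
    exact Measurable.ite (measurableSet_le hadd measurable_const)
      ((hcm.comp hadd).mul ((continuous_thinGenLimit hh hnn).measurable.comp hadd)) measurable_const
  rw [e, integral_ite_le_expMeasure (sub_nonneg.2 hu) hA (C := 1)]
  · have h1 : ∫ v in (0 : ℝ)..(L - u), ((Real.exp (-v) : ℝ) : ℂ) *
          (if u + v ≤ L then c (u + v) * thinGenLimit s L h (u + v) else 0)
        = ∫ v in (0 : ℝ)..(L - u), ((Real.exp (u - L) : ℝ) : ℂ) *
          (c (u + v) * (((Real.exp (L - (u + v)) : ℝ) : ℂ) * thinGenLimit s L h (u + v))) := by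
      refine intervalIntegral.integral_congr fun v hv => ?_
      rw [Set.uIcc_of_le (sub_nonneg.2 hu)] at hv
      have hexp : Real.exp (-v) = Real.exp (u - L) * Real.exp (L - (u + v)) := by
        rw [← Real.exp_add]
        ring_nf
      simp only [if_pos (show u + v ≤ L by linarith [hv.2]), hexp]
      push_cast
      ring
    rw [h1, intervalIntegral.integral_const_mul, intervalIntegral.integral_comp_add_left
      (fun v => c v * (((Real.exp (L - v) : ℝ) : ℂ) * thinGenLimit s L h v)), add_zero,
      add_sub_cancel, key, neg_sub, mul_sub, ← mul_assoc, ← Complex.ofReal_mul, ← Real.exp_add]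
    simp
  · intro v
    split_ifs with hv
    · rw [norm_mul]
      exact mul_le_one₀ (hc1 _) (norm_nonneg _) (norm_thinGenLimit_le hs hv)
    · simp

end Thinning

/-! ### The law of the number of jobs along a fixed path -/

section Law

set_option linter.unusedSectionVars false

variable {Ω : Type*} [MeasurableSpace Ω] {P : Measure Ω} [IsProbabilityMeasure P]

/-- Independent standard exponential waiting times and marks. -/
structure IsExpFamily (P : Measure Ω) (σ z : ℕ → Ω → ℝ) : Prop where
  measurable_left : ∀ k, Measurable (σ k)
  measurable_right : ∀ k, Measurable (z k)
  law_left : ∀ k, P.map (σ k) = expMeasure 1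
  law_right : ∀ k, P.map (z k) = expMeasure 1
  indep : iIndepFun (Sum.elim σ z) P

variable {σ z : ℕ → Ω → ℝ}

theorem IsExpFamily.measurable_elim (hσ : IsExpFamily P σ z) (i : ℕ ⊕ ℕ) :
    Measurable (Sum.elim σ z i) := by
  cases i with
  | inl k => exact hσ.measurable_left k
  | inr k => exact hσ.measurable_right k

theorem IsExpFamily.shift (hσ : IsExpFamily P σ z) :
    IsExpFamily P (fun k => σ (k + 1)) (fun k => z (k + 1)) where
  measurable_left k := hσ.measurable_left _
  measurable_right k := hσ.measurable_right _
  law_left k := hσ.law_left _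
  law_right k := hσ.law_right _
  indep := by
    have hinj : Function.Injective (Sum.map Nat.succ Nat.succ : ℕ ⊕ ℕ → ℕ ⊕ ℕ) :=
      Sum.map_injective.2 ⟨Nat.succ_injective, Nat.succ_injective⟩
    convert hσ.indep.precomp hinj using 1
    ext i
    cases i <;> rfl

theorem IsExpFamily.indep_head_tail (hσ : IsExpFamily P σ z) :
    IndepFun (fun ω => (σ 0 ω, z 0 ω))
      (fun ω => ((fun k => σ (k + 1) ω), fun k => z (k + 1) ω)) P := by
  let m : ℕ ⊕ ℕ → MeasurableSpace Ω := fun i =>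
    MeasurableSpace.comap (Sum.elim σ z i) inferInstance
  have hS : Disjoint ({Sum.inl 0, Sum.inr 0} : Set (ℕ ⊕ ℕ)) {Sum.inl 0, Sum.inr 0}ᶜ :=
    disjoint_compl_right
  have hind := indep_iSup_of_disjoint (m := m) (fun i => (hσ.measurable_elim i).comap_le)
    hσ.indep hS
  have hmeas : ∀ (T : Set (ℕ ⊕ ℕ)), ∀ i ∈ T, Measurable[⨆ i ∈ T, m i] (Sum.elim σ z i) :=
    fun T i hi => (comap_measurable (Sum.elim σ z i)).mono
      (le_iSup₂ (f := fun i (_ : i ∈ T) => m i) i hi) le_rfl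
  refine indep_of_indep_of_le_left (indep_of_indep_of_le_right hind ?_) ?_
  · refine Measurable.comap_le (Measurable.prodMk ?_ ?_)
    · exact @measurable_pi_lambda Ω ℕ (fun _ => ℝ) (_) _ _
        fun k => hmeas _ (Sum.inl (k + 1)) (by simp)
    · exact @measurable_pi_lambda Ω ℕ (fun _ => ℝ) (_) _ _
        fun k => hmeas _ (Sum.inr (k + 1)) (by simp)
  · exact Measurable.comap_le ((hmeas _ (Sum.inl 0) (by simp)).prodMk
      (hmeas _ (Sum.inr 0) (by simp)))

theorem IsExpFamily.map_head (hσ : IsExpFamily P σ z) :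
    P.map (fun ω => (σ 0 ω, z 0 ω)) = (expMeasure 1).prod (expMeasure 1) := by
  have h : IndepFun (σ 0) (z 0) P :=
    hσ.indep.indepFun (i := Sum.inl 0) (j := Sum.inr 0) (by simp)
  rw [(indepFun_iff_map_prod_eq_prod_map_map (hσ.measurable_left 0).aemeasurable
    (hσ.measurable_right 0).aemeasurable).1 h, hσ.law_left, hσ.law_right]

variable {s : ℂ} {L : ℝ} {h : ℝ → ℝ}

/-- Conditioning on the first waiting time and mark, which are independent of the rest: the mark
exceeds its threshold with probability `e ^ (-h)`, so the factor `s` or `1` averages to `1 + (s - 1)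
e ^ (-h)`. -/
theorem IsExpFamily.integral_thinGen_succ (hσ : IsExpFamily P σ z) (hs : ‖s‖ ≤ 1)
    (hh : Measurable h) (hnn : ∀ v, 0 ≤ h v) (m : ℕ) (u : ℝ) :
    ∫ ω, thinGen s L h (m + 1) u (fun k => σ k ω) (fun k => z k ω) ∂P
      = ∫ v, (if u + v ≤ L then (1 + (s - 1) * (Real.exp (-h (u + v)) : ℝ)) *
          ∫ ω, thinGen s L h m (u + v) (fun k => σ (k + 1) ω) (fun k => z (k + 1) ω) ∂P else 1)
          ∂expMeasure 1 := by
  let tail : Ω → (ℕ → ℝ) × (ℕ → ℝ) := fun ω => ((fun k => σ (k + 1) ω), fun k => z (k + 1) ω)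
  have htail : Measurable tail :=
    (measurable_pi_lambda _ fun k => hσ.measurable_left _).prodMk
      (measurable_pi_lambda _ fun k => hσ.measurable_right _)
  have hhead : Measurable fun ω => (σ 0 ω, z 0 ω) :=
    (hσ.measurable_left 0).prodMk (hσ.measurable_right 0)
  let H : (ℝ × ℝ) × ((ℕ → ℝ) × (ℕ → ℝ)) → ℂ := fun p =>
    if u + p.1.1 ≤ L then (if h (u + p.1.1) < p.1.2 then s else 1) *
      thinGen s L h m (u + p.1.1) p.2.1 p.2.2 else 1
  have hadd : Measurable fun p : (ℝ × ℝ) × ((ℕ → ℝ) × (ℕ → ℝ)) => u + p.1.1 := by fun_prop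
  have hH : Measurable H := by
    refine Measurable.ite (measurableSet_le hadd measurable_const)
      (Measurable.mul (Measurable.ite (measurableSet_lt (hh.comp hadd) (by fun_prop))
        measurable_const measurable_const) ?_) measurable_const
    exact (measurable_thinGen hh m).comp (hadd.prodMk measurable_snd)
  have hHn : ∀ p, ‖H p‖ ≤ 1 := fun p => by
    simp only [H]
    split_ifs
    · rw [norm_mul]
      exact mul_le_one₀ hs (norm_nonneg _) (norm_thinGen_le hs _ _ _ _)
    · rw [norm_mul, norm_one, one_mul]
      exact norm_thinGen_le hs _ _ _ _
    · simp
  have : IsProbabilityMeasure (P.map tail) := Measure.isProbabilityMeasure_map htail.aemeasurable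
  have hHi : Integrable H (((expMeasure 1).prod (expMeasure 1)).prod (P.map tail)) :=
    Integrable.of_bound hH.aestronglyMeasurable 1 (Eventually.of_forall hHn)
  have e1 : ∫ ω, thinGen s L h (m + 1) u (fun k => σ k ω) (fun k => z k ω) ∂P
      = ∫ p, H p ∂(((expMeasure 1).prod (expMeasure 1)).prod (P.map tail)) := by
    rw [← hσ.map_head, ← (indepFun_iff_map_prod_eq_prod_map_map hhead.aemeasurable
      htail.aemeasurable).1 hσ.indep_head_tail, integral_map (hhead.prodMk htail).aemeasurable
      hH.aestronglyMeasurable]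
    rfl
  rw [e1, integral_prod _ hHi, integral_prod _ hHi.integral_prod_left]
  refine integral_congr_ae (Eventually.of_forall fun v => ?_)
  simp only [H]
  by_cases hv : u + v ≤ L
  · have e2 : ∫ y, thinGen s L h m (u + v) y.1 y.2 ∂(P.map tail)
        = ∫ ω, thinGen s L h m (u + v) (fun k => σ (k + 1) ω) (fun k => z (k + 1) ω) ∂P := by
      rw [integral_map htail.aemeasurable]
      exact ((measurable_thinGen hh m).comp
        (measurable_const.prodMk measurable_id)).aestronglyMeasurable
    have e3 : ∀ w : ℝ, ∫ y, (if h (u + v) < w then s else 1) *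
        thinGen s L h m (u + v) y.1 y.2 ∂(P.map tail) = (if h (u + v) < w then s else 1) *
        ∫ ω, thinGen s L h m (u + v) (fun k => σ (k + 1) ω) (fun k => z (k + 1) ω) ∂P :=
      fun w => by rw [← e2]; exact integral_const_mul _ _
    simp only [if_pos hv]
    refine (integral_congr_ae (Eventually.of_forall e3)).trans ((integral_mul_const _ _).trans ?_)
    rw [integral_ite_lt_expMeasure (hnn _)]
  · simp [hv]

/-- Both functions obey the same renewal step, and their discrepancy propagates only if another
arrival occurs before `L`, which has probability at most `1 - e ^ (-L) < 1`. The induction varies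
the family, since the tail is a shifted copy. -/
theorem IsExpFamily.norm_integral_thinGen_sub_le (hσ : IsExpFamily P σ z) (hs : ‖s‖ ≤ 1)
    (hh : Measurable h) (hnn : ∀ v, 0 ≤ h v) (m : ℕ) {u : ℝ} (hu0 : 0 ≤ u) (hu : u ≤ L) :
    ‖(∫ ω, thinGen s L h m u (fun k => σ k ω) (fun k => z k ω) ∂P) - thinGenLimit s L h u‖
      ≤ 2 * (1 - Real.exp (-L)) ^ m := by
  induction m generalizing σ z u with
  | zero =>
    refine (norm_sub_le _ _).trans ?_
    have := norm_thinGenLimit_le (h := h) hs hu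
    simp only [thinGen, integral_const, pow_zero, mul_one]
    simp
    linarith
  | succ m ih =>
    let G : ℝ → ℂ := fun v =>
      ∫ ω, thinGen s L h m v (fun k => σ (k + 1) ω) (fun k => z (k + 1) ω) ∂P
    have hGm : Measurable G := by
      refine (StronglyMeasurable.integral_prod_right (f := fun (v : ℝ) (ω : Ω) =>
        thinGen s L h m v (fun k => σ (k + 1) ω) (fun k => z (k + 1) ω)) ?_).measurable
      refine Measurable.stronglyMeasurable ((measurable_thinGen hh m).comp
        (measurable_fst.prodMk (Measurable.prodMk ?_ ?_)))
      · exact measurable_pi_lambda _ fun k => (hσ.measurable_left _).comp measurable_snd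
      · exact measurable_pi_lambda _ fun k => (hσ.measurable_right _).comp measurable_snd
    have hGn : ∀ v, ‖G v‖ ≤ 1 := fun v =>
      (norm_integral_le_of_norm_le_const (Eventually.of_forall fun ω =>
        norm_thinGen_le hs m v _ _)).trans (by simp)
    have hadd : Measurable fun v : ℝ => u + v := measurable_const_add u
    have hcm : Measurable fun v => 1 + (s - 1) * ((Real.exp (-h (u + v)) : ℝ) : ℂ) := by
      have := Complex.measurable_ofReal.comp (Real.measurable_exp.comp (hh.comp hadd).neg)
      exact (this.const_mul _).const_add _
    have hint : ∀ A : ℝ → ℂ, Measurable A → (∀ v ≤ L, ‖A v‖ ≤ 1) →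
        Integrable (fun v => if u + v ≤ L then
          (1 + (s - 1) * ((Real.exp (-h (u + v)) : ℝ) : ℂ)) * A (u + v) else 1)
          (expMeasure 1) := fun A hA hA1 => by
      refine Integrable.of_bound (Measurable.ite (measurableSet_le hadd measurable_const)
        (hcm.mul (hA.comp hadd)) measurable_const).aestronglyMeasurable 1
        (Eventually.of_forall fun v => ?_)
      split_ifs with hv
      · rw [norm_mul]
        exact mul_le_one₀ (norm_one_add_mul_le hs (hnn _)) (norm_nonneg _) (hA1 _ hv)
      · simp
    rw [hσ.integral_thinGen_succ hs hh hnn, ← thinGenLimit_renewal hs hh hnn hu,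
      ← integral_sub (hint G hGm fun v _ => hGn v)
        (hint _ (continuous_thinGenLimit hh hnn).measurable fun v hv => norm_thinGenLimit_le hs hv)]
    have hρ : 0 ≤ 1 - Real.exp (-L) := by
      have := Real.exp_le_one_iff.2 (show -L ≤ 0 by linarith)
      linarith
    have hbound : ∀ᵐ v ∂expMeasure 1, ‖(if u + v ≤ L then
          (1 + (s - 1) * ((Real.exp (-h (u + v)) : ℝ) : ℂ)) * G (u + v) else 1) -
        (if u + v ≤ L then (1 + (s - 1) * ((Real.exp (-h (u + v)) : ℝ) : ℂ)) *
          thinGenLimit s L h (u + v) else 1)‖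
        ≤ (Set.Ioi (L - u))ᶜ.indicator (fun _ => 2 * (1 - Real.exp (-L)) ^ m) v := by
      filter_upwards [ae_pos_expMeasure] with v hv0
      by_cases hv : u + v ≤ L
      · have hmem : v ∈ (Set.Ioi (L - u))ᶜ := by
          simp only [Set.mem_compl_iff, Set.mem_Ioi, not_lt]
          linarith
        rw [if_pos hv, if_pos hv, Set.indicator_of_mem hmem, ← mul_sub, norm_mul]
        have := ih hσ.shift (u := u + v) (by linarith) hv
        calc _ ≤ 1 * (2 * (1 - Real.exp (-L)) ^ m) :=
              mul_le_mul (norm_one_add_mul_le hs (hnn _)) this (norm_nonneg _) zero_le_one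
          _ = _ := one_mul _
      · rw [if_neg hv, if_neg hv, sub_self, norm_zero]
        exact Set.indicator_nonneg (fun _ _ => by positivity) _
    refine (norm_integral_le_of_norm_le
      ((integrable_const _).indicator measurableSet_Ioi.compl) hbound).trans ?_
    rw [integral_indicator_const _ measurableSet_Ioi.compl, probReal_compl_eq_one_sub
      measurableSet_Ioi, smul_eq_mul, pow_succ]
    have hr : (expMeasure 1).real (Set.Ioi (L - u)) = Real.exp (-(L - u)) := by
      have := integral_ite_lt_expMeasure (sub_nonneg.2 hu) 1 0
      have e : (fun w : ℝ => if L - u < w then (1 : ℂ) else 0)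
          = (Set.Ioi (L - u)).indicator fun _ => 1 := by
        ext w
        simp [Set.indicator]
      rw [e, integral_indicator_const _ measurableSet_Ioi] at this
      simpa [← Complex.ofReal_exp] using this
    rw [hr]
    have : Real.exp (-L) ≤ Real.exp (-(L - u)) := Real.exp_le_exp.2 (by linarith)
    have h2 : 0 ≤ 2 * (1 - Real.exp (-L)) ^ m := by positivity
    nlinarith

end Law

/-! ### From the generating function to the Poisson law -/

section PoissonLaw

set_option linter.unusedSectionVars false

variable {Ω : Type*} [MeasurableSpace Ω] {P : Measure Ω} [IsProbabilityMeasure P]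
  {σ z : ℕ → Ω → ℝ}

theorem integrable_id_expMeasure : Integrable (fun x : ℝ => x) (expMeasure 1) := by
  have h : expMeasure 1 = volume.withDensity (exponentialPDF 1) := rfl
  have hm : Measurable (exponentialPDF 1) :=
    (measurable_exponentialPDFReal 1).ennreal_ofReal
  rw [h, integrable_withDensity_iff hm (Eventually.of_forall fun _ => ENNReal.ofReal_lt_top)]
  have hg := Real.GammaIntegral_convergent (s := 2) (by norm_num)
  rw [← integrable_indicator_iff measurableSet_Ioi] at hg
  refine hg.congr (Eventually.of_forall fun x => ?_)
  simp only [exponentialPDF_eq]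
  rcases lt_trichotomy x 0 with hx | rfl | hx
  · simp [hx.not_ge, hx.le]
  · simp
  · rw [if_pos hx.le, Set.indicator_of_mem (by simpa using hx), ENNReal.toReal_ofReal (by positivity)]
    norm_num
    ring

theorem integral_id_expMeasure : ∫ x, x ∂expMeasure 1 = 1 := by
  rw [integral_expMeasure]
  have := Real.Gamma_eq_integral (s := 2) (by norm_num)
  rw [Real.Gamma_two] at this
  rw [this]
  refine setIntegral_congr_fun measurableSet_Ioi fun x hx => ?_
  norm_num

theorem IsExpFamily.ae_forall_pos (hσ : IsExpFamily P σ z) :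
    ∀ᵐ ω ∂P, ∀ k, 0 < σ k ω ∧ 0 < z k ω := by
  rw [ae_all_iff]
  intro k
  have h1 : ∀ᵐ ω ∂P, 0 < σ k ω := ae_of_ae_map (hσ.measurable_left k).aemeasurable
    (by rw [hσ.law_left]; exact ae_pos_expMeasure)
  have h2 : ∀ᵐ ω ∂P, 0 < z k ω := ae_of_ae_map (hσ.measurable_right k).aemeasurable
    (by rw [hσ.law_right]; exact ae_pos_expMeasure)
  exact h1.and h2

/-- By the strong law, arrival times grow linearly. This makes the number of arrivals in bounded
clock time almost surely finite. -/
theorem IsExpFamily.ae_tendsto_baseArrival (hσ : IsExpFamily P σ z) :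
    ∀ᵐ ω ∂P, Tendsto (baseArrival fun k => σ k ω) atTop atTop := by
  have hid : ∀ k, IdentDistrib (σ k) (σ 0) P P := fun k =>
    ⟨(hσ.measurable_left k).aemeasurable, (hσ.measurable_left 0).aemeasurable, by
      rw [hσ.law_left, hσ.law_left]⟩
  have hmean : ∫ ω, σ 0 ω ∂P = 1 := by
    rw [← integral_id_expMeasure, ← hσ.law_left 0, integral_map (hσ.measurable_left 0).aemeasurable
      (f := fun x => x) measurable_id.aestronglyMeasurable]
  have hint : Integrable (σ 0) P := by
    have := integrable_id_expMeasure
    rw [← hσ.law_left 0] at this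
    exact this.comp_measurable (hσ.measurable_left 0)
  have hslln := strong_law_ae_real σ hint
    (fun i j hij => hσ.indep.indepFun (i := Sum.inl i) (j := Sum.inl j) (by simpa using hij)) hid
  filter_upwards [hslln] with ω hω
  rw [hmean] at hω
  have h := hω.pos_mul_atTop one_pos tendsto_natCast_atTop_atTop
  have h' : Tendsto (fun n : ℕ => ∑ i ∈ Finset.range n, σ i ω) atTop atTop := by
    refine h.congr' ?_
    filter_upwards [eventually_gt_atTop 0] with n hn
    have : (n : ℝ) ≠ 0 := by positivity
    field_simp
  exact (tendsto_add_atTop_iff_nat 1).2 h'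

variable {E : Type*} [Finite E] [MeasurableSpace E] [DiscreteMeasurableSpace E]

/-- Once `m` exceeds the number of arrivals before the final clock value, the truncation is vacuous
and each job present contributes a factor `s`. -/
theorem eventually_thinGen_eq (s : ℂ) (lam kap mu : E → ℝ≥0) {f : ℝ≥0 → E} (hf : Measurable f)
    (t : ℝ≥0) {a w : ℕ → ℝ} (ha : ∀ k, 0 < a k) (hw : ∀ k, 0 < w k)
    (htop : Tendsto (baseArrival a) atTop atTop) :
    ∀ᶠ m in atTop, thinGen s (pathIntegral lam f 0 t) (markThreshold lam kap mu f t) m 0 a w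
      = s ^ numJobs lam kap mu f a w t := by
  obtain ⟨K, hK⟩ := eventually_atTop.1 (htop.eventually_gt_atTop (pathIntegral lam f 0 t))
  filter_upwards [eventually_ge_atTop K] with m hm
  rw [thinGen_eq_prod (fun k => (ha k).le)]
  classical
  have hA : jobsPresent lam kap mu f a w t
      = ↑((Finset.range m).filter fun k => 0 + baseArrival a k ≤ pathIntegral lam f 0 t ∧
          markThreshold lam kap mu f t (0 + baseArrival a k) < w k) := by
    ext k
    rw [mem_jobsPresent_iff lam kap mu hf t (hw k)]
    simp only [zero_add, Finset.coe_filter, Finset.mem_range, Set.mem_ofPred_eq]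
    refine ⟨fun h => ⟨?_, h⟩, fun h => h.2⟩
    by_contra! hmk
    exact absurd h.1 (not_le.2 (hK k (hm.trans hmk)))
  rw [numJobs, hA, Set.ncard_coe_finset, Finset.prod_ite]
  simp

/-- The probability generating function of the number of jobs along a fixed path. -/
theorem IsExpFamily.integral_pow_numJobs (hσ : IsExpFamily P σ z) (lam kap mu : E → ℝ≥0)
    {f : ℝ≥0 → E} (hf : Measurable f) (t : ℝ≥0) {s : ℂ} (hs : ‖s‖ ≤ 1) :
    ∫ ω, s ^ numJobs lam kap mu f (fun k => σ k ω) (fun k => z k ω) t ∂P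
      = Complex.exp ((s - 1) * (phi lam kap mu t f : ℝ)) := by
  rw [← integral_exp_neg_markThreshold lam kap mu hf t]
  have hL : 0 ≤ pathIntegral lam f 0 t := pathIntegral_nonneg lam f zero_le
  have hh : Measurable (markThreshold lam kap mu f t) := measurable_markThreshold lam kap mu hf t
  have hnn : ∀ v, 0 ≤ markThreshold lam kap mu f t v := markThreshold_nonneg lam kap mu f t
  have hev := fun a w => eventually_thinGen_eq s lam kap mu hf t (a := a) (w := w)
  -- From here on the clock value and the threshold enter only through measurability, nonnegativity
  -- and the eventual identity.
  revert hL hh hnn hev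
  generalize pathIntegral lam f 0 t = L
  generalize markThreshold lam kap mu f t = h
  intro hL hh hnn hev
  have hseq : Measurable fun ω => ((fun k => σ k ω), fun k => z k ω) :=
    (measurable_pi_lambda _ hσ.measurable_left).prodMk (measurable_pi_lambda _ hσ.measurable_right)
  have hlim1 : Tendsto (fun m => ∫ ω, thinGen s L h m 0 (fun k => σ k ω) (fun k => z k ω) ∂P) atTop
      (𝓝 (∫ ω, s ^ numJobs lam kap mu f (fun k => σ k ω) (fun k => z k ω) t ∂P)) := by
    refine tendsto_integral_of_dominated_convergence (fun _ => 1) (fun m => ?_)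
      (integrable_const _) (fun m => Eventually.of_forall fun ω => norm_thinGen_le hs m _ _ _) ?_
    · exact ((measurable_thinGen hh m).comp (measurable_const.prodMk hseq)).aestronglyMeasurable
    · filter_upwards [hσ.ae_forall_pos, hσ.ae_tendsto_baseArrival] with ω hpos htop
      exact tendsto_const_nhds.congr' ((hev (fun k => σ k ω) (fun k => z k ω)
        (fun k => (hpos k).1) (fun k => (hpos k).2) htop).mono fun m hm => hm.symm)
  have hlim2 : Tendsto (fun m => ∫ ω, thinGen s L h m 0 (fun k => σ k ω) (fun k => z k ω) ∂P) atTop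
      (𝓝 (thinGenLimit s L h 0)) := by
    rw [tendsto_iff_norm_sub_tendsto_zero]
    have h1 : 0 ≤ 1 - Real.exp (-L) := by
      have := Real.exp_le_one_iff.2 (show -L ≤ 0 by linarith)
      linarith
    have hgeo := (tendsto_pow_atTop_nhds_zero_of_lt_one h1
      (by linarith [Real.exp_pos (-L)])).const_mul 2
    rw [mul_zero] at hgeo
    exact squeeze_zero (fun _ => norm_nonneg _)
      (fun m => hσ.norm_integral_thinGen_sub_le hs hh hnn m le_rfl hL) hgeo
  exact tendsto_nhds_unique hlim1 hlim2

theorem IsExpFamily.measurable_numJobs (hσ : IsExpFamily P σ z) (lam kap mu : E → ℝ≥0)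
    {f : ℝ≥0 → E} (hf : Measurable f) (t : ℝ≥0) : Measurable fun ω =>
      (numJobs lam kap mu f (fun k => σ k ω) (fun k => z k ω) t : ℝ) := by
  have hseq : Measurable fun ω => ((), ((fun k => σ k ω), fun k => z k ω)) :=
    measurable_const.prodMk ((measurable_pi_lambda _ hσ.measurable_left).prodMk
      (measurable_pi_lambda _ hσ.measurable_right))
  have hf' : Measurable fun p : Unit × ℝ≥0 => (fun (s : ℝ≥0) (_ : Unit) => f s) p.2 p.1 :=
    hf.comp measurable_snd
  have h := _root_.measurable_numJobs (S := Unit) (J := fun s _ => f s) hf' lam kap mu t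
  have h2 := h.comp hseq
  simp only [Function.comp_def] at h2
  exact h2

/-- Along a fixed path, the number of jobs present at time `t` is Poisson with mean `phi`. -/
theorem IsExpFamily.map_numJobs (hσ : IsExpFamily P σ z) (lam kap mu : E → ℝ≥0) {f : ℝ≥0 → E}
    (hf : Measurable f) (t : ℝ≥0) :
    P.map (fun ω => (numJobs lam kap mu f (fun k => σ k ω) (fun k => z k ω) t : ℝ))
      = (poissonMeasure (phi lam kap mu t f).toNNReal).map (Nat.cast : ℕ → ℝ) := by
  have hN := hσ.measurable_numJobs lam kap mu hf t
  have : IsProbabilityMeasure (P.map fun ω =>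
      (numJobs lam kap mu f (fun k => σ k ω) (fun k => z k ω) t : ℝ)) :=
    Measure.isProbabilityMeasure_map hN.aemeasurable
  refine Measure.ext_of_charFun ?_
  ext θ
  rw [charFun_map_cast_poissonMeasure, charFun_apply_real,
    integral_map hN.aemeasurable (by fun_prop)]
  -- The characteristic function at `θ` is the generating function at the point `e ^ (iθ)` of the
  -- unit circle; hence the complex `s` throughout.
  have hs : ‖Complex.exp (θ * Complex.I)‖ ≤ 1 := (Complex.norm_exp_ofReal_mul_I θ).le
  have hpow : ∀ N : ℕ, Complex.exp (θ * ((N : ℝ) : ℂ) * Complex.I)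
      = Complex.exp (θ * Complex.I) ^ N := fun N => by
    rw [← Complex.exp_nat_mul]
    push_cast
    ring_nf
  simp_rw [hpow]
  rw [hσ.integral_pow_numJobs lam kap mu hf t hs, mul_comm,
    Real.coe_toNNReal _ (phi_nonneg lam kap mu t f)]

end PoissonLaw

/-! ### Conditioning on the background path -/

section Mixture

set_option linter.unusedSectionVars false

variable {Ω : Type*} [MeasurableSpace Ω] {P : Measure Ω} [IsProbabilityMeasure P]
  {E : Type*} [Fintype E] [DecidableEq E] [TopologicalSpace E] [DiscreteTopology E]
  [MeasurableSpace E] [DiscreteMeasurableSpace E] {J : ℝ≥0 → Ω → E} {σ z : ℕ → Ω → ℝ}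

theorem IsQueueDriver.aemeasurable (h : IsQueueDriver P J σ z) :
    AEMeasurable (fun ω => ((fun k => σ k ω), fun k => z k ω)) P :=
  (aemeasurable_pi_lambda _ fun k => (h.law_interarrival k).aemeasurable).prodMk
    (aemeasurable_pi_lambda _ fun k => (h.law_mark k).aemeasurable)

/-- The coordinate process under the law of the driver. -/
theorem IsQueueDriver.isExpFamily (h : IsQueueDriver P J σ z) :
    IsExpFamily (P.map fun ω => ((fun k => σ k ω), fun k => z k ω))
      (fun k (w : (ℕ → ℝ) × (ℕ → ℝ)) => w.1 k) (fun k w => w.2 k) where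
  measurable_left k := by fun_prop
  measurable_right k := by fun_prop
  law_left k := by
    rw [AEMeasurable.map_map_of_aemeasurable (by fun_prop) h.aemeasurable]
    exact (h.law_interarrival k).map_eq
  law_right k := by
    rw [AEMeasurable.map_map_of_aemeasurable (by fun_prop) h.aemeasurable]
    exact (h.law_mark k).map_eq
  indep := by
    have hm : ∀ i : ℕ ⊕ ℕ, Measurable (Sum.elim (fun k (w : (ℕ → ℝ) × (ℕ → ℝ)) => w.1 k)
        (fun k w => w.2 k) i) := by
      rintro (k | k) <;> simp only [Sum.elim_inl, Sum.elim_inr] <;> fun_prop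
    have hpre : ∀ (i : ℕ ⊕ ℕ) (s : Set ℝ),
        (fun ω => ((fun k => σ k ω), fun k => z k ω)) ⁻¹'
          (Sum.elim (fun k (w : (ℕ → ℝ) × (ℕ → ℝ)) => w.1 k) (fun k w => w.2 k) i ⁻¹' s)
        = Sum.elim σ z i ⁻¹' s := by
      rintro (k | k) s <;> rfl
    rw [iIndepFun_iff_measure_inter_preimage_eq_mul]
    intro S sets hsets
    rw [Measure.map_apply_of_aemeasurable h.aemeasurable
      (Finset.measurableSet_biInter _ fun i hi => hm i (hsets i hi))]
    simp only [Set.preimage_iInter, hpre]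
    rw [(iIndepFun_iff_measure_inter_preimage_eq_mul.1 h.indep_driver) S hsets]
    refine Finset.prod_congr rfl fun i hi => ?_
    rw [Measure.map_apply_of_aemeasurable h.aemeasurable (hm i (hsets i hi)), hpre]

/-- Paths are restricted to càdlàg ones because joint measurability of evaluation in path and time
comes from right-continuity. -/
theorem measurable_numJobs_of_cadlag (lam kap mu : E → ℝ≥0) (t : ℝ≥0) :
    Measurable fun p : {f : ℝ≥0 → E // IsCadlagPath f} × ((ℕ → ℝ) × (ℕ → ℝ)) =>
      (numJobs lam kap mu p.1.1 p.2.1 p.2.2 t : ℝ) := by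
  have hunc : Measurable fun p : {f : ℝ≥0 → E // IsCadlagPath f} × ℝ≥0 =>
      (fun (s : ℝ≥0) (x : {f : ℝ≥0 → E // IsCadlagPath f}) => x.1 s) p.2 p.1 :=
    measurable_uncurry_of_cadlag (fun s => (measurable_pi_apply s).comp measurable_subtype_coe)
      fun x => x.2
  exact measurable_numJobs (J := fun (s : ℝ≥0) (x : {f : ℝ≥0 → E // IsCadlagPath f}) => x.1 s)
    hunc lam kap mu t

/-- The law of a function of two independent variables, by conditioning on the first one. -/
theorem map_apply_eq_lintegral_of_indepFun {S D Y : Type*} [MeasurableSpace S] [MeasurableSpace D]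
    [MeasurableSpace Y] {X : Ω → S} {W : Ω → D} (hX : Measurable X) (hW : AEMeasurable W P)
    (hXW : IndepFun X W P) {N : S × D → Y} (hN : Measurable N) {B : Set Y} (hB : MeasurableSet B) :
    P.map (fun ω => N (X ω, W ω)) B
      = ∫⁻ ω, (P.map W).map (fun w => N (X ω, w)) B ∂P := by
  have hpair : AEMeasurable (fun ω => (X ω, W ω)) P := hX.aemeasurable.prodMk hW
  have hmap : P.map (fun ω => (X ω, W ω)) = (P.map X).prod (P.map W) :=
    (indepFun_iff_map_prod_eq_prod_map_map hX.aemeasurable hW).1 hXW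
  have hcomp : P.map (fun ω => N (X ω, W ω)) = ((P.map X).prod (P.map W)).map N := by
    rw [← hmap, AEMeasurable.map_map_of_aemeasurable hN.aemeasurable hpair]
    rfl
  have : IsProbabilityMeasure (P.map W) := Measure.isProbabilityMeasure_map hW
  rw [hcomp, Measure.map_apply hN hB, Measure.prod_apply (hN hB),
    lintegral_map (measurable_measure_prodMk_left (hN hB)) hX]
  refine lintegral_congr fun ω => ?_
  rw [Measure.map_apply (by fun_prop) hB]
  rfl

theorem IsQueueDriver.aemeasurable_numJobs (h : IsQueueDriver P J σ z)
    (hm : ∀ s, Measurable (J s)) (hc : ∀ ω, IsCadlagPath fun s => J s ω) (lam kap mu : E → ℝ≥0)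
    (t : ℝ≥0) : AEMeasurable (fun ω => (numJobs lam kap mu (fun s => J s ω)
      (fun k => σ k ω) (fun k => z k ω) t : ℝ)) P := by
  have hX : Measurable fun ω => (⟨fun s => J s ω, hc ω⟩ : {f : ℝ≥0 → E // IsCadlagPath f}) :=
    Measurable.subtype_mk (measurable_pi_lambda _ hm)
  have hN := (measurable_numJobs_of_cadlag lam kap mu t).comp_aemeasurable
    (hX.aemeasurable.prodMk h.aemeasurable)
  simp only [Function.comp_def] at hN
  exact hN

/-- The number of jobs is a mixed Poisson variable with random parameter `phi`. -/
theorem IsQueueDriver.map_numJobs_apply (h : IsQueueDriver P J σ z) (hm : ∀ s, Measurable (J s))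
    (hc : ∀ ω, IsCadlagPath fun s => J s ω) (lam kap mu : E → ℝ≥0) (t : ℝ≥0) {B : Set ℝ}
    (hB : MeasurableSet B) :
    P.map (fun ω => (numJobs lam kap mu (fun s => J s ω)
      (fun k => σ k ω) (fun k => z k ω) t : ℝ)) B
      = ∫⁻ ω, poissonMeasure (phi lam kap mu t fun s => J s ω).toNNReal
          ((Nat.cast : ℕ → ℝ) ⁻¹' B) ∂P := by
  have hX : Measurable fun ω => (⟨fun s => J s ω, hc ω⟩ : {f : ℝ≥0 → E // IsCadlagPath f}) :=
    Measurable.subtype_mk (measurable_pi_lambda _ hm)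
  have hXD : IndepFun (fun ω => (⟨fun s => J s ω, hc ω⟩ : {f : ℝ≥0 → E // IsCadlagPath f}))
      (fun ω => ((fun k => σ k ω), fun k => z k ω)) P := by
    -- The subtype has the σ-algebra induced by the product, so restricting the codomain to càdlàg
    -- paths does not change the σ-algebra generated by the background.
    have := h.indep_background
    rw [IndepFun_iff_Indep] at this ⊢
    convert this using 1
    exact MeasurableSpace.comap_comp
  have key := map_apply_eq_lintegral_of_indepFun hX h.aemeasurable hXD
    (measurable_numJobs_of_cadlag lam kap mu t) hB
  simp only [] at key
  have := Measure.isProbabilityMeasure_map h.aemeasurable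
  rw [key]
  refine lintegral_congr fun ω => ?_
  rw [← Measure.map_apply measurable_from_top hB,
    ← h.isExpFamily.map_numJobs lam kap mu (hc ω).measurable t]

end Mixture

/-! ### Exponential estimates for Poisson laws -/

/-- Markov's inequality for `e ^ (θ k)`, done termwise. Writing the event as `θ * x ≤ θ * k` covers
upper tails for `θ ≥ 0` and lower tails for `θ ≤ 0` at once. -/
theorem poissonMeasure_tilt_le (r : ℝ≥0) (θ x : ℝ) :
    poissonMeasure r {k | θ * x ≤ θ * k} ≤ ENNReal.ofReal (Real.exp (r * (Real.exp θ - 1) - θ * x)) := by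
  have hs : HasSum (fun k : ℕ => Real.exp (-r - θ * x) * ((r * Real.exp θ) ^ k / k.factorial))
      (Real.exp (r * (Real.exp θ - 1) - θ * x)) := by
    have h := (NormedSpace.expSeries_div_hasSum_exp (r * Real.exp θ : ℝ)).mul_left
      (Real.exp (-r - θ * x))
    rw [← Real.exp_eq_exp_ℝ, ← Real.exp_add, show (-r - θ * x + r * Real.exp θ : ℝ)
      = r * (Real.exp θ - 1) - θ * x by ring] at h
    exact h
  rw [poissonMeasure, Measure.sum_apply _ (MeasurableSet.of_discrete), ← hs.tsum_eq,
    ENNReal.ofReal_tsum_of_nonneg (fun k => by positivity) hs.summable]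
  refine ENNReal.tsum_le_tsum fun k => ?_
  rw [Measure.smul_apply, smul_eq_mul, Measure.dirac_apply' _ MeasurableSet.of_discrete]
  by_cases hk : θ * x ≤ θ * k
  · rw [Set.indicator_of_mem (by exact hk), Pi.one_apply, mul_one]
    refine ENNReal.ofReal_le_ofReal ?_
    have h1 : Real.exp (-r - θ * x) * ((r * Real.exp θ) ^ k / k.factorial)
        = (Real.exp (-r) * r ^ k / k.factorial) * Real.exp (θ * k - θ * x) := by
      rw [mul_pow, ← Real.exp_nat_mul, sub_eq_add_neg, Real.exp_add, sub_eq_add_neg, Real.exp_add,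
        mul_comm (k : ℝ) θ]
      ring
    rw [h1]
    exact le_mul_of_one_le_right (by positivity) (Real.one_le_exp (by linarith))
  · rw [Set.indicator_of_notMem (by exact hk), mul_zero]
    exact zero_le

/-- Closedness puts the largest point of `F` below `p` in `F`, where the rate exceeds `c`;
Chernoff's bound at that point covers the rest. Its tilt is nonpositive, so the estimate for mean `n
p` persists for every larger mean `r`. -/
theorem poissonMeasure_lower_tail_le {p : ℝ} (hp : 0 ≤ p) {F : Set ℝ} (hF : IsClosed F) {c : ℝ≥0}
    (hc : ∀ a ∈ F, a ≤ p → (c : ℝ≥0∞) < poissonRate p a) {n : ℕ} (hn : 0 < n) {r : ℝ≥0}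
    (hr : n * p ≤ r) :
    poissonMeasure r {k | (k / n : ℝ) ∈ F ∧ (k / n : ℝ) ≤ p}
      ≤ ENNReal.ofReal (Real.exp (-(n * c))) := by
  have hn' : (0 : ℝ) < n := by exact_mod_cast hn
  rcases (F ∩ Set.Iic p).eq_empty_or_nonempty with he | hne
  · have : {k : ℕ | (k / n : ℝ) ∈ F ∧ (k / n : ℝ) ≤ p} = ∅ :=
      Set.eq_empty_of_forall_notMem fun k hk => by
        have : (k / n : ℝ) ∈ F ∩ Set.Iic p := hk
        rw [he] at this
        exact this
    rw [this, measure_empty]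
    exact zero_le
  have hbdd : BddAbove (F ∩ Set.Iic p) := ⟨p, fun a ha => ha.2⟩
  obtain ⟨hbF, hbp⟩ := (hF.inter isClosed_Iic).csSup_mem hne hbdd
  obtain ⟨θ, hθ, h⟩ := exists_nonpos_tilt hp hbp (hc _ hbF hbp)
  refine (measure_mono ?_).trans ((poissonMeasure_tilt_le r θ (n * sSup (F ∩ Set.Iic p))).trans
    (ENNReal.ofReal_le_ofReal (Real.exp_le_exp.2 ?_)))
  · intro k hk
    have := le_csSup hbdd hk
    rw [div_le_iff₀ hn', mul_comm] at this
    exact mul_le_mul_of_nonpos_left this hθ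
  · have h1 := Real.exp_le_one_iff.2 hθ
    nlinarith

/-- Mirror image: Chernoff's bound at the smallest point of `F` above `q`, with a nonnegative tilt,
hence uniform over smaller means. -/
theorem poissonMeasure_upper_tail_le {q : ℝ} (hq : 0 ≤ q) {F : Set ℝ} (hF : IsClosed F) {c : ℝ≥0}
    (hc : ∀ a ∈ F, q ≤ a → (c : ℝ≥0∞) < poissonRate q a) {n : ℕ} (hn : 0 < n) {r : ℝ≥0}
    (hr : r ≤ n * q) :
    poissonMeasure r {k | (k / n : ℝ) ∈ F ∧ q ≤ (k / n : ℝ)}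
      ≤ ENNReal.ofReal (Real.exp (-(n * c))) := by
  have hn' : (0 : ℝ) < n := by exact_mod_cast hn
  rcases (F ∩ Set.Ici q).eq_empty_or_nonempty with he | hne
  · have : {k : ℕ | (k / n : ℝ) ∈ F ∧ q ≤ (k / n : ℝ)} = ∅ :=
      Set.eq_empty_of_forall_notMem fun k hk => by
        have : (k / n : ℝ) ∈ F ∩ Set.Ici q := hk
        rw [he] at this
        exact this
    rw [this, measure_empty]
    exact zero_le
  have hbdd : BddBelow (F ∩ Set.Ici q) := ⟨q, fun a ha => ha.2⟩
  obtain ⟨hbF, hbq⟩ := (hF.inter isClosed_Ici).csInf_mem hne hbdd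
  obtain ⟨θ, hθ, h⟩ := exists_nonneg_tilt hq hbq (hc _ hbF hbq)
  refine (measure_mono ?_).trans ((poissonMeasure_tilt_le r θ (n * sInf (F ∩ Set.Ici q))).trans
    (ENNReal.ofReal_le_ofReal (Real.exp_le_exp.2 ?_)))
  · intro k hk
    have := csInf_le hbdd hk
    rw [le_div_iff₀ hn', mul_comm] at this
    exact mul_le_mul_of_nonneg_left this hθ
  · have h1 := Real.one_le_exp hθ
    nlinarith

/-- A crude Stirling bound; the spare `log k` is negligible after division by `n`. -/
theorem log_factorial_le {k : ℕ} (hk : 1 ≤ k) :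
    Real.log k.factorial ≤ 1 + (k + 1) * Real.log k - k := by
  induction k, hk using Nat.le_induction with
  | base => simp
  | succ k hk ih =>
    have hk' : (0 : ℝ) < k := by exact_mod_cast hk
    have h1 : Real.log (k / (k + 1)) ≤ k / (k + 1) - 1 := Real.log_le_sub_one_of_pos (by positivity)
    rw [Real.log_div hk'.ne' (by positivity)] at h1
    have h2 := mul_le_mul_of_nonneg_left h1 (show (0 : ℝ) ≤ k + 1 by positivity)
    have h3 : ((k : ℝ) + 1) * (k / (k + 1) - 1) = -1 := by field_simp; ring
    rw [h3] at h2
    rw [Nat.factorial_succ, Nat.cast_mul, Real.log_mul (by positivity) (by positivity)]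
    push_cast
    linarith

/-- For means between `n α` and `n β`, the factor `e ^ (-r)` is worst at `n β` and `r ^ k` at `n α`.
Bounding them separately yields uniformity in `r`, at the price of the mixed exponent `β - a + a log
(a / α)`. -/
theorem eventually_exp_le_poisson_weight {α β a L : ℝ} (hα : 0 < α) (ha : 0 < a)
    (hL : β - a + a * Real.log (a / α) < L) :
    ∀ᶠ n : ℕ in atTop, ∀ r : ℝ≥0, n * α ≤ r → r ≤ n * β →
      ENNReal.ofReal (Real.exp (-(n * L))) ≤ poissonMeasure r {⌊n * a⌋₊} := by
  have hx : Tendsto (fun n : ℕ => ((⌊(n : ℝ) * a⌋₊ : ℕ) : ℝ) / n) atTop (𝓝 a) := by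
    have := (tendsto_nat_floor_mul_div_atTop ha.le).comp (tendsto_natCast_atTop_atTop (R := ℝ))
    simpa [Function.comp_def, mul_comm] using this
  have hlog : Tendsto (fun n : ℕ => Real.log n / (n : ℝ)) atTop (𝓝 0) :=
    (Real.isLittleO_log_id_atTop.tendsto_div_nhds_zero).comp (tendsto_natCast_atTop_atTop (R := ℝ))
  have hinv : Tendsto (fun n : ℕ => (1 : ℝ) / n) atTop (𝓝 0) := tendsto_const_div_atTop_nhds_zero_nat 1
  have hlim : Tendsto (fun n : ℕ => β
      - ((⌊(n : ℝ) * a⌋₊ : ℕ) : ℝ) / n * (Real.log α - Real.log (((⌊(n : ℝ) * a⌋₊ : ℕ) : ℝ) / n) + 1)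
      + 1 / n + (Real.log (((⌊(n : ℝ) * a⌋₊ : ℕ) : ℝ) / n) * (1 / n) + Real.log n / n)) atTop
      (𝓝 (β - a * (Real.log α - Real.log a + 1) + 0 + (Real.log a * 0 + 0))) :=
    ((tendsto_const_nhds.sub (hx.mul ((tendsto_const_nhds.sub (hx.log ha.ne')).add_const 1))).add
      hinv).add (((hx.log ha.ne').mul hinv).add hlog)
  have hlt : β - a * (Real.log α - Real.log a + 1) + 0 + (Real.log a * 0 + 0) < L := by
    rw [Real.log_div ha.ne' hα.ne'] at hL
    linarith
  filter_upwards [hlim.eventually_lt_const hlt, hx.eventually_const_lt ha, eventually_gt_atTop 0]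
    with n hn hk hn0 r hr1 hr2
  have hn' : (0 : ℝ) < n := by exact_mod_cast hn0
  set k := ⌊(n : ℝ) * a⌋₊ with hkdef
  have hk' : (0 : ℝ) < k := by
    by_contra! h
    exact absurd hk (not_lt.2 (div_nonpos_of_nonpos_of_nonneg h hn'.le))
  have hk1 : 1 ≤ k := by exact_mod_cast hk'
  have hr0 : (0 : ℝ) < r := lt_of_lt_of_le (by positivity) hr1
  rw [poissonMeasure_singleton]
  refine ENNReal.ofReal_le_ofReal ?_
  rw [← Real.log_le_log_iff (Real.exp_pos _) (by positivity), Real.log_exp,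
    Real.log_div (by positivity) (by positivity), Real.log_mul (Real.exp_pos _).ne' (by positivity),
    Real.log_exp, Real.log_pow]
  have h1 : Real.log n + Real.log α ≤ Real.log r := by
    rw [← Real.log_mul hn'.ne' hα.ne']
    exact Real.log_le_log (by positivity) hr1
  have h2 := log_factorial_le hk1
  have h3 := mul_le_mul_of_nonneg_left h1 hk'.le
  rw [Real.log_div hk'.ne' hn'.ne'] at hn
  have h4 := mul_lt_mul_of_pos_left hn hn'
  have h5 : (n : ℝ) * (β - (k : ℝ) / n * (Real.log α - (Real.log k - Real.log n) + 1) + 1 / n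
      + ((Real.log k - Real.log n) * (1 / n) + Real.log n / n))
      = n * β - k * (Real.log α - (Real.log k - Real.log n) + 1) + 1 + Real.log k := by
    field_simp
    ring
  rw [h5] at h4
  nlinarith

/-- Local lower bound, uniform over a neighbourhood of the parameter. -/
theorem exists_eventually_exp_le_poisson_weight {γ a ε : ℝ} (hγ : 0 < γ) (ha : 0 < a)
    (hε : 0 < ε) : ∃ δ > 0, ∀ᶠ n : ℕ in atTop, ∀ r : ℝ≥0, n * (γ - δ) ≤ r → r ≤ n * (γ + δ) →
      ENNReal.ofReal (Real.exp (-(n * (γ - a + a * Real.log (a / γ) + ε))))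
        ≤ poissonMeasure r {⌊n * a⌋₊} := by
  -- With `α = γ - δ` and `β = γ + δ`, the mixed exponent tends to the true rate as `δ → 0`, so some
  -- positive `δ` loses less than `ε`.
  have hlim : Tendsto (fun δ : ℝ => γ + δ - a + a * Real.log (a / (γ - δ))) (𝓝 0)
      (𝓝 (γ + 0 - a + a * Real.log (a / (γ - 0)))) := by
    have h1 : Tendsto (fun δ : ℝ => γ - δ) (𝓝 0) (𝓝 (γ - 0)) := tendsto_const_nhds.sub tendsto_id
    refine ((tendsto_const_nhds.add tendsto_id).sub_const a).add (Tendsto.const_mul a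
      (Tendsto.log (tendsto_const_nhds.div h1 (by simpa using hγ.ne')) ?_))
    rw [sub_zero]
    positivity
  rw [add_zero, sub_zero] at hlim
  have h := (hlim.eventually_lt_const (lt_add_of_pos_right _ hε)).and (eventually_lt_nhds hγ)
  obtain ⟨δ, ⟨h1, h2⟩, hδ⟩ := ((h.filter_mono nhdsWithin_le_nhds).and
    (self_mem_nhdsWithin (a := (0 : ℝ)) (s := Set.Ioi 0))).exists
  exact ⟨δ, hδ, eventually_exp_le_poisson_weight (sub_pos.2 h2) ha h1⟩

/-! ### Large deviations of the mixed Poisson counts -/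

section MixedPoissonLDP

set_option linter.unusedSectionVars false

variable {Ω : Type*} [MeasurableSpace Ω] {P : Measure Ω} [IsProbabilityMeasure P]
  {E : Type*} [Fintype E] [DecidableEq E] [TopologicalSpace E] [DiscreteTopology E]
  [MeasurableSpace E] [DiscreteMeasurableSpace E] {Q : Matrix E E ℝ} {J : ℝ≥0 → Ω → E}
  {σ z : ℕ → Ω → ℝ}

theorem phi_const_mul (n : ℕ) (lam kap mu : E → ℝ≥0) (t : ℝ≥0) (f : ℝ≥0 → E) :
    phi (fun x => (n : ℝ≥0) * lam x) kap mu t f = n * phi lam kap mu t f := by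
  unfold phi
  rw [← intervalIntegral.integral_const_mul]
  refine intervalIntegral.integral_congr fun s _ => ?_
  push_cast
  ring

/-- The optimal parameter is the projection of `a` onto `[p, q]`. It vanishes only for `q = 0`,
where the rate at `a > 0` is infinite. -/
theorem exists_mixedPoissonRate_Icc_eq {p q a : ℝ} (hp : 0 ≤ p) (hpq : p ≤ q) (ha : 0 < a)
    (hfin : mixedPoissonRate (Set.Icc p q) (supportRate (Set.Icc p q)) a ≠ ⊤) :
    ∃ γ ∈ Set.Icc p q, 0 < γ ∧
      mixedPoissonRate (Set.Icc p q) (supportRate (Set.Icc p q)) a = poissonRate γ a := by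
  rcases le_total a p with h | h
  · exact ⟨p, ⟨le_rfl, hpq⟩, ha.trans_le h, mixedPoissonRate_Icc_of_le hpq ⟨ha.le, h⟩⟩
  rcases le_total a q with h' | h'
  · exact ⟨a, ⟨h, h'⟩, ha, by rw [mixedPoissonRate_Icc_of_mem hp ⟨h, h'⟩, poissonRate_self ha.le]⟩
  · refine ⟨q, ⟨hpq, le_rfl⟩, lt_of_le_of_ne (hp.trans hpq) fun hq => hfin ?_,
      mixedPoissonRate_Icc_of_ge hp hpq h'⟩
    rw [mixedPoissonRate_Icc_of_ge hp hpq h', ← hq]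
    simp [poissonRate, ha.not_gt, ha.ne']

theorem IsQueueDriver.map_numJobs_div_apply (h : IsQueueDriver P J σ z) (hJ : IsMarkovChain P Q J)
    (lam kap mu : E → ℝ≥0) (t : ℝ≥0) (n : ℕ) {B : Set ℝ} (hB : MeasurableSet B) :
    P.map (fun ω => (numJobs (fun x => (n : ℝ≥0) * lam x) kap mu (fun s => J s ω)
        (fun k => σ k ω) (fun k => z k ω) t : ℝ) / n) B
      = ∫⁻ ω, poissonMeasure (n * phi lam kap mu t fun s => J s ω).toNNReal
          {k | (k / n : ℝ) ∈ B} ∂P := by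
  have hN := h.aemeasurable_numJobs hJ.measurable hJ.cadlag (fun x => (n : ℝ≥0) * lam x) kap mu t
  have hdiv : Measurable fun x : ℝ => x / n := measurable_id.div_const _
  have hmap := AEMeasurable.map_map_of_aemeasurable hdiv.aemeasurable hN
  rw [Function.comp_def] at hmap
  rw [← hmap, Measure.map_apply hdiv hB,
    h.map_numJobs_apply hJ.measurable hJ.cadlag _ kap mu t (hdiv hB)]
  simp_rw [phi_const_mul]
  rfl

/-- The Chernoff bounds hold for every value of the parameter, so integrating over the background
loses nothing. `F` misses `[p, q]`, where the rate is `0`, leaving two tails and hence the factor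
`2`. -/
theorem IsQueueDriver.map_numJobs_div_le (h : IsQueueDriver P J σ z) (hJ : IsMarkovChain P Q J)
    (lam kap mu : E → ℝ≥0) (t : ℝ≥0) {p q : ℝ} (hp : 0 ≤ p) (hpq : p ≤ q)
    (hphi : ∀ ω, phi lam kap mu t (fun s => J s ω) ∈ Set.Icc p q) {F : Set ℝ} (hF : IsClosed F)
    {c : ℝ≥0}
    (hc : ∀ a ∈ F, (c : ℝ≥0∞) < mixedPoissonRate (Set.Icc p q) (supportRate (Set.Icc p q)) a)
    {n : ℕ} (hn : 0 < n) :
    P.map (fun ω => (numJobs (fun x => (n : ℝ≥0) * lam x) kap mu (fun s => J s ω)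
        (fun k => σ k ω) (fun k => z k ω) t : ℝ) / n) F
      ≤ ENNReal.ofReal (2 * Real.exp (-(n * c))) := by
  rw [h.map_numJobs_div_apply hJ lam kap mu t n hF.measurableSet]
  refine (lintegral_mono fun ω => ?_).trans_eq
    (by rw [lintegral_const, measure_univ, mul_one])
  have hpos : 0 ≤ (n : ℝ) * phi lam kap mu t fun s => J s ω :=
    mul_nonneg n.cast_nonneg (phi_nonneg lam kap mu t _)
  have hsub : {k : ℕ | (k / n : ℝ) ∈ F} ⊆ {k : ℕ | (k / n : ℝ) ∈ F ∧ (k / n : ℝ) ≤ p}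
      ∪ {k : ℕ | (k / n : ℝ) ∈ F ∧ q ≤ (k / n : ℝ)} := by
    intro k hk
    rcases le_total (k / n : ℝ) p with h1 | h1
    · exact Or.inl ⟨hk, h1⟩
    rcases le_total q (k / n : ℝ) with h2 | h2
    · exact Or.inr ⟨hk, h2⟩
    · have := hc _ hk
      rw [mixedPoissonRate_Icc_of_mem hp ⟨h1, h2⟩] at this
      exact absurd this not_lt_zero
  have hlow : ∀ a ∈ F, a ≤ p → (c : ℝ≥0∞) < poissonRate p a := fun a ha hap => by
    rcases lt_or_ge a 0 with h0 | h0
    · rw [poissonRate_of_neg h0]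
      exact ENNReal.coe_lt_top
    · rw [← mixedPoissonRate_Icc_of_le hpq ⟨h0, hap⟩]
      exact hc a ha
  have hup : ∀ a ∈ F, q ≤ a → (c : ℝ≥0∞) < poissonRate q a := fun a ha haq => by
    rw [← mixedPoissonRate_Icc_of_ge hp hpq haq]
    exact hc a ha
  calc _ ≤ _ := measure_mono hsub
    _ ≤ _ := measure_union_le _ _
    _ ≤ ENNReal.ofReal (Real.exp (-(n * c))) + ENNReal.ofReal (Real.exp (-(n * c))) :=
        add_le_add
          (poissonMeasure_lower_tail_le hp hF hlow hn (by
            rw [Real.coe_toNNReal _ hpos]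
            exact mul_le_mul_of_nonneg_left (hphi ω).1 n.cast_nonneg))
          (poissonMeasure_upper_tail_le (hp.trans hpq) hF hup hn (by
            rw [Real.coe_toNNReal _ hpos]
            exact mul_le_mul_of_nonneg_left (hphi ω).2 n.cast_nonneg))
    _ = _ := by rw [← ENNReal.ofReal_add (by positivity) (by positivity), two_mul]

/-- Restricting to the event that the parameter is within `δ` of `γ` costs only its probability,
which does not depend on `n` and serves as the constant `C`. -/
theorem IsQueueDriver.le_map_numJobs_div (h : IsQueueDriver P J σ z) (hJ : IsMarkovChain P Q J)
    (lam kap mu : E → ℝ≥0) (t : ℝ≥0) {G : Set ℝ} (hG : IsOpen G) {γ δ L : ℝ}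
    (hpos : 0 < P.map (fun ω => phi lam kap mu t fun s => J s ω) (Metric.ball γ δ))
    (hL : ∀ᶠ n : ℕ in atTop, ∀ r : ℝ≥0, n * (γ - δ) ≤ r → r ≤ n * (γ + δ) →
      ENNReal.ofReal (Real.exp (-(n * L))) ≤ poissonMeasure r {k | (k / n : ℝ) ∈ G}) :
    ∃ C : ℝ, 0 < C ∧ ∀ᶠ n : ℕ in atTop, ENNReal.ofReal (C * Real.exp (-(n * L)))
      ≤ P.map (fun ω => (numJobs (fun x => (n : ℝ≥0) * lam x) kap mu (fun s => J s ω)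
        (fun k => σ k ω) (fun k => z k ω) t : ℝ) / n) G := by
  have hphi := measurable_phi hJ.measurable_uncurry lam kap mu t
  rw [Measure.map_apply hphi Metric.isOpen_ball.measurableSet] at hpos
  set A := (fun ω => phi lam kap mu t fun s => J s ω) ⁻¹' Metric.ball γ δ with hA
  have hAm : MeasurableSet A := hphi Metric.isOpen_ball.measurableSet
  refine ⟨(P A).toReal, ENNReal.toReal_pos hpos.ne' (measure_ne_top _ _), ?_⟩
  filter_upwards [hL] with n hn
  rw [h.map_numJobs_div_apply hJ lam kap mu t n hG.measurableSet,
    ENNReal.ofReal_mul ENNReal.toReal_nonneg, ENNReal.ofReal_toReal (measure_ne_top _ _), mul_comm,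
    ← setLIntegral_const]
  refine (setLIntegral_mono' hAm fun ω hω => hn _ ?_ ?_).trans (setLIntegral_le_lintegral _ _)
  all_goals
    rw [Real.coe_toNNReal _ (mul_nonneg n.cast_nonneg (phi_nonneg lam kap mu t _))]
    refine mul_le_mul_of_nonneg_left ?_ n.cast_nonneg
    have := abs_lt.1 (show |phi lam kap mu t (fun s => J s ω) - γ| < δ from hω)
    linarith

/-- The large deviations principle for the scaled number of jobs. -/
theorem IsQueueDriver.satisfiesLDP (h : IsQueueDriver P J σ z) (hJ : IsMarkovChain P Q J)
    (lam kap mu : E → ℝ≥0) (t : ℝ≥0) {p q : ℝ} (hp : 0 ≤ p) (hpq : p ≤ q)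
    (hphi : ∀ ω, phi lam kap mu t (fun s => J s ω) ∈ Set.Icc p q)
    (hpos : ∀ γ ∈ Set.Icc p q, ∀ δ : ℝ, 0 < δ →
      0 < P.map (fun ω => phi lam kap mu t fun s => J s ω) (Metric.ball γ δ)) :
    SatisfiesLDP (fun n : ℕ => P.map fun ω =>
        (numJobs (fun x => (n : ℝ≥0) * lam x) kap mu (fun s => J s ω)
          (fun k => σ k ω) (fun k => z k ω) t : ℝ) / n)
      (mixedPoissonRate (Set.Icc p q) (supportRate (Set.Icc p q))) := by
  refine SatisfiesLDP.of_exp_bounds (fun n s => ?_)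
    (lowerSemicontinuous_mixedPoissonRate_Icc hp hpq) (fun F hF c hc => ?_)
    (fun G hG a ha hfin ε hε => ?_)
  · have := Measure.isProbabilityMeasure_map ((h.aemeasurable_numJobs hJ.measurable hJ.cadlag
      (fun x => (n : ℝ≥0) * lam x) kap mu t).div_const n)
    exact prob_le_one
  · exact ⟨2, two_pos, (eventually_gt_atTop 0).mono fun n hn =>
      h.map_numJobs_div_le hJ lam kap mu t hp hpq hphi hF hc hn⟩
  rcases lt_trichotomy a 0 with h0 | rfl | h0
  · exact absurd (mixedPoissonRate_Icc_of_neg h0) hfin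
  -- At `a = 0` the cheapest way is an empty system under the smallest parameter `p`, with
  -- probability `e ^ (-r)`; the logarithmic estimate for positive `a` does not apply here.
  · rw [mixedPoissonRate_Icc_of_le hpq ⟨le_rfl, hp⟩]
    refine h.le_map_numJobs_div hJ lam kap mu t hG (hpos p ⟨le_rfl, hpq⟩ ε hε)
      (Eventually.of_forall fun n r _ hr => ?_)
    have hzero : (poissonRate p 0).toReal = p := by simp [poissonRate, hp]
    calc ENNReal.ofReal (Real.exp (-(n * ((poissonRate p 0).toReal + ε))))
        ≤ poissonMeasure r {0} := by
          rw [hzero, poissonMeasure_singleton]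
          refine ENNReal.ofReal_le_ofReal ?_
          simpa using hr
      _ ≤ _ := measure_mono (by simpa using ha)
  · obtain ⟨γ, hγ, hγ0, hI⟩ := exists_mixedPoissonRate_Icc_eq hp hpq h0 hfin
    obtain ⟨δ, hδ, hev⟩ := exists_eventually_exp_le_poisson_weight hγ0 h0 hε
    refine h.le_map_numJobs_div hJ lam kap mu t hG (hpos γ hγ δ hδ) ?_
    have hx : Tendsto (fun n : ℕ => ((⌊(n : ℝ) * a⌋₊ : ℕ) : ℝ) / n) atTop (𝓝 a) := by
      have := (tendsto_nat_floor_mul_div_atTop h0.le).comp (tendsto_natCast_atTop_atTop (R := ℝ))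
      simpa [Function.comp_def, mul_comm] using this
    filter_upwards [hev, hx.eventually_mem (hG.mem_nhds ha)] with n hn hxn r hr1 hr2
    refine le_trans (ENNReal.ofReal_le_ofReal (Real.exp_le_exp.2 (neg_le_neg ?_)))
      ((hn r hr1 hr2).trans (measure_mono (Set.singleton_subset_iff.2 hxn)))
    -- Passing through `ENNReal.ofReal` clips the exponent at `0`, which can only increase it.
    refine mul_le_mul_of_nonneg_left (add_le_add_left ?_ ε) n.cast_nonneg
    rw [hI, poissonRate_of_nonneg h0.le hγ0, ENNReal.toReal_ofReal']
    exact le_max_left _ _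

end MixedPoissonLDP

/-! ### The theorem for the modulated queue -/

theorem mainTheorem5 {Ω : Type*} [MeasurableSpace Ω] (P : Measure Ω) [IsProbabilityMeasure P]
    {d : ℕ} (Q : Matrix (Fin d) (Fin d) ℝ) (hQ : IsGeneratorMatrix Q)
    (hirr : IsIrreducibleGenerator Q)
    (J : ℝ≥0 → Ω → Fin d) (hJ : IsMarkovChain P Q J)
    (σ z : ℕ → Ω → ℝ) (hdrive : IsQueueDriver P J σ z)
    (lam kap mu : Fin d → ℝ≥0) (t : ℝ≥0) :
    ∃ aMinus aPlus : ℝ,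
      IsGLB (phi lam kap mu t '' {g | IsCadlagPath g}) aMinus ∧
      IsLUB (phi lam kap mu t '' {g | IsCadlagPath g}) aPlus ∧
      0 ≤ aMinus ∧ aMinus ≤ aPlus ∧
      -- the background process is not scaled, so the laws of the normalized parameter are constant
      attainableSet (fun _ => P.map fun ω => phi lam kap mu t fun s => J s ω)
        = Set.Icc aMinus aPlus ∧
      ∃ ψ I : ℝ → ℝ≥0∞,
        SatisfiesLDP (fun _ => P.map fun ω => phi lam kap mu t fun s => J s ω) ψ ∧
        I = mixedPoissonRate
          (attainableSet (fun _ => P.map fun ω => phi lam kap mu t fun s => J s ω)) ψ ∧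
        SatisfiesLDP
          (fun n : ℕ => P.map fun ω =>
            (numJobs (fun x => (n : ℝ≥0) * lam x) kap mu (fun s => J s ω)
              (fun k => σ k ω) (fun k => z k ω) t : ℝ) / n) I ∧
        (∀ a, a < 0 → I a = ⊤) ∧
        (∀ a ∈ Set.Icc 0 aMinus, I a = poissonRate aMinus a) ∧
        (∀ a ∈ Set.Icc aMinus aPlus, I a = 0) ∧
        (∀ a, aPlus ≤ a → I a = poissonRate aPlus a) := by
  -- The state space is not assumed nonempty; a realized path of `J` provides a càdlàg path.
  have hne : (phi lam kap mu t '' {g | IsCadlagPath g}).Nonempty := by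
    obtain ⟨ω⟩ := nonempty_of_isProbabilityMeasure P
    exact ⟨_, _, hJ.cadlag ω, rfl⟩
  obtain ⟨C, hC⟩ := exists_phi_le lam kap mu t
  obtain ⟨p, hp⟩ : ∃ p, IsGLB (phi lam kap mu t '' {g | IsCadlagPath g}) p :=
    ⟨_, isGLB_csInf hne ⟨0, Set.forall_mem_image.2 fun f _ => phi_nonneg lam kap mu t f⟩⟩
  obtain ⟨q, hq⟩ : ∃ q, IsLUB (phi lam kap mu t '' {g | IsCadlagPath g}) q :=
    ⟨_, isLUB_csSup hne ⟨C, Set.forall_mem_image.2 fun f _ => hC f⟩⟩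
  have hp0 : 0 ≤ p := hp.2 (Set.forall_mem_image.2 fun f _ => phi_nonneg lam kap mu t f)
  have hpq : p ≤ q := isGLB_le_isLUB hp hq hne
  have hphi : ∀ ω, phi lam kap mu t (fun s => J s ω) ∈ Set.Icc p q := fun ω =>
    ⟨hp.1 ⟨_, hJ.cadlag ω, rfl⟩, hq.1 ⟨_, hJ.cadlag ω, rfl⟩⟩
  have hpos : ∀ γ ∈ Set.Icc p q, ∀ δ : ℝ, 0 < δ →
      0 < P.map (fun ω => phi lam kap mu t fun s => J s ω) (Metric.ball γ δ) := fun γ hγ δ hδ =>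
    hJ.map_phi_ball_pos_of_mem_Icc hQ hirr lam kap mu t hp hq hγ hδ
  have hR := hJ.attainableSet_eq hQ hirr lam kap mu t hp hq hp0
  have := Measure.isProbabilityMeasure_map
    (measurable_phi hJ.measurable_uncurry lam kap mu t).aemeasurable (μ := P)
  refine ⟨p, q, hp, hq, hp0, hpq, hR, supportRate (Set.Icc p q),
    mixedPoissonRate (Set.Icc p q) (supportRate (Set.Icc p q)),
    satisfiesLDP_const isClosed_Icc (hJ.map_phi_compl_Icc lam kap mu t hp hq) hpos, by rw [hR],
    hdrive.satisfiesLDP hJ lam kap mu t hp0 hpq hphi hpos,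
    fun a ha => mixedPoissonRate_Icc_of_neg ha, fun a ha => mixedPoissonRate_Icc_of_le hpq ha,
    fun a ha => mixedPoissonRate_Icc_of_mem hp0 ha,
    fun a ha => mixedPoissonRate_Icc_of_ge hp0 hpq ha⟩
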